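/- \textbf{Setting.} Let $A$ be a regular noetherian ring, $U=\operatorname{Spec}A$, and let $f_1,\dots,f_n\in A$ be such that the divisor $D=V(f_1\cdots f_n)\subset U$ has strict normal crossings, $f_1,\dots,f_n$ are part of a minimal system of generators of the maximal ideal of $A_p$ for some point $p\in U$, and all $V(f_i : i\in I)$, $I\subseteq\{1,\dots,n\}$ (including $I=\emptyset$), are irreducible. We consider stratifications $\mathcal P$ of $U$, i.e. decompositions of $U$ into finitely many disjoint nonempty strata such that the closure of each stratum is a union of strata, in which every stratum is of the form $$Y=Y_{I,J}=V(f_i : i\in I)\setminus V\bigl(\textstyle\prod_{j\in J}f_j\bigr),\qquad I,J\subseteq\{1,\dots,n\}$$ (not necessarily $I\cup J=\{1,\dots,n\}$). The set $\mathcal P$ is partially ordered by $Z\le Y$ iff $Z\subseteq\overline Y$. Let $S$ be its semi-simplicial nerve, and let $\int S$ be the category whose objects are the finite nonempty chains $Y_1>\dots>Y_k$ in $\mathcal P$ and whose morphisms $\xi\to\xi'$ are the strictly increasing maps of index sets such that the corresponding face of $\xi'$ is $\xi$. Let $R:\int S\to\{\text{commutative rings}\}$ be the functor $(Y_1>\dots>Y_k)\mapsto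 R_{Y_1,\dots,Y_k}$, where inductively, for $Y_1=Y_{I,J}$, $$R_{Y_1,\dots,Y_k}=\lim_l\; R_{Y_2,\dots,Y_k}[f_j^{-1} : j\in J]\,/\,(f_i : i\in I)^l ,$$ the ring of the empty chain being $A$; the transition maps are the canonical ones, generated by the structure maps of these localizations and completions and by their functoriality. A \emph{module over $(\int S,R)$} consists of an $R_\xi$-module $M_\xi$ for each $\xi\in\int S$ and of $R_\rho$-semilinear maps $M_\rho:M_\xi\to M_{\xi'}$ for $\rho:\xi\to\xi'$, functorial in $\rho$. It is \emph{finitely generated} if all $M_\xi$ are finitely generated, and \emph{coCartesian} if all induced maps $R_{\xi'}\otimes_{R_\xi}M_\xi\to M_{\xi'}$ are isomorphisms. \textbf{Lemma.} Let $\mathcal P'$ be a refinement of $\mathcal P$ in which exactly one stratum $Y=Y_{I,J}$ of $\mathcal P$ is split into the two strata $Y'=Y\cap V(f)=Y_{I\cup\{i\},J}$ and $Y''=Y\setminus Y'=Y_{I,J\cup\{i\}}$, where $f=f_i$. Let $\nu:\mathcal P'\to\mathcal P$ be the induced map of partially ordered sets, let $S',R'$ be the nerve and the ring-valued functor of $\mathcal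 P'$, and let $\nu:\int S'\to\int S$ be the induced functor $(Y_1>\dots>Y_k)\mapsto(\nu(Y_1)>\dots>\nu(Y_k))$, double entries being deleted. Then: \begin{enumerate} \item $\nu:\int S'\to\int S$ is a Grothendieck fibration. \item The pull-back functor $M\mapsto\bigl(\xi\mapsto R'_\xi\otimes_{R_{\nu\xi}}M_{\nu\xi}\bigr)$ along the canonical ring maps $R_{\nu\xi}\to R'_\xi$ is an equivalence from the category of finitely generated coCartesian modules over $(\int S,R)$ to the category of finitely generated coCartesian modules over $(\int S',R')$. \end{enumerate} -/

import Mathlib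

open CategoryTheory
universe u v w

namespace FormalDescent

section BaseChange

variable {R R' R'' : Type u} [CommRing R] [CommRing R'] [CommRing R'']

/-- The extension of scalars `R' ⊗[R] M` of an `R`-module `M` along a ring homomorphism
`φ : R → R'`. -/
def BaseChange (φ : R →+* R') (M : Type u) [AddCommGroup M] [Module R M] : Type u :=
  @TensorProduct R _ R' M _ _ φ.toAlgebra.toModule _

namespace BaseChange

variable (φ : R →+* R') (M : Type u) [AddCommGroup M] [Module R M]

noncomputable instance : AddCommGroup (BaseChange φ M) :=
  @TensorProduct.addCommGroup R _ R' M _ _ φ.toAlgebra.toModule _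

noncomputable instance : Module R' (BaseChange φ M) :=
  let := φ.toAlgebra
  (TensorProduct.leftModule : Module R' (TensorProduct R R' M))

variable {M}

/-- The `φ`-semilinear map `m ↦ 1 ⊗ m`. -/
noncomputable def unit : M →ₛₗ[φ] BaseChange φ M :=
  letI := φ.toAlgebra
  { toFun := fun m => (TensorProduct.tmul R (1 : R') m : TensorProduct R R' M)
    map_add' := fun x y => TensorProduct.tmul_add _ x y
    map_smul' := fun r x => by
      change TensorProduct.tmul R (1 : R') (r • x) = φ r • (TensorProduct.tmul R (1 : R') x)
      rw [TensorProduct.tmul_smul, TensorProduct.smul_tmul', TensorProduct.smul_tmul',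
        Algebra.smul_def, smul_eq_mul]
      rfl }

variable {φ} {N : Type u} [AddCommGroup N] [Module R' N]

/-- The `R'`-linear map `R' ⊗[R] M → N`, `r ⊗ m ↦ r • g m`, of a `φ`-semilinear map
`g : M → N`. -/
noncomputable def lift (g : M →ₛₗ[φ] N) : BaseChange φ M →ₗ[R'] N :=
  letI := φ.toAlgebra
  letI : Module R N := Module.compHom N φ
  haveI : IsScalarTower R R' N := ⟨fun r s x => by
    change (φ r * s) • x = φ r • (s • x)
    rw [mul_smul]⟩
  TensorProduct.AlgebraTensorModule.lift
    (LinearMap.toSpanSingleton R' (M →ₗ[R] N)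
      { toFun := g
        map_add' := g.map_add
        map_smul' := fun r x => g.map_smulₛₗ r x })

@[simp] theorem lift_unit (g : M →ₛₗ[φ] N) (m : M) : lift g (unit φ m) = g m := by
  let := φ.toAlgebra
  let : Module R N := Module.compHom N φ
  have : IsScalarTower R R' N := ⟨fun r s x => by
    change (φ r * s) • x = φ r • (s • x)
    rw [mul_smul]⟩
  change (1 : R') • g m = g m
  exact one_smul _ _

theorem induction {p : BaseChange φ M → Prop} (h0 : p 0) (h1 : ∀ m, p (unit φ m))
    (hs : ∀ (r : R') x, p x → p (r • x)) (ha : ∀ x y, p x → p y → p (x + y))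
    (z : BaseChange φ M) : p z := by
  let := φ.toAlgebra
  refine TensorProduct.induction_on (motive := p) z h0 (fun r m => ?_) ha
  have h2 := hs r _ (h1 m)
  have h3 : r • unit φ m = (TensorProduct.tmul R r m : TensorProduct R R' M) := by
    change r • (TensorProduct.tmul R (1 : R') m : TensorProduct R R' M) = _
    rw [TensorProduct.smul_tmul', smul_eq_mul, mul_one]
  exact h3 ▸ h2

theorem hom_ext {g h : BaseChange φ M →ₗ[R'] N} (H : ∀ m, g (unit φ m) = h (unit φ m)) :
    g = h := by
  refine LinearMap.ext (induction (by simp) H ?_ ?_)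
  · intro r x hx; rw [map_smul, map_smul, hx]
  · intro x y hx hy; rw [map_add, map_add, hx, hy]

theorem finite [Module.Finite R M] : Module.Finite R' (BaseChange φ M) := by
  let := φ.toAlgebra
  exact Module.Finite.base_change R R' M

/-- Functoriality of the extension of scalars: `r ⊗ m ↦ r ⊗ f m`. -/
noncomputable def map (φ : R →+* R') {M' : Type u} [AddCommGroup M'] [Module R M']
    (f : M →ₗ[R] M') : BaseChange φ M →ₗ[R'] BaseChange φ M' :=
  lift ((unit φ).comp f)

@[simp] theorem map_unit {M' : Type u} [AddCommGroup M'] [Module R M']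
    (f : M →ₗ[R] M') (m : M) : map φ f (unit φ m) = unit φ (f m) :=
  lift_unit _ m

theorem map_comp {M' M'' : Type u} [AddCommGroup M'] [Module R M'] [AddCommGroup M'']
    [Module R M''] (f : M →ₗ[R] M') (g : M' →ₗ[R] M'') :
    map φ (g.comp f) = (map φ g).comp (map φ f) :=
  hom_ext fun m => by simp

/-- The `ψ`-semilinear map `R' ⊗[R] M → Q`, `r ⊗ m ↦ ψ r • g m`, of a map `g : M → Q` which
is semilinear along `ψ ∘ φ`. -/
noncomputable def semilift {σ : R →+* R''} {ψ : R' →+* R''} (hσ : σ = ψ.comp φ)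
    {Q : Type u} [AddCommGroup Q] [Module R'' Q] (g : M →ₛₗ[σ] Q) : BaseChange φ M →ₛₗ[ψ] Q :=
  letI : Module R' Q := Module.compHom Q ψ
  letI l : BaseChange φ M →ₗ[R'] Q := lift
    { toFun := g
      map_add' := g.map_add
      map_smul' := fun r x => by subst hσ; exact g.map_smulₛₗ r x }
  { toFun := l
    map_add' := l.map_add
    map_smul' := fun r x => l.map_smul r x }

@[simp] theorem semilift_unit {σ : R →+* R''} {ψ : R' →+* R''} (hσ : σ = ψ.comp φ)
    {Q : Type u} [AddCommGroup Q] [Module R'' Q] (g : M →ₛₗ[σ] Q) (m : M) :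
    semilift hσ g (unit φ m) = g m := by
  let : Module R' Q := Module.compHom Q ψ
  exact lift_unit _ m

theorem semi_ext {ψ : R' →+* R''} {Q : Type u} [AddCommGroup Q] [Module R'' Q]
    {g h : BaseChange φ M →ₛₗ[ψ] Q} (H : ∀ m, g (unit φ m) = h (unit φ m)) (x) : g x = h x := by
  refine induction (p := fun x => g x = h x) (by simp) H ?_ ?_ x
  · intro r x hx; rw [map_smulₛₗ, map_smulₛₗ, hx]
  · intro x y hx hy; rw [map_add, map_add, hx, hy]

end BaseChange

variable {φ : R →+* R'} {ψ : R' →+* R''}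
  {M : Type u} [AddCommGroup M] [Module R M] {N : Type u} [AddCommGroup N] [Module R' N]
  {Q : Type u} [AddCommGroup Q] [Module R'' Q]

/-- A `φ`-semilinear map `g : M → N` is coCartesian if the induced map `R' ⊗[R] M → N`
is an isomorphism. -/
def IsCoCartesianMap (g : M →ₛₗ[φ] N) : Prop :=
  Function.Bijective (BaseChange.lift g)

theorem isCoCartesianMap_unit : IsCoCartesianMap (BaseChange.unit φ : M →ₛₗ[φ] _) := by
  have : BaseChange.lift (BaseChange.unit φ : M →ₛₗ[φ] _) = LinearMap.id :=
    BaseChange.hom_ext fun m => by simp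
  rw [IsCoCartesianMap, this]
  exact Function.bijective_id

/-- Descending a semilinear map along a coCartesian one. -/
theorem IsCoCartesianMap.exists_lift {g : M →ₛₗ[φ] N} (hg : IsCoCartesianMap g)
    {N' : Type u} [AddCommGroup N'] [Module R' N'] (h : M →ₛₗ[φ] N') :
    ∃ k : N →ₗ[R'] N', ∀ m, k (g m) = h m := by
  let e := LinearEquiv.ofBijective _ hg
  refine ⟨(BaseChange.lift h).comp e.symm.toLinearMap, fun m => ?_⟩
  have : e.symm (g m) = BaseChange.unit φ m := by
    rw [LinearEquiv.symm_apply_eq]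
    exact (BaseChange.lift_unit g m).symm
  simp [this]

theorem IsCoCartesianMap.hom_ext {g : M →ₛₗ[φ] N} (hg : IsCoCartesianMap g)
    {N' : Type u} [AddCommGroup N'] [Module R' N'] {h k : N →ₗ[R'] N'}
    (H : ∀ m, h (g m) = k (g m)) : h = k := by
  have : h.comp (BaseChange.lift g) = k.comp (BaseChange.lift g) :=
    BaseChange.hom_ext fun m => by simpa using H m
  ext x
  obtain ⟨y, rfl⟩ := hg.2 x
  exact DFunLike.congr_fun this y

theorem isCoCartesianMap_of_universal {g : M →ₛₗ[φ] N}
    (h1 : ∃ k : N →ₗ[R'] BaseChange φ M, ∀ m, k (g m) = BaseChange.unit φ m)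
    (h2 : ∀ k : N →ₗ[R'] N, (∀ m, k (g m) = g m) → k = LinearMap.id) :
    IsCoCartesianMap g := by
  obtain ⟨k, hk⟩ := h1
  have e1 : k.comp (BaseChange.lift g) = LinearMap.id :=
    BaseChange.hom_ext fun m => by simp [hk]
  have e2 : (BaseChange.lift g).comp k = LinearMap.id := h2 _ fun m => by simp [hk]
  exact Function.bijective_iff_has_inverse.mpr
    ⟨k, fun x => DFunLike.congr_fun e1 x, fun x => DFunLike.congr_fun e2 x⟩

theorem IsCoCartesianMap.exists_semilift {g : M →ₛₗ[φ] N} (hg : IsCoCartesianMap g)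
    {σ : R →+* R''} {ψ : R' →+* R''} (hσ : σ = ψ.comp φ) (h : M →ₛₗ[σ] Q) :
    ∃ k : N →ₛₗ[ψ] Q, ∀ m, k (g m) = h m := by
  let : Module R' Q := Module.compHom Q ψ
  obtain ⟨k, hk⟩ := hg.exists_lift (N' := Q)
    { toFun := h
      map_add' := h.map_add
      map_smul' := fun r x => by subst hσ; exact h.map_smulₛₗ r x }
  exact ⟨{ toFun := k, map_add' := k.map_add, map_smul' := fun r x => k.map_smul r x }, hk⟩

theorem IsCoCartesianMap.semi_ext {g : M →ₛₗ[φ] N} (hg : IsCoCartesianMap g)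
    {ψ : R' →+* R''} {h k : N →ₛₗ[ψ] Q} (H : ∀ m, h (g m) = k (g m)) (x : N) : h x = k x := by
  obtain ⟨y, rfl⟩ := hg.2 x
  refine BaseChange.induction (p := fun y => h (BaseChange.lift g y) = k (BaseChange.lift g y))
    (by simp) (by simpa using H) ?_ ?_ y
  · intro r x hx; rw [map_smul, map_smulₛₗ, map_smulₛₗ, hx]
  · intro x y hx hy; simp only [map_add, hx, hy]

/-- Base change along a commutative square of rings preserves coCartesian maps. -/
theorem IsCoCartesianMap.baseChange {P : Type u} [CommRing P] {a : R →+* P} {b : R' →+* R''}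
    {χ : P →+* R''} (sq : b.comp φ = χ.comp a) {g : M →ₛₗ[φ] N} (hg : IsCoCartesianMap g)
    {G : BaseChange a M →ₛₗ[χ] BaseChange b N}
    (hG : ∀ m, G (BaseChange.unit a m) = BaseChange.unit b (g m)) : IsCoCartesianMap G := by
  refine isCoCartesianMap_of_universal ?_ ?_
  · let h : M →ₛₗ[b.comp φ] BaseChange χ (BaseChange a M) :=
      { toFun := fun m => BaseChange.unit χ (BaseChange.unit a m)
        map_add' := fun x y => by simp
        map_smul' := fun r x => by rw [map_smulₛₗ, map_smulₛₗ, sq]; rfl }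
    obtain ⟨k, hk⟩ := hg.exists_semilift rfl h
    refine ⟨BaseChange.lift k, fun x => ?_⟩
    refine BaseChange.semi_ext (g := (BaseChange.lift k).comp G) (fun m => ?_) x
    simp [hG, hk, h]
  · intro k hk
    refine BaseChange.hom_ext fun n => ?_
    refine hg.semi_ext (h := k.comp (BaseChange.unit b)) (k := BaseChange.unit b) (fun m => ?_) n
    have := hk (BaseChange.unit a m)
    simpa [hG] using this

end BaseChange

/-- A module over a diagram of rings `S : I ⥤ CommRingCat`: a lift of the functor `S` to the
category of modules over varying commutative rings. -/
structure DiagramModule {I : Type w} [Category.{v} I] (S : I ⥤ CommRingCat.{u}) where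
  /-- the module over `S i` -/
  obj (i : I) : ModuleCat.{u} (S.obj i)
  /-- the transition maps -/
  map {i j : I} (ρ : i ⟶ j) : obj i →ₛₗ[(S.map ρ).hom] obj j
  map_id (i : I) (x : obj i) : map (𝟙 i) x = x
  map_comp {i j k : I} (ρ : i ⟶ j) (σ : j ⟶ k) (x : obj i) : map (ρ ≫ σ) x = map σ (map ρ x)

namespace DiagramModule

variable {I : Type w} [Category.{v} I] {S : I ⥤ CommRingCat.{u}}

/-- Morphisms of modules over a diagram of rings. -/
@[ext] structure Hom (M N : DiagramModule S) where
  /-- the linear map over `S i` -/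
  app (i : I) : M.obj i →ₗ[S.obj i] N.obj i
  naturality {i j : I} (ρ : i ⟶ j) (x : M.obj i) : app j (M.map ρ x) = N.map ρ (app i x)

instance : Category (DiagramModule S) where
  Hom := Hom
  id M := { app := fun _ => LinearMap.id, naturality := fun _ _ => rfl }
  comp a b :=
    { app := fun i => (b.app i).comp (a.app i)
      naturality := fun ρ x => by simp [a.naturality, b.naturality] }

@[simp] theorem id_app (M : DiagramModule S) (i : I) : (𝟙 M : M ⟶ M).app i = LinearMap.id := rfl

@[simp] theorem comp_app {M N Q : DiagramModule S} (a : M ⟶ N) (b : N ⟶ Q) (i : I) :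
    (a ≫ b).app i = (b.app i).comp (a.app i) := rfl

@[ext] theorem hom_ext {M N : DiagramModule S} {a b : M ⟶ N} (h : ∀ i, a.app i = b.app i) :
    a = b := Hom.ext (funext h)

/-- All transition maps are coCartesian. -/
def IsCoCartesian (M : DiagramModule S) : Prop :=
  ∀ ⦃i j : I⦄ (ρ : i ⟶ j), IsCoCartesianMap (M.map ρ)

/-- Pointwise finite generation. -/
def IsFinite (M : DiagramModule S) : Prop :=
  ∀ i : I, Module.Finite (S.obj i) (M.obj i)

variable (S) in
/-- The finitely generated coCartesian modules over `(I, S)`, as a property of objects. -/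
def finCoCart : ObjectProperty (DiagramModule S) := fun M => M.IsFinite ∧ M.IsCoCartesian

variable {J : Type w} [Category.{v} J] {T : J ⥤ CommRingCat.{u}}

section pullback

variable (α : I ⥤ J) (μ : α ⋙ T ⟶ S)

/-- The component `T (α i) → S i` of `μ`. -/
def ringMap (i : I) : T.obj (α.obj i) →+* S.obj i := (μ.app i).hom

theorem pullback_square {i j : I} (ρ : i ⟶ j) :
    (ringMap α μ j).comp (T.map (α.map ρ)).hom = (S.map ρ).hom.comp (ringMap α μ i) := by
  have := congrArg CommRingCat.Hom.hom (μ.naturality ρ)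
  simpa using! this

/-- The transition map `1 ⊗ m ↦ 1 ⊗ M(α ρ) m` of the pull-back. -/
noncomputable def pullbackMap (M : DiagramModule T) {i j : I} (ρ : i ⟶ j) :
    BaseChange (ringMap α μ i) (M.obj (α.obj i)) →ₛₗ[(S.map ρ).hom]
      BaseChange (ringMap α μ j) (M.obj (α.obj j)) :=
  BaseChange.semilift (pullback_square α μ ρ)
    { toFun := fun m => BaseChange.unit (ringMap α μ j) (M.map (α.map ρ) m)
      map_add' := fun x y => by simp
      map_smul' := fun r x => by rw [map_smulₛₗ, map_smulₛₗ]; rfl }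

@[simp] theorem pullbackMap_unit (M : DiagramModule T) {i j : I} (ρ : i ⟶ j)
    (m : M.obj (α.obj i)) :
    pullbackMap α μ M ρ (BaseChange.unit _ m) = BaseChange.unit _ (M.map (α.map ρ) m) :=
  BaseChange.semilift_unit _ _ m

/-- The pull-back of a module: `((α, μ)^* M) i = S i ⊗[T (α i)] M (α i)`. -/
noncomputable def pullbackObj (M : DiagramModule T) : DiagramModule S where
  obj i := ModuleCat.of (S.obj i) (BaseChange (ringMap α μ i) (M.obj (α.obj i)))
  map ρ := pullbackMap α μ M ρ
  map_id i x := by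
    refine BaseChange.induction (p := fun x => pullbackMap α μ M (𝟙 i) x = x) (by simp) ?_ ?_ ?_ x
    · intro m
      rw [pullbackMap_unit]
      have : ∀ (f : α.obj i ⟶ α.obj i), f = 𝟙 _ → M.map f m = m := by
        rintro _ rfl; exact M.map_id _ m
      rw [this _ (α.map_id i)]
    · intro r x hx
      rw [map_smulₛₗ, hx]; simp
    · intro x y hx hy; rw [map_add, hx, hy]
  map_comp {i j k} ρ σ x := by
    refine BaseChange.induction
      (p := fun x => pullbackMap α μ M (ρ ≫ σ) x = pullbackMap α μ M σ (pullbackMap α μ M ρ x))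
      (by simp) ?_ ?_ ?_ x
    · intro m
      simp only [pullbackMap_unit]
      have : ∀ (f : α.obj i ⟶ α.obj k), f = α.map ρ ≫ α.map σ →
          M.map f m = M.map (α.map σ) (M.map (α.map ρ) m) := by
        rintro _ rfl; exact M.map_comp _ _ m
      rw [this _ (α.map_comp ρ σ)]
    · intro r x hx
      simp only [map_smulₛₗ, hx]; simp
    · intro x y hx hy; simp only [map_add, hx, hy]

/-- The pull-back functor `(α, μ)^*` along a morphism of diagrams of rings
`(α, μ) : (I, S) ⟶ (J, T)`, where `α : I ⥤ J` and `μ : T ∘ α ⟹ S`. -/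
noncomputable def pullback : DiagramModule T ⥤ DiagramModule S where
  obj M := pullbackObj α μ M
  map {M N} a :=
    { app := fun i => BaseChange.map (ringMap α μ i) (a.app (α.obj i))
      naturality := fun {i j} ρ x => by
        refine BaseChange.semi_ext (φ := ringMap α μ i) (ψ := (S.map ρ).hom)
          (g := (BaseChange.map (ringMap α μ j) (a.app (α.obj j))).comp (pullbackMap α μ M ρ))
          (h := (pullbackMap α μ N ρ).comp (BaseChange.map (ringMap α μ i) (a.app (α.obj i))))
          (fun m => ?_) x
        simp [a.naturality] }
  map_id M := by
    ext i : 1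
    refine BaseChange.hom_ext fun m => ?_
    exact BaseChange.map_unit _ m
  map_comp a b := by
    ext i : 1
    exact BaseChange.map_comp (a.app (α.obj i)) (b.app (α.obj i))

/-- The pull-back functor on finitely generated coCartesian modules. -/
noncomputable def pullbackFinCoCart :
    (finCoCart T).FullSubcategory ⥤ (finCoCart S).FullSubcategory :=
  (finCoCart S).lift ((finCoCart T).ι ⋙ pullback α μ) fun M =>
    ⟨fun i => by
      have : Module.Finite (T.obj (α.obj i)) (M.obj.obj (α.obj i)) := M.property.1 (α.obj i)
      exact BaseChange.finite (φ := ringMap α μ i) (M := M.obj.obj (α.obj i)),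
     fun i j ρ => (M.property.2 (α.map ρ)).baseChange (pullback_square α μ ρ)
      (fun m => pullbackMap_unit α μ M.obj ρ m)⟩

end pullback
end DiagramModule

section AdicCompletion

variable {B C : Type u} [CommRing B] [CommRing C] {I : Ideal B} {J : Ideal C}

theorem evalₐ_of_le {l m : ℕ} (hlm : l ≤ m) {x : AdicCompletion I B} {y : B}
    (hy : Ideal.Quotient.mk (I ^ m) y = AdicCompletion.evalₐ I m x) :
    Ideal.Quotient.mk (I ^ l) y = AdicCompletion.evalₐ I l x := by
  induction x using AdicCompletion.induction_on with
  | _ a =>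
    rw [AdicCompletion.evalₐ_mk] at hy ⊢
    rw [Ideal.Quotient.mk_eq_mk_iff_sub_mem] at hy
    have h1 := AdicCompletion.Ideal.mk_eq_mk I hlm a
    rw [← h1, Ideal.Quotient.mk_eq_mk_iff_sub_mem]
    exact Ideal.pow_le_pow_right hlm hy

/-- Ring maps between completions that agree on the uncompleted ring are equal, if they are
continuous. -/
theorem completion_ext (hI : I.FG) {φ ψ : AdicCompletion I B →+* AdicCompletion J C}
    (H : ∀ x : B, φ (algebraMap B _ x) = ψ (algebraMap B _ x))
    (hφ : ∀ l, ∀ r ∈ I ^ l, AdicCompletion.evalₐ J l (φ (algebraMap B _ r)) = 0) : φ = ψ := by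
  ext1 x
  refine AdicCompletion.ext_evalₐ fun l => ?_
  obtain ⟨y, hy⟩ := Ideal.Quotient.mk_surjective (AdicCompletion.evalₐ I l x)
  have hz : x - algebraMap B _ y ∈ (I ^ l • ⊤ : Submodule B (AdicCompletion I B)) := by
    rw [AdicCompletion.pow_smul_top_eq_ker_eval hI, LinearMap.mem_ker,
      ← AdicCompletion.factor_evalₐ_eq_eval I _ (by simp), map_sub, ← hy]
    simp
  have key : ∀ z ∈ (I ^ l • ⊤ : Submodule B (AdicCompletion I B)),
      AdicCompletion.evalₐ J l (φ z) = AdicCompletion.evalₐ J l (ψ z) := by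
    intro z hz
    induction hz using Submodule.smul_induction_on' with
    | smul r hr t _ =>
      have h2 := hφ l r hr
      rw [Algebra.smul_def, map_mul, map_mul, map_mul, map_mul, ← H, h2, zero_mul, zero_mul]
    | add x _ y _ hx hy => simp only [map_add, hx, hy]
  have := key _ hz
  rw [map_sub, map_sub, map_sub, map_sub, ← H] at this
  exact sub_left_injective this

variable {A : Type u} [CommRing A] [Algebra A B] [Algebra A C]

theorem completionMap_aux (φ : B →ₐ[A] C) (h : ∀ l, I ^ l ≤ (J ^ l).comap φ) {l m : ℕ}
    (hlm : l ≤ m) :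
    (Ideal.Quotient.factorₐ A (Ideal.pow_le_pow_right hlm)).comp
      ((Ideal.quotientMapₐ (J ^ m) φ (h m)).comp
        ((AdicCompletion.evalₐ I m).restrictScalars A)) =
    (Ideal.quotientMapₐ (J ^ l) φ (h l)).comp ((AdicCompletion.evalₐ I l).restrictScalars A) := by
  ext x
  obtain ⟨y, hy⟩ := Ideal.Quotient.mk_surjective (AdicCompletion.evalₐ I m x)
  have hl := evalₐ_of_le hlm hy
  simp only [AlgHom.comp_apply, AlgHom.restrictScalars_apply]
  rw [← hy, ← hl]
  simp

/-- The map of completions induced by a map of algebras. -/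
noncomputable def completionMap (φ : B →ₐ[A] C) (h : ∀ l, I ^ l ≤ (J ^ l).comap φ) :
    AdicCompletion I B →ₐ[A] AdicCompletion J C :=
  AdicCompletion.liftAlgHom (R := A) J
    (fun l => (Ideal.quotientMapₐ (J ^ l) φ (h l)).comp
      ((AdicCompletion.evalₐ I l).restrictScalars A))
    (fun hlm => completionMap_aux φ h hlm)

theorem completionMap_algebraMap (φ : B →ₐ[A] C) (h : ∀ l, I ^ l ≤ (J ^ l).comap φ) (x : B) :
    completionMap φ h (algebraMap B _ x) = algebraMap C _ (φ x) := by
  refine AdicCompletion.ext_evalₐ fun l => ?_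
  rw [completionMap, AdicCompletion.evalₐ_liftAlgHom J _ (fun hlm => completionMap_aux φ h hlm),
    AlgHom.comp_apply, AlgHom.restrictScalars_apply, AlgHom.commutes, AlgHom.commutes]
  simp

end AdicCompletion

/-- Combinatorial data of a stratum `V(f i : i ∈ van) ∖ V(∏ j ∈ inv, f j)`. -/
@[ext] structure Cell (n : ℕ) where
  /-- indices of the functions that vanish -/
  van : Finset (Fin n)
  /-- indices of the functions that are invertible -/
  inv : Finset (Fin n)
deriving DecidableEq

namespace Cell

variable {n : ℕ}

/-- `a.Contains b`: at least the same functions are required to vanish, respectively to be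
invertible, on `b`. -/
def Contains (a b : Cell n) : Prop := a.van ⊆ b.van ∧ a.inv ⊆ b.inv

theorem Contains.refl (a : Cell n) : a.Contains a := ⟨subset_rfl, subset_rfl⟩

theorem Contains.trans {a b c : Cell n} (h : a.Contains b) (h' : b.Contains c) : a.Contains c :=
  ⟨h.1.trans h'.1, h.2.trans h'.2⟩

/-- Data for the stratum `Y ∩ V(f i)`. -/
def cut (Y : Cell n) (i : Fin n) : Cell n := ⟨insert i Y.van, Y.inv⟩

/-- Data for the stratum `Y ∖ V(f i)`. -/
def rest (Y : Cell n) (i : Fin n) : Cell n := ⟨Y.van, insert i Y.inv⟩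

variable {A : Type u} [CommRing A] (f : Fin n → A)

/-- The locally closed subset `V(f i : i ∈ van) ∖ V(∏ j ∈ inv, f j)` of `Spec A`. -/
def carrier (Y : Cell n) : Set (PrimeSpectrum A) :=
  PrimeSpectrum.zeroLocus (f '' Y.van) \ PrimeSpectrum.zeroLocus {∏ j ∈ Y.inv, f j}

theorem mem_carrier {Y : Cell n} {x : PrimeSpectrum A} :
    x ∈ Y.carrier f ↔ (∀ i ∈ Y.van, f i ∈ x.asIdeal) ∧ ∀ j ∈ Y.inv, f j ∉ x.asIdeal := by
  simp [carrier, PrimeSpectrum.mem_zeroLocus, Set.subset_def, x.isPrime.prod_mem_iff]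

theorem Contains.carrier_subset {a b : Cell n} (h : a.Contains b) :
    b.carrier f ⊆ a.carrier f := by
  intro x hx
  rw [mem_carrier] at hx ⊢
  exact ⟨fun i hi => hx.1 i (h.1 hi), fun i hi => hx.2 i (h.2 hi)⟩

theorem carrier_cut (Y : Cell n) (i : Fin n) :
    (Y.cut i).carrier f = Y.carrier f ∩ PrimeSpectrum.zeroLocus {f i} := by
  ext x
  simp only [mem_carrier, cut, Finset.mem_insert, forall_eq_or_imp, Set.mem_inter_iff,
    PrimeSpectrum.mem_zeroLocus, Set.singleton_subset_iff, SetLike.mem_coe]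
  tauto

theorem carrier_rest (Y : Cell n) (i : Fin n) :
    (Y.rest i).carrier f = Y.carrier f \ (Y.cut i).carrier f := by
  ext x
  simp only [mem_carrier, cut, rest, Finset.mem_insert, forall_eq_or_imp, Set.mem_sdiff]
  tauto

/-- The ideal generated by the `f i` that vanish on `Y`. -/
def ideal (Y : Cell n) (B : Type u) [CommRing B] [Algebra A B] : Ideal B :=
  (Ideal.span (f '' Y.van)).map (algebraMap A B)

theorem ideal_fg (Y : Cell n) (B : Type u) [CommRing B] [Algebra A B] : (Y.ideal f B).FG := by
  classical
  exact Ideal.FG.map ⟨Y.van.image f, by simp⟩ _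

theorem map_ideal (Y : Cell n) (B C : Type u) [CommRing B] [Algebra A B] [CommRing C]
    [Algebra A C] [Algebra B C] [IsScalarTower A B C] :
    (Y.ideal f B).map (algebraMap B C) = Y.ideal f C := by
  rw [ideal, ideal, Ideal.map_map, IsScalarTower.algebraMap_eq A B C]

/-- The localization of the `A`-algebra `B` at the `f j` that are invertible on `Y`. -/
abbrev Loc (Y : Cell n) (B : Type u) [CommRing B] [Algebra A B] : Type u :=
  Localization.Away (algebraMap A B (∏ j ∈ Y.inv, f j))

/-- The `A`-algebra `lim_l B[f j ⁻¹ : j ∈ inv] / (f i : i ∈ van) ^ l`. -/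
noncomputable def comp (Y : Cell n) (B : CommAlgCat.{u} A) : CommAlgCat.{u} A :=
  CommAlgCat.of A (AdicCompletion (Y.ideal f (Y.Loc f B)) (Y.Loc f B))

/-- The structure map `B → lim_l B[f j ⁻¹ : j ∈ inv] / (f i : i ∈ van) ^ l`. -/
noncomputable def toComp (Y : Cell n) (B : CommAlgCat.{u} A) : B →ₐ[A] Y.comp f B :=
  ((IsScalarTower.toAlgHom A (Y.Loc f B)
    (AdicCompletion (Y.ideal f (Y.Loc f B)) (Y.Loc f B)))).comp
    (IsScalarTower.toAlgHom A B (Y.Loc f B))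

variable {f}

theorem ideal_le {a b : Cell n} (h : a.Contains b) (B : Type u) [CommRing B] [Algebra A B] :
    a.ideal f B ≤ b.ideal f B :=
  Ideal.map_mono (Ideal.span_mono (Set.image_mono (by exact_mod_cast h.1)))

theorem ideal_le_comap (a : Cell n) {B C : Type u} [CommRing B] [Algebra A B]
    [CommRing C] [Algebra A C] (φ : B →ₐ[A] C) :
    a.ideal f B ≤ (a.ideal f C).comap φ := by
  rw [ideal, ideal, Ideal.map_le_iff_le_comap]
  intro x hx
  rw [Ideal.mem_comap, Ideal.mem_comap, φ.commutes]
  exact Ideal.mem_map_of_mem _ hx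

theorem pow_le_comap {a b : Cell n} (h : a.Contains b) {B C : Type u} [CommRing B] [Algebra A B]
    [CommRing C] [Algebra A C] (φ : B →ₐ[A] C) (l : ℕ) :
    a.ideal f B ^ l ≤ (b.ideal f C ^ l).comap φ := by
  refine le_trans (Ideal.pow_right_mono ?_ l) (Ideal.le_comap_pow _ l)
  exact (a.ideal_le_comap φ).trans (Ideal.comap_mono (ideal_le h C))

theorem isUnit_loc {a b : Cell n} (h : a.Contains b) (B : Type u) [CommRing B] [Algebra A B] :
    IsUnit (algebraMap A (b.Loc f B) (∏ j ∈ a.inv, f j)) := by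
  have h1 : IsUnit (algebraMap A (b.Loc f B) (∏ j ∈ b.inv, f j)) := by
    rw [IsScalarTower.algebraMap_apply A B (b.Loc f B)]
    exact IsLocalization.Away.algebraMap_isUnit _
  exact isUnit_of_dvd_unit ((algebraMap A (b.Loc f B)).map_dvd
    (Finset.prod_dvd_prod_of_subset _ _ f h.2)) h1

/-- The map of localizations induced by a map of algebras and a containment of strata. -/
noncomputable def locMap {a b : Cell n} (h : a.Contains b) {B C : Type u} [CommRing B]
    [Algebra A B] [CommRing C] [Algebra A C] (g : B →ₐ[A] C) : a.Loc f B →ₐ[A] b.Loc f C :=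
  IsLocalization.liftAlgHom (M := Submonoid.powers (algebraMap A B (∏ j ∈ a.inv, f j)))
    (f := (IsScalarTower.toAlgHom A C (b.Loc f C)).comp g) (by
      rintro ⟨_, k, rfl⟩
      have := (isUnit_loc (f := f) h C).pow k
      rw [IsScalarTower.algebraMap_apply A C (b.Loc f C)] at this
      simpa using this)

theorem locMap_algebraMap {a b : Cell n} (h : a.Contains b) {B C : Type u} [CommRing B]
    [Algebra A B] [CommRing C] [Algebra A C] (g : B →ₐ[A] C) (x : B) :
    locMap (f := f) h g (algebraMap B (a.Loc f B) x) = algebraMap C (b.Loc f C) (g x) := by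
  simp [locMap]

/-- The map `a.comp f B → b.comp f C` induced by a map of algebras `B → C` and a containment of
strata: localize and complete. -/
noncomputable def compMap {a b : Cell n} (h : a.Contains b) {B C : CommAlgCat.{u} A}
    (g : B →ₐ[A] C) : a.comp f B →ₐ[A] b.comp f C :=
  completionMap (I := a.ideal f (a.Loc f B)) (J := b.ideal f (b.Loc f C)) (locMap h g)
    (pow_le_comap h (locMap h g))

theorem compMap_toComp {a b : Cell n} (h : a.Contains b) {B C : CommAlgCat.{u} A}
    (g : B →ₐ[A] C) (x : B) : compMap (f := f) h g (a.toComp f B x) = b.toComp f C (g x) := by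
  refine (completionMap_algebraMap (I := a.ideal f (a.Loc f B)) (J := b.ideal f (b.Loc f C))
    (locMap h g) (pow_le_comap h (locMap h g)) (algebraMap B (a.Loc f B) x)).trans ?_
  rw [locMap_algebraMap]
  rfl

/-- Algebra maps from a completion to a completion along a smaller stratum are determined on the
uncompleted and unlocalized algebra. -/
theorem comp_ext {a b : Cell n} (h : a.Contains b) {B C : CommAlgCat.{u} A}
    {φ ψ : a.comp f B →ₐ[A] b.comp f C} (H : ∀ x, φ (a.toComp f B x) = ψ (a.toComp f B x)) :
    φ = ψ := by
  let L := a.Loc f B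
  let j : L →ₐ[A] a.comp f B := IsScalarTower.toAlgHom A L (AdicCompletion (a.ideal f L) L)
  have H1 : φ.comp j = ψ.comp j := by
    apply IsLocalization.algHom_ext (Submonoid.powers (algebraMap A B (∏ i ∈ a.inv, f i)))
    ext x
    exact H x
  have H2 : ∀ y : L, φ (j y) = ψ (j y) := fun y => DFunLike.congr_fun H1 y
  have := completion_ext (I := a.ideal f L) (J := b.ideal f (b.Loc f C)) (a.ideal_fg f L)
    (φ := φ.toRingHom) (ψ := ψ.toRingHom) H2 (fun l r hr => by
      let q : L →ₐ[A] b.Loc f C ⧸ b.ideal f (b.Loc f C) ^ l :=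
        ((AdicCompletion.evalₐ (b.ideal f (b.Loc f C)) l).restrictScalars A).comp (φ.comp j)
      change q r = 0
      have h1 : (a.ideal f L) ^ l ≤ RingHom.ker q := by
        refine (pow_le_comap h q l).trans ?_
        have h2 : b.ideal f (b.Loc f C ⧸ b.ideal f (b.Loc f C) ^ l) ^ l = ⊥ := by
          rw [← b.map_ideal f (b.Loc f C) (b.Loc f C ⧸ b.ideal f (b.Loc f C) ^ l), ← Ideal.map_pow]
          exact Ideal.map_quotient_self (b.ideal f (b.Loc f C) ^ l)
        rw [h2]
        exact le_rfl
      exact h1 hr)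
  exact AlgHom.coe_ringHom_injective this

theorem compMap_id (a : Cell n) (B : CommAlgCat.{u} A) :
    compMap (f := f) (Contains.refl a) (AlgHom.id A B) = AlgHom.id A (a.comp f B) :=
  comp_ext (Contains.refl a) fun x => compMap_toComp _ _ x

theorem compMap_comp {a b c : Cell n} (h : a.Contains b) (h' : b.Contains c)
    {B C D : CommAlgCat.{u} A} (g : B →ₐ[A] C) (g' : C →ₐ[A] D) :
    (compMap (f := f) h' g').comp (compMap (f := f) h g) = compMap (h.trans h') (g'.comp g) :=
  comp_ext (h.trans h') fun x => by
    rw [AlgHom.comp_apply, compMap_toComp, compMap_toComp, compMap_toComp, AlgHom.comp_apply]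

variable (f) in
/-- The ring `R_{Y₁, …, Yₖ}` of a list of strata: it is `A` for the empty list, and
`R_{Y₁, …, Yₖ} = lim_l R_{Y₂, …, Yₖ}[f j ⁻¹ : j ∈ inv] / (f i : i ∈ van) ^ l`, where `van` and `inv`
are the data of `Y₁`. -/
noncomputable def wordRing : List (Cell n) → CommAlgCat.{u} A
  | [] => CommAlgCat.of A A
  | Y :: t => Y.comp f (wordRing t)

variable (f) in
/-- The structure map `R_{Y₂, …, Yₖ} → R_{Y₁, …, Yₖ}`. -/
noncomputable def wordSkip (b : Cell n) (t : List (Cell n)) :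
    wordRing f t →ₐ[A] wordRing f (b :: t) :=
  b.toComp f (wordRing f t)

/-- Localization and completion of a map `R_{Y₂, …, Yₖ} → R_{Z₂, …, Zₗ}`, giving
`R_{Y₁, …, Yₖ} → R_{Z₁, …, Zₗ}`, if `Z₁` is contained in `Y₁`. -/
noncomputable def wordKeep {a b : Cell n} (h : a.Contains b) {s t : List (Cell n)}
    (g : wordRing f s →ₐ[A] wordRing f t) : wordRing f (a :: s) →ₐ[A] wordRing f (b :: t) :=
  compMap h g

theorem wordKeep_comp_wordSkip {a b : Cell n} (h : a.Contains b) {s t : List (Cell n)}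
    (g : wordRing f s →ₐ[A] wordRing f t) :
    (wordKeep h g).comp (wordSkip f a s) = (wordSkip f b t).comp g :=
  AlgHom.ext fun x => compMap_toComp h g x

theorem wordKeep_id (a : Cell n) (s : List (Cell n)) :
    wordKeep (Contains.refl a) (AlgHom.id A (wordRing f s)) = AlgHom.id A (wordRing f (a :: s)) :=
  compMap_id a (wordRing f s)

theorem wordKeep_comp {a b c : Cell n} (h : a.Contains b) (h' : b.Contains c)
    {s t r : List (Cell n)} (g : wordRing f s →ₐ[A] wordRing f t)
    (g' : wordRing f t →ₐ[A] wordRing f r) :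
    (wordKeep h' g').comp (wordKeep h g) = wordKeep (h.trans h') (g'.comp g) :=
  compMap_comp h h' g g'

theorem word_ext {a b : Cell n} (h : a.Contains b) {s t : List (Cell n)}
    {φ ψ : wordRing f (a :: s) →ₐ[A] wordRing f (b :: t)}
    (H : φ.comp (wordSkip f a s) = ψ.comp (wordSkip f a s)) : φ = ψ :=
  comp_ext h fun x => DFunLike.congr_fun H x

/-- The canonical maps `R_s → R_t` for lists of strata `s` and `t`, such that `s` is obtained from
`t` by deleting some members and enlarging some of the others: they are generated by the structure
maps into a completion and by functoriality. -/
inductive IsCanonical : (s t : List (Cell n)) → (wordRing f s →ₐ[A] wordRing f t) → Prop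
  | nil : IsCanonical [] [] (AlgHom.id A _)
  | skip (b : Cell n) {s t : List (Cell n)} {g : wordRing f s →ₐ[A] wordRing f t} :
      IsCanonical s t g → IsCanonical s (b :: t) ((wordSkip f b t).comp g)
  | keep {a b : Cell n} (h : a.Contains b) {s t : List (Cell n)}
      {g : wordRing f s →ₐ[A] wordRing f t} :
      IsCanonical s t g → IsCanonical (a :: s) (b :: t) (wordKeep h g)

theorem IsCanonical.refl (s : List (Cell n)) : IsCanonical s s (AlgHom.id A (wordRing f s)) := by
  induction s with
  | nil => exact .nil
  | cons a s ih =>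
    have := IsCanonical.keep (Contains.refl a) ih
    rwa [wordKeep_id] at this

theorem IsCanonical.trans {s t r : List (Cell n)} {g : wordRing f s →ₐ[A] wordRing f t}
    {k : wordRing f t →ₐ[A] wordRing f r} (hg : IsCanonical s t g) (hk : IsCanonical t r k) :
    IsCanonical s r (k.comp g) := by
  induction hk generalizing s with
  | nil => exact hg
  | skip b _ ih => exact .skip b (ih hg)
  | @keep a b h s' t' k' hk' ih =>
    cases hg with
    | skip _ hg' =>
      rw [← AlgHom.comp_assoc, wordKeep_comp_wordSkip, AlgHom.comp_assoc]
      exact .skip _ (ih hg')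
    | keep h' hg' =>
      rw [wordKeep_comp]
      exact .keep _ (ih hg')

theorem IsCanonical.tail {a : Cell n} {s t : List (Cell n)}
    {g : wordRing f (a :: s) →ₐ[A] wordRing f t} (hg : IsCanonical (a :: s) t g) :
    IsCanonical s t (g.comp (wordSkip f a s)) :=
  IsCanonical.trans (.skip a (.refl s)) hg

/-- There is at most one canonical map. -/
theorem IsCanonical.unique {s t : List (Cell n)} {g k : wordRing f s →ₐ[A] wordRing f t}
    (hg : IsCanonical s t g) (hk : IsCanonical s t k) : g = k := by
  induction t generalizing s with
  | nil => cases hg; cases hk; rfl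
  | cons b t ih =>
    cases hg with
    | skip _ hg' =>
      cases hk with
      | skip _ hk' => rw [ih hg' hk']
      | keep h hk' =>
        refine word_ext h ?_
        rw [AlgHom.comp_assoc, ih hg'.tail hk', wordKeep_comp_wordSkip]
    | keep h hg' =>
      cases hk with
      | skip _ hk' =>
        refine word_ext h ?_
        rw [AlgHom.comp_assoc, ih hk'.tail hg', wordKeep_comp_wordSkip]
      | keep _ hk' => rw [ih hg' hk']

theorem exists_isCanonical {s t : List (Cell n)} (h : s.SublistForall₂ Contains t) :
    ∃ g : wordRing f s →ₐ[A] wordRing f t, IsCanonical s t g := by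
  induction h with
  | @nil t =>
    induction t with
    | nil => exact ⟨_, .nil⟩
    | cons b t ih => obtain ⟨g, hg⟩ := ih; exact ⟨_, .skip b hg⟩
  | cons h _ ih => obtain ⟨g, hg⟩ := ih; exact ⟨_, .keep h hg⟩
  | cons_right _ ih => obtain ⟨g, hg⟩ := ih; exact ⟨_, .skip _ hg⟩

/-- The canonical map `R_s → R_t`. -/
noncomputable def wordMap {s t : List (Cell n)} (h : s.SublistForall₂ Contains t) :
    wordRing f s →ₐ[A] wordRing f t :=
  (exists_isCanonical h).choose

theorem wordMap_isCanonical {s t : List (Cell n)} (h : s.SublistForall₂ Contains t) :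
    IsCanonical s t (wordMap (f := f) h) :=
  (exists_isCanonical h).choose_spec

end Cell
/-- The category `∫ S` of the semi-simplicial nerve `S` of a partially ordered set `P`. The objects
are the nonempty finite chains `Y₁ > Y₂ > ⋯ > Yₖ`. -/
structure ChainCat (P : Type w) [PartialOrder P] where
  /-- the members of the chain, in decreasing order -/
  verts : List P
  ne_nil : verts ≠ []
  desc : verts.Pairwise (· > ·)

namespace ChainCat

variable {P : Type w} [PartialOrder P] {Q : Type w} [PartialOrder Q]

/-- A morphism `ξ ⟶ ξ'` is an injective monotone map `μ` between the index sets such that the face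
of `ξ'` given by `μ` is `ξ`. -/
@[ext] structure Hom (ξ ξ' : ChainCat P) where
  /-- the map of index sets -/
  emb : Fin ξ.verts.length ↪o Fin ξ'.verts.length
  face : ∀ i, ξ'.verts.get (emb i) = ξ.verts.get i

theorem nodup (ξ : ChainCat P) : ξ.verts.Nodup :=
  ξ.desc.imp fun h => h.ne'

instance : Category (ChainCat P) where
  Hom := Hom
  id ξ := ⟨RelEmbedding.refl _, fun _ => rfl⟩
  comp a b := ⟨a.emb.trans b.emb, fun i => (b.face (a.emb i)).trans (a.face i)⟩

instance (ξ ξ' : ChainCat P) : Subsingleton (ξ ⟶ ξ') := ⟨fun a b => by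
  apply Hom.ext
  ext i : 1
  exact ξ'.nodup.injective_get ((a.face i).trans (b.face i).symm)⟩

theorem Hom.sublist {ξ ξ' : ChainCat P} (a : ξ ⟶ ξ') : ξ.verts.Sublist ξ'.verts :=
  List.sublist_iff_exists_fin_orderEmbedding_get_eq.mpr ⟨a.emb, fun i => (a.face i).symm⟩

theorem nonempty_hom {ξ ξ' : ChainCat P} (h : ξ.verts.Sublist ξ'.verts) : Nonempty (ξ ⟶ ξ') := by
  obtain ⟨e, he⟩ := List.sublist_iff_exists_fin_orderEmbedding_get_eq.mp h
  exact ⟨⟨e, fun i => (he i).symm⟩⟩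

open Classical in
/-- The image of a chain: apply `ν` to the members and delete double entries. -/
noncomputable def mapObj (ν : P →o Q) (ξ : ChainCat P) : ChainCat Q where
  verts := (ξ.verts.map ν).dedup
  ne_nil := by simpa [List.dedup_eq_nil] using ξ.ne_nil
  desc := by
    have h1 : (ξ.verts.map ν).Pairwise (· ≥ ·) :=
      List.pairwise_map.mpr (ξ.desc.imp fun h => ν.monotone h.le)
    have h2 := h1.sublist (List.dedup_sublist _)
    exact (h2.and (List.nodup_dedup _)).imp fun h => lt_of_le_of_ne h.1 h.2.symm

theorem mem_mapObj (ν : P →o Q) (ξ : ChainCat P) (y : Q) :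
    y ∈ (mapObj ν ξ).verts ↔ ∃ x ∈ ξ.verts, ν x = y := by
  simp [mapObj]

theorem mapObj_sublist (ν : P →o Q) (ξ : ChainCat P) :
    (mapObj ν ξ).verts.Sublist (ξ.verts.map ν) := by
  classical
  exact List.dedup_sublist _

theorem sublist_of_subset {ξ ξ' : ChainCat P} (h : ξ.verts ⊆ ξ'.verts) :
    ξ.verts.Sublist ξ'.verts :=
  List.sublist_of_subperm_of_pairwise (ξ.nodup.subperm h) ξ.desc ξ'.desc

/-- The functor `∫ S' ⥤ ∫ S` induced by a monotone map `ν`. -/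
noncomputable def mapFunctor (ν : P →o Q) : ChainCat P ⥤ ChainCat Q where
  obj := mapObj ν
  map {ξ ξ'} a := (nonempty_hom (sublist_of_subset fun y hy => by
    rw [mem_mapObj] at hy ⊢
    obtain ⟨x, hx, rfl⟩ := hy
    exact ⟨x, (Hom.sublist a).subset hx, rfl⟩)).some
  map_id _ := Subsingleton.elim _ _
  map_comp _ _ := Subsingleton.elim _ _

end ChainCat

/-- A stratification of `Spec A` with all strata of the form
`V(f i : i ∈ van) ∖ V(∏ j ∈ inv, f j)`: a decomposition into finitely many disjoint nonempty
strata such that the closure of each stratum is a union of strata. -/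
structure Stratification {n : ℕ} {A : Type u} [CommRing A] (f : Fin n → A) where
  /-- the strata -/
  strata : Finset (Cell n)
  nonempty : ∀ Y ∈ strata, (Y.carrier f).Nonempty
  disjoint : ∀ Y ∈ strata, ∀ Z ∈ strata, Y ≠ Z → Disjoint (Y.carrier f) (Z.carrier f)
  cover : ∀ x : PrimeSpectrum A, ∃ Y ∈ strata, x ∈ Y.carrier f
  frontier : ∀ Y ∈ strata, ∀ Z ∈ strata, (Z.carrier f ∩ closure (Y.carrier f)).Nonempty →
    Z.carrier f ⊆ closure (Y.carrier f)

namespace Stratification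

variable {n : ℕ} {A : Type u} [CommRing A] {f : Fin n → A}

/-- The type of strata. -/
@[ext] structure Stratum (P : Stratification f) : Type where
  /-- the data of the stratum -/
  cell : Cell n
  mem : cell ∈ P.strata

/-- Strata are ordered by `Z ≤ Y` if `Z` is contained in the closure of `Y`. -/
instance (P : Stratification f) : PartialOrder P.Stratum where
  le Z Y := Z.cell.carrier f ⊆ closure (Y.cell.carrier f)
  le_refl _ := subset_closure
  le_trans _ _ _ h h' := h.trans (closure_minimal h' isClosed_closure)
  le_antisymm Z Y h h' := by
    by_contra hne
    have hd := P.disjoint Z.cell Z.mem Y.cell Y.mem fun e => hne (Stratum.ext e)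
    obtain ⟨x, hx⟩ := P.nonempty Z.cell Z.mem
    obtain ⟨y, hy, hyY⟩ := mem_closure_iff.mp (h hx) _
      (PrimeSpectrum.isClosed_zeroLocus {∏ j ∈ Z.cell.inv, f j}).isOpen_compl hx.2
    have h1 : closure (Z.cell.carrier f) ⊆ PrimeSpectrum.zeroLocus (f '' Z.cell.van) :=
      closure_minimal Set.sdiff_subset (PrimeSpectrum.isClosed_zeroLocus _)
    exact Set.disjoint_left.mp hd ⟨h1 (h' hyY), hy⟩ hyY

/-- The list of data of the members of a chain of strata. -/
def word (P : Stratification f) (ξ : ChainCat P.Stratum) : List (Cell n) :=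
  ξ.verts.map Stratum.cell

theorem word_sublist (P : Stratification f) {ξ ξ' : ChainCat P.Stratum} (a : ξ ⟶ ξ') :
    (P.word ξ).SublistForall₂ Cell.Contains (P.word ξ') :=
  List.sublistForall₂_iff.mpr ⟨_, List.forall₂_same.mpr fun _ _ => Cell.Contains.refl _,
    (ChainCat.Hom.sublist a).map _⟩

/-- The ring valued functor `(Y₁ > ⋯ > Yₖ) ↦ R_{Y₁, …, Yₖ}` on `∫ S`. -/
noncomputable def ringFunctor (P : Stratification f) : ChainCat P.Stratum ⥤ CommRingCat.{u} where
  obj ξ := CommRingCat.of (Cell.wordRing f (P.word ξ))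
  map a := CommRingCat.ofHom (Cell.wordMap (f := f) (P.word_sublist a)).toRingHom
  map_id ξ := by
    rw [(Cell.wordMap_isCanonical _).unique (Cell.IsCanonical.refl _)]
    rfl
  map_comp a b := by
    rw [(Cell.wordMap_isCanonical (f := f) (P.word_sublist (a ≫ b))).unique
      ((Cell.wordMap_isCanonical (P.word_sublist a)).trans
        (Cell.wordMap_isCanonical (P.word_sublist b)))]
    rfl

/-- `P'` is obtained from `P` by splitting the stratum `Y` into the two strata `Y ∩ V(f i)` and
`Y ∖ V(f i)`. -/
structure IsSplitting (P' P : Stratification f) (Y : Cell n) (i : Fin n) : Prop where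
  mem : Y ∈ P.strata
  strata_eq : P'.strata = insert (Y.cut i) (insert (Y.rest i) (P.strata.erase Y))

namespace IsSplitting

variable {P' P : Stratification f} {Y : Cell n} {i : Fin n}

/-- The stratum of `P` that contains a given stratum of `P'`. -/
def parent (h : IsSplitting P' P Y i) (Z : P'.Stratum) : P.Stratum :=
  if hZ : Z.cell = Y.cut i ∨ Z.cell = Y.rest i then ⟨Y, h.mem⟩
  else ⟨Z.cell, by
    have := Z.mem
    rw [h.strata_eq, Finset.mem_insert, Finset.mem_insert, Finset.mem_erase] at this
    tauto⟩

theorem parent_contains (h : IsSplitting P' P Y i) (Z : P'.Stratum) :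
    (h.parent Z).cell.Contains Z.cell := by
  unfold parent
  split_ifs with hZ
  · rcases hZ with hZ | hZ
    · rw [hZ]
      exact ⟨Finset.subset_insert _ _, subset_rfl⟩
    · rw [hZ]
      exact ⟨subset_rfl, Finset.subset_insert _ _⟩
  · exact Cell.Contains.refl _

/-- The map `ν` from the strata of `P'` to the strata of `P`. -/
def ν (h : IsSplitting P' P Y i) : P'.Stratum →o P.Stratum where
  toFun := h.parent
  monotone' Z W hZW := by
    refine P.frontier _ (h.parent W).mem _ (h.parent Z).mem ?_
    obtain ⟨x, hx⟩ := P'.nonempty Z.cell Z.mem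
    exact ⟨x, (h.parent_contains Z).carrier_subset f hx,
      closure_mono ((h.parent_contains W).carrier_subset f) (hZW hx)⟩

theorem word_sublist_word (h : IsSplitting P' P Y i) (ξ : ChainCat P'.Stratum) :
    (P.word (ChainCat.mapObj h.ν ξ)).SublistForall₂ Cell.Contains (P'.word ξ) := by
  have : IsTrans (Cell n) Cell.Contains := ⟨fun _ _ _ => Cell.Contains.trans⟩
  have h1 : ((ξ.verts.map h.ν).map Stratum.cell).SublistForall₂ Cell.Contains (P'.word ξ) := by
    rw [List.map_map]
    refine List.sublistForall₂_iff.mpr ⟨_, ?_, List.Sublist.refl _⟩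
    rw [word, List.forall₂_map_left_iff, List.forall₂_map_right_iff]
    exact List.forall₂_same.mpr fun Z _ => h.parent_contains Z
  refine _root_.trans (List.sublistForall₂_iff.mpr
    ⟨_, List.forall₂_same.mpr fun _ _ => Cell.Contains.refl _, ?_⟩) h1
  exact (ChainCat.mapObj_sublist h.ν ξ).map _

/-- The canonical ring maps `R_{ν ξ} → R'_ξ`. -/
noncomputable def ringTrans (h : IsSplitting P' P Y i) :
    ChainCat.mapFunctor h.ν ⋙ P.ringFunctor ⟶ P'.ringFunctor where
  app ξ := CommRingCat.ofHom (Cell.wordMap (f := f) (h.word_sublist_word ξ)).toRingHom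
  naturality ξ ξ' a := by
    have := ((Cell.wordMap_isCanonical (f := f) (P.word_sublist
        ((ChainCat.mapFunctor h.ν).map a))).trans
        (Cell.wordMap_isCanonical (h.word_sublist_word ξ'))).unique
      ((Cell.wordMap_isCanonical (h.word_sublist_word ξ)).trans
        (Cell.wordMap_isCanonical (P'.word_sublist a)))
    exact congrArg (fun g => CommRingCat.ofHom (AlgHom.toRingHom g)) this

end IsSplitting

end Stratification

/-- Elements of a local ring that are part of a minimal system of generators of the maximal
ideal. -/
def IsPartOfMinimalGenerators {L : Type u} [CommRing L] [IsLocalRing L] {m : ℕ} (g : Fin m → L) :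
    Prop :=
  ∃ (d : ℕ) (y : Fin d → L) (e : Fin m ↪ Fin d),
    Ideal.span (Set.range y) = IsLocalRing.maximalIdeal L ∧
    d = (IsLocalRing.maximalIdeal L).spanFinrank ∧ ∀ i, y (e i) = g i

/-- The closed subscheme `V(I)` of `Spec A` is a divisor with strict normal crossings: locally
around each of its points it is defined by an equation `g₁ ⋯ gₘ`, where `g₁, …, gₘ` are part of
a minimal system of generators of the maximal ideal at that point. -/
def IsStrictNormalCrossings {A : Type u} [CommRing A] (I : Ideal A) : Prop :=
  ∀ q : PrimeSpectrum A, I ≤ q.asIdeal →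
    ∃ (m : ℕ) (g : Fin m → Localization.AtPrime q.asIdeal),
      IsPartOfMinimalGenerators g ∧
      I.map (algebraMap A (Localization.AtPrime q.asIdeal)) = Ideal.span {∏ i, g i}

end FormalDescent

/-! For a chain `ξ` of `P`, consider the chains `ζ` of `P'` with a map `ξ ⟶ ν ζ`. A module over `P`
should be recovered at `ξ` as the limit of its pull-back over all these `ζ`. Since `ν` is bijective
away from `Y`, a chain `ξ` without `Y` has a smallest `ζ`, with the same ring. If `ξ` is `s₁ > Y >
s₂`, the minimal `ζ` are `ζ' = (s₁ > Y' > s₂)` and `ζ'' = (s₁ > Y'' > s₂)`, with join `ζ₀ = (s₁ >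
Y'' > Y' > s₂)`, so the limit is a fibre product. The exception is that a member of `s₂` is not in
the closure of `Y'`. By irreducibility it then misses `V(f)`, so `f` is invertible on `R_{s₂}`, the
ring `R_{Y', s₂}` vanishes, and `ζ''` alone is the smallest chain.

Every finite module `N` over `R_ξ` is the fibre product of its extensions of scalars to `R_{ζ'}` and
`R_{ζ''}` over the one to `R_{ζ₀}`. For modules killed by a power of `I` this is gluing in the style
of Beauville and Laszlo: completion along `f` on one side, inversion of `f` on the other
(`exactOn_of_flat`). Passage to the limit over the powers of `I` (`isGluing_of_isCompletion`) and
stability under further localizations and completions (`IsGluing.localize`, `Cell.isGluing_compMap`)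
give all words `s₁ > Y > s₂`.

Conversely, glueing data come from a finite module. It suffices to treat `ξ = (Y)`, because modules
over longer chains containing `Y` arise by extension of scalars. Given `M'`, `M''` with common
extension `M`, density arguments show `M = f M' + M''`. Nakayama's lemma then yields generators of
`M'` and `M''` that agree in `M`; the same applied to the relations gives compatible relations,
whose coefficients lift to `R_Y = R_{Y'} ×_{R_{Y'',Y'}} R_{Y''}`. The lifted relations present the
wanted module (`IsFormalSquare.exists_module`).

The formal criterion `DiagramModule.pullbackFinCoCart_isEquivalence` turns both statements into the
equivalence. That `ν` is a fibration is elementary: the cartesian lift of a face of `ν ξ` is the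
largest subchain of `ξ` lying over it. -/

namespace FormalDescent

/-! ### Noetherian completions and finite modules over complete rings -/

section Complete

variable {B : Type u} [CommRing B]

theorem exists_tsum_of_isPrecomplete {J : Ideal B} [IsPrecomplete J B] (c : ℕ → B)
    (hc : ∀ k, c k ∈ J ^ k) :
    ∃ s : B, ∀ k, s - ∑ i ∈ Finset.range k, c i ∈ J ^ k := by
  obtain ⟨s, hs⟩ := IsPrecomplete.prec (I := J) (M := B) inferInstance
    (f := fun k => ∑ i ∈ Finset.range k, c i) (by
      intro m n hmn
      rw [SModEq.sub_mem, ← neg_mem_iff, neg_sub, ← Finset.sum_Ico_eq_sub _ hmn]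
      refine sum_mem fun i hi => ?_
      rw [smul_eq_mul, Ideal.mul_top]
      exact Ideal.pow_le_pow_right (Finset.mem_Ico.mp hi).1 (hc i))
  refine ⟨s, fun k => ?_⟩
  have := (hs k).symm
  rwa [SModEq.sub_mem, smul_eq_mul, Ideal.mul_top] at this

/-- A ring which is complete with respect to a finitely generated ideal `J` is noetherian if
`B ⧸ J` is. -/
theorem isNoetherianRing_of_isAdicComplete (J : Ideal B) (hJ : J.FG) [IsAdicComplete J B]
    (hB : IsNoetherianRing (B ⧸ J)) : IsNoetherianRing B := by
  by_contra hn
  have hne : ∃ I : Ideal B, ¬ I.FG := by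
    by_contra! h
    exact hn ⟨h⟩
  obtain ⟨I, hI⟩ := hne
  -- An ideal `p` maximal among those not finitely generated is prime. If `J ≤ p`, finite generation
  -- of `p` follows from that of `p / J` and `J`. Otherwise some `x ∈ J` is outside `p`, and
  -- repeated division by `x` expresses elements of `p` by convergent series.
  obtain ⟨p, -, hp⟩ := zorn_le_nonempty₀ {I : Ideal B | ¬ I.FG} (by
    intro C hC₁ hC₂ I hI
    refine ⟨sSup C, fun h => ?_, fun _ h => le_sSup h⟩
    obtain ⟨G, hG⟩ := h
    obtain ⟨J, J_mem_C, G_subset_J⟩ : ∃ J ∈ C, (G : Set B) ⊆ J := by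
      refine hC₂.directedOn.exists_mem_subset_of_finset_subset_biUnion ⟨I, hI⟩ (fun _ hx ↦ ?_)
      simp only [Set.mem_iUnion, SetLike.mem_coe, exists_prop]
      exact (Submodule.mem_sSup_of_directed ⟨I, hI⟩ hC₂.directedOn).1 <|
        hG ▸ Submodule.subset_span hx
    have e : J = sSup C := le_antisymm (le_sSup J_mem_C) (hG ▸ Ideal.span_le.2 G_subset_J)
    exact hC₁ J_mem_C ⟨G, hG.trans e.symm⟩) I hI
  have hprime : p.IsPrime := Ideal.isOka_fg.isPrime_of_maximal_not hp
  have hfg : ¬ p.FG := hp.prop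
  by_cases hJp : J ≤ p
  · apply hfg
    have hs : Function.Surjective (Ideal.Quotient.mk J) := Ideal.Quotient.mk_surjective
    refine Submodule.fg_of_fg_map_of_fg_inf_ker (Ideal.Quotient.mkₐ B J).toLinearMap ?_ ?_
    · have h2 : IsNoetherian B (B ⧸ J) := ⟨fun N => by
        let N' : Ideal (B ⧸ J) :=
          { N with
            smul_mem' := fun c y hy => by
              obtain ⟨c, rfl⟩ := hs c
              exact N.smul_mem c hy }
        have h3 : N = N'.restrictScalars B := rfl
        rw [h3]
        exact Submodule.FG.restrictScalars_of_surjective (IsNoetherian.noetherian N') hs⟩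
      exact IsNoetherian.noetherian _
    · have : p ⊓ LinearMap.ker (Ideal.Quotient.mkₐ B J).toLinearMap = J := by
        ext x
        simp only [Submodule.mem_inf, LinearMap.mem_ker, AlgHom.toLinearMap_apply,
          Ideal.Quotient.mkₐ_eq_mk, Ideal.Quotient.eq_zero_iff_mem]
        exact ⟨fun h => h.2, fun h => ⟨hJp h, h⟩⟩
      rw [this]
      exact hJ
  · obtain ⟨x, hxJ, hxp⟩ := SetLike.not_le_iff_exists.mp hJp
    have hsup : (p ⊔ Ideal.span {x}).FG := by
      by_contra h
      have := hp.le_of_ge (y := p ⊔ Ideal.span {x}) h le_sup_left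
      exact hxp (this (Ideal.mem_sup_right (Ideal.mem_span_singleton_self x)))
    obtain ⟨S, hS⟩ := hsup
    have key : ∃ T : Finset B, (T : Set B) ⊆ p ∧ p ≤ Ideal.span T ⊔ Ideal.span {x} := by
      have : ∀ s : B, s ∈ S → ∃ a ∈ p, s - a ∈ Ideal.span {x} := by
        intro s hs
        have : s ∈ p ⊔ Ideal.span {x} := hS ▸ Submodule.subset_span hs
        obtain ⟨a, ha, b, hb, rfl⟩ := Submodule.mem_sup.mp this
        exact ⟨a, ha, by simpa using hb⟩
      choose! a ha hs using this
      classical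
      refine ⟨S.image a, ?_, ?_⟩
      · intro y hy
        obtain ⟨s, hs, rfl⟩ := Finset.mem_image.mp hy
        exact ha s hs
      · refine le_trans (le_sup_left (b := Ideal.span {x})) ?_
        rw [← hS]
        refine Submodule.span_le.mpr fun s hs' => ?_
        have := hs s hs'
        rw [← sub_add_cancel s (a s)]
        exact add_mem (Ideal.mem_sup_right this) (Ideal.mem_sup_left
          (Ideal.subset_span (Finset.mem_image_of_mem a hs')))
    obtain ⟨T, hTp, hT⟩ := key
    apply hfg
    refine ⟨T, le_antisymm (Ideal.span_le.mpr hTp) fun y hy => ?_⟩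
    -- Since `p` is prime and `x ∉ p`, the cofactor of `x` lies in `p` again: `p = (T) + x p`, which
    -- can be iterated.
    have step : ∀ y : p, ∃ (c : T → B) (z : p), (y : B) = ∑ t, c t * t + x * z := by
      rintro ⟨y, hy⟩
      obtain ⟨a, ha, b, hb, e⟩ := Submodule.mem_sup.mp (hT hy)
      obtain ⟨z, rfl⟩ := Ideal.mem_span_singleton'.mp hb
      obtain ⟨c, hc⟩ := Submodule.mem_span_finset'.mp ha
      have hap : a ∈ p := (Ideal.span_le.mpr hTp) ha
      have : z * x ∈ p := by
        rw [← e] at hy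
        simpa using sub_mem hy hap
      refine ⟨c, ⟨z, (hprime.mem_or_mem this).resolve_right hxp⟩, ?_⟩
      change y = _
      rw [← e, ← hc, mul_comm x z]
      simp
    choose c z hcz using step
    -- The successive remainders. The coefficients collected on the way carry powers of `x ∈ J`, so
    -- their sums converge.
    let Z : ℕ → p := fun k => Nat.rec (motive := fun _ => p) ⟨y, hy⟩ (fun _ w => z w) k
    have hsum : ∀ k, y = ∑ t, (∑ i ∈ Finset.range k, x ^ i * c (Z i) t) * t + x ^ k * (Z k : B) := by
      intro k
      induction k with
      | zero => simp [Z]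
      | succ k ih =>
        rw [ih, hcz (Z k)]
        change _ = _ + x ^ (k + 1) * (z (Z k) : B)
        simp only [Finset.sum_range_succ, add_mul, Finset.sum_add_distrib]
        rw [mul_add, Finset.mul_sum]
        simp only [← mul_assoc, pow_succ]
        ring
    choose C hC using fun t : T => exists_tsum_of_isPrecomplete (J := J)
      (fun i => x ^ i * c (Z i) t) fun i => Ideal.mul_mem_right _ _ (Ideal.pow_mem_pow hxJ i)
    have : y = ∑ t, C t * t := by
      rw [← sub_eq_zero]
      refine IsHausdorff.haus (I := J) (M := B) inferInstance _ fun k => ?_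
      rw [SModEq.zero, smul_eq_mul, Ideal.mul_top]
      have e : y - ∑ t, C t * t =
          x ^ k * Z k - ∑ t : T, (C t - ∑ i ∈ Finset.range k, x ^ i * c (Z i) t) * t := by
        conv_lhs => rw [hsum k]
        simp only [sub_mul, Finset.sum_sub_distrib]
        ring
      rw [e]
      exact sub_mem (Ideal.mul_mem_right _ _ (Ideal.pow_mem_pow hxJ k))
        (sum_mem fun t _ => Ideal.mul_mem_right _ _ (hC t k))
    rw [this]
    exact sum_mem fun t _ => Ideal.mul_mem_left _ _ (Ideal.subset_span t.2)

theorem isNoetherianRing_adicCompletion [IsNoetherianRing B] (J : Ideal B) :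
    IsNoetherianRing (AdicCompletion J B) := by
  have hJ : J.FG := IsNoetherian.noetherian J
  have := AdicCompletion.isAdicComplete_self J hJ
  refine isNoetherianRing_of_isAdicComplete (J.map (algebraMap B (AdicCompletion J B)))
    (hJ.map _) ?_
  rw [← AdicCompletion.ker_evalOneₐ_eq_map J hJ]
  exact isNoetherianRing_of_ringEquiv (B ⧸ J)
    (RingHom.quotientKerEquivOfSurjective (AdicCompletion.evalOneₐ_surjective J)).symm

/-- For finite `M` the completion of `M` is a quotient of the completion of `B` tensored with `M`,
and every element of the completion of `B` comes from `B`. -/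
theorem isPrecomplete_of_finite (J : Ideal B) [IsPrecomplete J B] (M : Type u) [AddCommGroup M]
    [Module B M] [Module.Finite B M] : IsPrecomplete J M := by
  rw [← AdicCompletion.of_surjective_iff]
  intro x
  obtain ⟨y, rfl⟩ := AdicCompletion.ofTensorProduct_surjective_of_finite J M x
  induction y with
  | zero => exact ⟨0, by simp⟩
  | add y z hy hz =>
    obtain ⟨a, ha⟩ := hy
    obtain ⟨b, hb⟩ := hz
    exact ⟨a + b, by rw [map_add, map_add, ha, hb]⟩
  | tmul r m =>
    obtain ⟨b, rfl⟩ := AdicCompletion.of_surjective J B r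
    refine ⟨b • m, ?_⟩
    rw [AdicCompletion.ofTensorProduct_tmul, map_smul]
    ext k
    rw [AdicCompletion.smul_eval]
    rfl

theorem isAdicComplete_of_finite [IsNoetherianRing B] (J : Ideal B) [IsAdicComplete J B]
    (M : Type u) [AddCommGroup M] [Module B M] [Module.Finite B M] : IsAdicComplete J M where
  toIsHausdorff := IsHausdorff.of_le_jacobson J M (IsAdicComplete.le_jacobson_bot J)
  toIsPrecomplete := isPrecomplete_of_finite J M

/-- An `I`-adic Cauchy sequence has a `J`-adic limit. This is also the `I`-adic limit, because `I ^
n M` is `J`-adically closed: the finite module `M / I ^ n M` is `J`-adically separated. -/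
theorem isAdicComplete_of_le [IsNoetherianRing B] {I J : Ideal B} (hIJ : I ≤ J)
    [IsAdicComplete J B] (M : Type u) [AddCommGroup M] [Module B M] [Module.Finite B M] :
    IsAdicComplete I M where
  toIsHausdorff := IsHausdorff.of_le_jacobson I M (hIJ.trans (IsAdicComplete.le_jacobson_bot J))
  prec' c hc := by
    have := isAdicComplete_of_finite J M
    obtain ⟨L, hL⟩ := IsPrecomplete.prec (I := J) (M := M) inferInstance (f := c)
      (fun hmn => (hc hmn).mono (Submodule.smul_mono_left (Ideal.pow_right_mono hIJ _)))
    refine ⟨L, fun n => ?_⟩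
    let X := M ⧸ (I ^ n • ⊤ : Submodule B M)
    have := isAdicComplete_of_finite J X
    rw [SModEq.sub_mem, ← Submodule.Quotient.mk_eq_zero]
    refine IsHausdorff.haus (I := J) (M := X) inferInstance _ fun k => ?_
    have h1 := hL (max n k)
    have h2 := hc (le_max_left n k)
    rw [SModEq.sub_mem] at h1 h2
    rw [SModEq.zero, ← sub_add_sub_cancel (c n) (c (max n k)) L, Submodule.Quotient.mk_add,
      (Submodule.Quotient.mk_eq_zero _).mpr h2, zero_add]
    have h3 : c (max n k) - L ∈ (J ^ k • ⊤ : Submodule B M) :=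
      Submodule.smul_mono_left (Ideal.pow_le_pow_right (le_max_right n k)) h1
    have h4 := Submodule.mem_map_of_mem (f := Submodule.mkQ (I ^ n • ⊤ : Submodule B M)) h3
    rw [Submodule.map_smul''] at h4
    exact Submodule.smul_mono le_rfl le_top h4

end Complete

/-! ### Calculus of coCartesian semilinear maps -/

section CoCartesian

variable {R R' R'' : Type u} [CommRing R] [CommRing R'] [CommRing R'']
variable {φ : R →+* R'} {ψ : R' →+* R''} {σ : R →+* R''}
  {M : Type u} [AddCommGroup M] [Module R M] {N : Type u} [AddCommGroup N] [Module R' N]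
  {Q : Type u} [AddCommGroup Q] [Module R'' Q]

/-- Composition of semilinear maps, along a composition of ring homomorphisms. -/
def scomp (hσ : σ = ψ.comp φ) (h : N →ₛₗ[ψ] Q) (g : M →ₛₗ[φ] N) : M →ₛₗ[σ] Q where
  toFun m := h (g m)
  map_add' x y := by rw [map_add, map_add]
  map_smul' r x := by subst hσ; rw [map_smulₛₗ, map_smulₛₗ]; rfl

@[simp] theorem scomp_apply (hσ : σ = ψ.comp φ) (h : N →ₛₗ[ψ] Q) (g : M →ₛₗ[φ] N) (m : M) :
    scomp hσ h g m = h (g m) := rfl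

theorem IsCoCartesianMap.semi_ext_of_eq {g : M →ₛₗ[φ] N} (hg : IsCoCartesianMap g)
    {ψ₁ ψ₂ : R' →+* R''} (e : ψ₁ = ψ₂) {h : N →ₛₗ[ψ₁] Q} {k : N →ₛₗ[ψ₂] Q}
    (H : ∀ m, h (g m) = k (g m)) (x : N) : h x = k x := by
  subst e
  exact hg.semi_ext H x

theorem IsCoCartesianMap.comp {g : M →ₛₗ[φ] N} (hg : IsCoCartesianMap g) {h : N →ₛₗ[ψ] Q}
    (hh : IsCoCartesianMap h) (hσ : σ = ψ.comp φ) {k : M →ₛₗ[σ] Q} (hk : ∀ m, k m = h (g m)) :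
    IsCoCartesianMap k := by
  refine isCoCartesianMap_of_universal ?_ fun l hl => ?_
  · obtain ⟨a, ha⟩ := hg.exists_semilift hσ (BaseChange.unit σ)
    obtain ⟨l, hl⟩ := hh.exists_lift a
    exact ⟨l, fun m => by rw [hk, hl, ha]⟩
  · refine hh.hom_ext fun n => ?_
    refine hg.semi_ext (h := l.comp h) (k := LinearMap.id.comp h) (fun m => ?_) n
    have := hl m
    rw [hk] at this
    exact this

theorem IsCoCartesianMap.of_comp {g : M →ₛₗ[φ] N} (hg : IsCoCartesianMap g) {k : M →ₛₗ[σ] Q}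
    (hk : IsCoCartesianMap k) (hσ : σ = ψ.comp φ) {h : N →ₛₗ[ψ] Q} (hkh : ∀ m, k m = h (g m)) :
    IsCoCartesianMap h := by
  refine isCoCartesianMap_of_universal ?_ fun l hl => hk.hom_ext fun m => ?_
  · let a : M →ₛₗ[σ] BaseChange ψ N :=
      { toFun := fun m => BaseChange.unit ψ (g m)
        map_add' := fun x y => by simp
        map_smul' := fun r x => by subst hσ; simp }
    obtain ⟨l, hl⟩ := hk.exists_lift a
    refine ⟨l, fun n => ?_⟩
    refine hg.semi_ext (h := l.comp h) (k := BaseChange.unit ψ) (fun m => ?_) n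
    have := hl m
    rw [hkh] at this
    exact this
  · rw [hkh]
    exact hl _

theorem IsCoCartesianMap.span_range {g : M →ₛₗ[φ] N} (hg : IsCoCartesianMap g) :
    Submodule.span R' (Set.range g) = ⊤ := by
  refine eq_top_iff.mpr fun x _ => ?_
  obtain ⟨y, rfl⟩ := hg.2 x
  refine BaseChange.induction
    (p := fun y => BaseChange.lift g y ∈ Submodule.span R' (Set.range g)) (by simp) ?_ ?_ ?_ y
  · intro m
    rw [BaseChange.lift_unit]
    exact Submodule.subset_span ⟨m, rfl⟩
  · intro r x hx
    rw [map_smul]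
    exact Submodule.smul_mem _ _ hx
  · intro x y hx hy
    rw [map_add]
    exact add_mem hx hy

theorem IsCoCartesianMap.finite {g : M →ₛₗ[φ] N} (hg : IsCoCartesianMap g) [Module.Finite R M] :
    Module.Finite R' N := by
  have := BaseChange.finite (φ := φ) (M := M)
  exact Module.Finite.of_surjective _ hg.2

theorem IsCoCartesianMap.surjective_of_surjective {g : M →ₛₗ[φ] N} (hg : IsCoCartesianMap g)
    (hφ : Function.Surjective φ) : Function.Surjective g := by
  intro x
  have : x ∈ Submodule.span R' (Set.range g) := hg.span_range ▸ Submodule.mem_top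
  induction this using Submodule.span_induction with
  | mem x h => exact h
  | zero => exact ⟨0, map_zero g⟩
  | add x y _ _ hx hy =>
    obtain ⟨a, rfl⟩ := hx
    obtain ⟨b, rfl⟩ := hy
    exact ⟨a + b, map_add g a b⟩
  | smul r x _ hx =>
    obtain ⟨a, rfl⟩ := hx
    obtain ⟨s, rfl⟩ := hφ r
    exact ⟨s • a, map_smulₛₗ g s a⟩

theorem IsCoCartesianMap.bijective_of_bijective {g : M →ₛₗ[φ] N} (hg : IsCoCartesianMap g)
    (hφ : Function.Bijective φ) : Function.Bijective g := by
  refine ⟨?_, hg.surjective_of_surjective hφ.2⟩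
  let e := RingEquiv.ofBijective φ hφ
  let : Module R' M := Module.compHom M e.symm.toRingHom
  obtain ⟨k, hk⟩ := hg.exists_lift (N' := M)
    { toFun := fun m => m
      map_add' := fun _ _ => rfl
      map_smul' := fun r m => by
        change r • m = e.symm (e r) • m
        rw [e.symm_apply_apply] }
  intro x y hxy
  have := congrArg k hxy
  rw [hk, hk] at this
  exact this

theorem isCoCartesianMap_of_bijective {g : M →ₛₗ[φ] N} (hφ : Function.Bijective φ)
    (hg : Function.Bijective g) : IsCoCartesianMap g := by
  refine isCoCartesianMap_of_universal ?_ fun l hl => ?_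
  · let e := Equiv.ofBijective g hg
    have he : ∀ m, e.symm (g m) = m := e.symm_apply_apply
    refine ⟨{ toFun := fun n => BaseChange.unit φ (e.symm n)
              map_add' := fun x y => ?_
              map_smul' := fun r x => ?_ }, fun m => ?_⟩
    · obtain ⟨a, rfl⟩ := hg.2 x
      obtain ⟨b, rfl⟩ := hg.2 y
      rw [← map_add, he, he, he, map_add]
    · obtain ⟨a, rfl⟩ := hg.2 x
      obtain ⟨s, rfl⟩ := hφ.2 r
      rw [← map_smulₛₗ, he, he, map_smulₛₗ]
      rfl
    · exact congrArg (BaseChange.unit φ) (he m)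
  · ext x
    obtain ⟨m, rfl⟩ := hg.2 x
    exact hl m

/-- Base change to the quotient modules `M ⧸ I M → N ⧸ I N`. -/
theorem IsCoCartesianMap.quotient {g : M →ₛₗ[φ] N} (hg : IsCoCartesianMap g) {I : Ideal R}
    {J : Ideal R'} (hJ : I.map φ = J)
    {k : (M ⧸ (I • ⊤ : Submodule R M)) →ₛₗ[φ] (N ⧸ (J • ⊤ : Submodule R' N))}
    (hk : ∀ m, k (Submodule.Quotient.mk m) = Submodule.Quotient.mk (g m)) :
    IsCoCartesianMap k := by
  subst hJ
  refine isCoCartesianMap_of_universal ?_ fun l hl => ?_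
  · let W := BaseChange φ (M ⧸ (I • ⊤ : Submodule R M))
    obtain ⟨a, ha⟩ := hg.exists_lift
      (N' := W) ((BaseChange.unit φ).comp (Submodule.mkQ (I • ⊤ : Submodule R M)))
    have hW : ∀ r ∈ I.map φ, ∀ w : W, r • w = 0 := by
      intro r hr w
      have h1 : I.map φ ≤ Module.annihilator R' W := by
        rw [Ideal.map_le_iff_le_comap]
        intro i hi
        rw [Ideal.mem_comap, Module.mem_annihilator]
        refine BaseChange.induction (by simp) ?_ ?_ ?_
        · intro m
          rw [← map_smulₛₗ]
          obtain ⟨m, rfl⟩ := Submodule.Quotient.mk_surjective _ m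
          rw [← Submodule.Quotient.mk_smul, (Submodule.Quotient.mk_eq_zero _).mpr, map_zero]
          exact Submodule.smul_mem_smul hi trivial
        · intro r x hx
          rw [smul_comm, hx, smul_zero]
        · intro x y hx hy
          rw [smul_add, hx, hy, add_zero]
      exact Module.mem_annihilator.mp (h1 hr) w
    have hle : (I.map φ • ⊤ : Submodule R' N) ≤ LinearMap.ker a := by
      rw [Submodule.smul_le]
      intro r hr n _
      rw [LinearMap.mem_ker, map_smul, hW r hr]
    refine ⟨Submodule.liftQ _ a hle, fun m => ?_⟩
    obtain ⟨m, rfl⟩ := Submodule.Quotient.mk_surjective _ m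
    rw [hk]
    exact ha m
  · refine LinearMap.ext fun x => ?_
    obtain ⟨x, rfl⟩ := Submodule.Quotient.mk_surjective _ x
    have : l.comp (Submodule.mkQ _) = Submodule.mkQ (I.map φ • ⊤ : Submodule R' N) :=
      hg.hom_ext fun m => by
        have := hl (Submodule.Quotient.mk m)
        rw [hk] at this
        exact this
    exact DFunLike.congr_fun this x

/-- A semilinear map as a linear map to the restriction of scalars. -/
def toLinearOfSemilinear (g : M →ₛₗ[φ] N) :
    letI : Module R N := Module.compHom N φ
    M →ₗ[R] N :=
  letI : Module R N := Module.compHom N φ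
  { toFun := g
    map_add' := g.map_add
    map_smul' := fun r x => g.map_smulₛₗ r x }

/-- The bridge to base changes of linear maps, which makes localized modules and flatness available.
-/
theorem isCoCartesianMap_iff_isBaseChange (φ : R →+* R') (g : M →ₛₗ[φ] N) :
    IsCoCartesianMap g ↔
      (letI := φ.toAlgebra
       letI : Module R N := Module.compHom N φ
       haveI : IsScalarTower R R' N := ⟨fun r s x => by
         change (φ r * s) • x = φ r • (s • x)
         rw [mul_smul]⟩
       IsBaseChange R' (toLinearOfSemilinear g)) := by
  let := φ.toAlgebra
  let : Module R N := Module.compHom N φ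
  have : IsScalarTower R R' N := ⟨fun r s x => by
    change (φ r * s) • x = φ r • (s • x)
    rw [mul_smul]⟩
  let gl : M →ₗ[R] N := toLinearOfSemilinear g
  change IsCoCartesianMap g ↔ IsBaseChange R' gl
  have h2 : ∀ t : TensorProduct R R' M, BaseChange.lift g t =
      TensorProduct.lift (((Algebra.linearMap R' (Module.End R' (M →ₗ[R] N))).flip
        gl).restrictScalars R) t := by
    intro t
    induction t with
    | zero => rw [map_zero]; exact map_zero _
    | add x y hx hy => rw [map_add, ← hx, ← hy]; exact map_add (BaseChange.lift g) x y
    | tmul r m => rfl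
  change Function.Bijective (BaseChange.lift g) ↔ Function.Bijective _
  rw [show (⇑(BaseChange.lift g)) = _ from funext h2]
  exact Iff.rfl

/-- The ring homomorphism `φ` exhibits its target as the localization at the powers of `x`. -/
def IsAway (φ : R →+* R') (x : R) : Prop :=
  letI := φ.toAlgebra
  IsLocalization.Away x R'

theorem IsAway.isUnit {x : R} (h : IsAway φ x) : IsUnit (φ x) := by
  let := φ.toAlgebra
  have : IsLocalization.Away x R' := h
  exact IsLocalization.Away.algebraMap_isUnit x

theorem IsCoCartesianMap.isLocalizedModule {x : R} (hφ : IsAway φ x) {g : M →ₛₗ[φ] N}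
    (hg : IsCoCartesianMap g) :
    letI : Module R N := Module.compHom N φ
    IsLocalizedModule (Submonoid.powers x) (toLinearOfSemilinear g) := by
  let := φ.toAlgebra
  let : Module R N := Module.compHom N φ
  have : IsScalarTower R R' N := ⟨fun r s x => by
    change (φ r * s) • x = φ r • (s • x)
    rw [mul_smul]⟩
  have : IsLocalization.Away x R' := hφ
  exact (isLocalizedModule_iff_isBaseChange (Submonoid.powers x) R' _).mpr
    ((isCoCartesianMap_iff_isBaseChange φ g).mp hg)

theorem IsCoCartesianMap.exists_pow_smul_eq_zero {x : R} (hφ : IsAway φ x) {g : M →ₛₗ[φ] N}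
    (hg : IsCoCartesianMap g) {m : M} (hm : g m = 0) : ∃ k : ℕ, x ^ k • m = 0 := by
  let : Module R N := Module.compHom N φ
  obtain ⟨⟨_, k, rfl⟩, hc⟩ := (hg.isLocalizedModule hφ).exists_of_eq (x₁ := m) (x₂ := 0)
    (hm.trans (map_zero g).symm)
  refine ⟨k, ?_⟩
  rw [smul_zero] at hc
  exact hc

theorem IsCoCartesianMap.exists_pow_smul_eq {x : R} (hφ : IsAway φ x) {g : M →ₛₗ[φ] N}
    (hg : IsCoCartesianMap g) (n : N) : ∃ (k : ℕ) (m : M), φ x ^ k • n = g m := by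
  let : Module R N := Module.compHom N φ
  obtain ⟨⟨m, ⟨_, k, rfl⟩⟩, hc⟩ := (hg.isLocalizedModule hφ).surj n
  refine ⟨k, m, ?_⟩
  rw [← map_pow]
  exact hc

/-- Together with the two preceding lemmas this characterizes coCartesian maps along a localization
by elements, so that later arguments can clear denominators. -/
theorem isCoCartesianMap_of_isAway {x : R} (hφ : IsAway φ x) {g : M →ₛₗ[φ] N}
    (h1 : ∀ m, g m = 0 → ∃ k : ℕ, x ^ k • m = 0)
    (h2 : ∀ n, ∃ (k : ℕ) (m : M), φ x ^ k • n = g m) : IsCoCartesianMap g := by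
  let := φ.toAlgebra
  let : Module R N := Module.compHom N φ
  have : IsScalarTower R R' N := ⟨fun r s x => by
    change (φ r * s) • x = φ r • (s • x)
    rw [mul_smul]⟩
  have : IsLocalization.Away x R' := hφ
  rw [isCoCartesianMap_iff_isBaseChange φ g]
  refine (isLocalizedModule_iff_isBaseChange (Submonoid.powers x) R' _).mp ⟨?_, ?_, ?_⟩
  · rintro ⟨_, k, rfl⟩
    have hu : IsUnit (φ (x ^ k)) := by
      rw [map_pow]
      exact hφ.isUnit.pow k
    obtain ⟨v, hv⟩ := hu
    refine (Module.End.isUnit_iff _).mpr ?_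
    have := MulAction.bijective (β := N) v
    convert this using 2 with n
    change φ (x ^ k) • n = (v : R') • n
    rw [hv]
  · intro n
    obtain ⟨k, m, h⟩ := h2 n
    refine ⟨⟨m, ⟨_, k, rfl⟩⟩, ?_⟩
    rw [← map_pow] at h
    exact h
  · intro a b hab
    obtain ⟨k, hk⟩ := h1 (a - b) (by rw [map_sub]; exact sub_eq_zero.mpr hab)
    exact ⟨⟨_, k, rfl⟩, by rwa [smul_sub, sub_eq_zero] at hk⟩

end CoCartesian

/-! ### CoCartesian maps of torsion modules under a change of rings -/

section Change

variable {S T S₁ T₁ : Type u} [CommRing S] [CommRing T] [CommRing S₁] [CommRing T₁]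

/-- If `S → S₁` and `T → T₁` are isomorphisms modulo `𝔟` and `𝔟 T`, then a coCartesian map along
`S₁ → T₁` of modules killed by `𝔟` is also coCartesian along `S → T`. -/
theorem IsCoCartesianMap.restrict {φ : S →+* T} {φ₁ : S₁ →+* T₁} {ι : S →+* S₁} {ι' : T →+* T₁}
    (sq : φ₁.comp ι = ι'.comp φ) {b : Ideal S}
    {e : S₁ →+* S ⧸ b} (he : e.comp ι = Ideal.Quotient.mk b)
    {e' : T₁ →+* T ⧸ b.map φ} (he' : e'.comp ι' = Ideal.Quotient.mk (b.map φ))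
    (hee : (RingHom.ker e).map φ₁ = RingHom.ker e')
    {X : Type u} [AddCommGroup X] [Module S X] [Module S₁ X] (hX : ∀ (s : S) (x : X), ι s • x = s • x)
    {Y : Type u} [AddCommGroup Y] [Module T Y] [Module T₁ Y] (hY : ∀ (t : T) (y : Y), ι' t • y = t • y)
    (hk : ∀ s ∈ RingHom.ker e, ∀ x : X, s • x = 0)
    {g : X →ₛₗ[φ₁] Y} (hg : IsCoCartesianMap g) {g₀ : X →ₛₗ[φ] Y} (hg₀ : ∀ x, g₀ x = g x) :
    IsCoCartesianMap g₀ := by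
  -- `Y` is generated by the image of `X`, which `ker e` kills.
  have hkY : ∀ t ∈ RingHom.ker e', ∀ y : Y, t • y = 0 := by
    intro t ht y
    have h1 : (RingHom.ker e).map φ₁ ≤ Module.annihilator T₁ Y := by
      rw [Ideal.map_le_iff_le_comap]
      intro s hs
      rw [Ideal.mem_comap, Module.mem_annihilator]
      intro y
      have : y ∈ Submodule.span T₁ (Set.range g) := hg.span_range ▸ Submodule.mem_top
      induction this using Submodule.span_induction with
      | mem y h =>
        obtain ⟨x, rfl⟩ := h
        rw [← map_smulₛₗ, hk s hs, map_zero]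
      | zero => exact smul_zero _
      | add x y _ _ hx hy => rw [smul_add, hx, hy, add_zero]
      | smul r x _ hx => rw [smul_comm, hx, smul_zero]
    exact Module.mem_annihilator.mp (h1 (hee ▸ ht)) y
  have hT : ∀ t : T₁, ∃ t₀ : T, t - ι' t₀ ∈ RingHom.ker e' := by
    intro t
    obtain ⟨t₀, ht₀⟩ := Ideal.Quotient.mk_surjective (e' t)
    refine ⟨t₀, ?_⟩
    rw [RingHom.mem_ker, map_sub, ← ht₀, ← he', RingHom.comp_apply, sub_self]
  have hS : ∀ s : S₁, ∃ s₀ : S, s - ι s₀ ∈ RingHom.ker e := by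
    intro s
    obtain ⟨s₀, hs₀⟩ := Ideal.Quotient.mk_surjective (e s)
    refine ⟨s₀, ?_⟩
    rw [RingHom.mem_ker, map_sub, ← hs₀, ← he, RingHom.comp_apply, sub_self]
  have hXX : ∀ s : S₁, ∃ s₀ : S, s - ι s₀ ∈ RingHom.ker e ∧ ∀ x : X, s • x = s₀ • x := by
    intro s
    obtain ⟨s₀, hs₀⟩ := hS s
    refine ⟨s₀, hs₀, fun x => ?_⟩
    rw [← hX, ← sub_eq_zero, ← sub_smul, hk _ hs₀]
  have hYY : ∀ t : T₁, ∃ t₀ : T, ∀ y : Y, t • y = t₀ • y := by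
    intro t
    obtain ⟨t₀, ht₀⟩ := hT t
    refine ⟨t₀, fun y => ?_⟩
    rw [← hY, ← sub_eq_zero, ← sub_smul, hkY _ ht₀]
  refine isCoCartesianMap_of_universal ?_ fun l hl => ?_
  · let W := BaseChange φ X
    have hW : ∀ t ∈ b.map φ, ∀ w : W, t • w = 0 := by
      intro t ht w
      have h1 : b.map φ ≤ Module.annihilator T W := by
        rw [Ideal.map_le_iff_le_comap]
        intro i hi
        rw [Ideal.mem_comap, Module.mem_annihilator]
        refine BaseChange.induction (by simp) ?_ ?_ ?_
        · intro x
          rw [← map_smulₛₗ, ← hX, hk, map_zero]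
          rw [RingHom.mem_ker, ← RingHom.comp_apply, he]
          exact Ideal.Quotient.eq_zero_iff_mem.mpr hi
        · intro r x hx
          rw [smul_comm, hx, smul_zero]
        · intro x y hx hy
          rw [smul_add, hx, hy, add_zero]
      exact Module.mem_annihilator.mp (h1 ht) w
    -- Being killed by `b T`, the module `W` becomes a `T₁`-module through `e'`, and the universal
    -- property of `g` over `T₁` applies to it.
    have hWt : Module.IsTorsionBySet T W (b.map φ) := fun w t => hW t t.2 w
    let : Module (T ⧸ b.map φ) W := hWt.module
    let : Module T₁ W := Module.compHom W e'
    have hWι : ∀ (t : T) (w : W), ι' t • w = t • w := by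
      intro t w
      change e' (ι' t) • w = _
      rw [← RingHom.comp_apply, he']
      rfl
    have hWk : ∀ t ∈ RingHom.ker e', ∀ w : W, t • w = 0 := by
      intro t ht w
      change e' t • w = 0
      rw [RingHom.mem_ker.mp ht, zero_smul]
    obtain ⟨k, hk'⟩ := hg.exists_lift (N' := W)
      { toFun := fun x => BaseChange.unit φ x
        map_add' := fun x y => map_add _ x y
        map_smul' := fun s x => by
          obtain ⟨s₀, hs₀, hs⟩ := hXX s
          have h2 : φ₁ s - ι' (φ s₀) ∈ RingHom.ker e' := by
            rw [← RingHom.comp_apply ι', ← sq, RingHom.comp_apply, ← map_sub, ← hee]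
            exact Ideal.mem_map_of_mem _ hs₀
          have h3 := hWk _ h2 (BaseChange.unit φ x)
          rw [sub_smul, sub_eq_zero] at h3
          rw [hs, map_smulₛₗ, h3, hWι] }
    refine ⟨{ toFun := k, map_add' := k.map_add, map_smul' := fun t y => ?_ }, fun m => ?_⟩
    · rw [← hY, map_smul, hWι]
      rfl
    · rw [hg₀]
      exact hk' m
  · ext y
    have : y ∈ Submodule.span T₁ (Set.range g) := hg.span_range ▸ Submodule.mem_top
    induction this using Submodule.span_induction with
    | mem y h =>
      obtain ⟨x, rfl⟩ := h
      rw [← hg₀, hl]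
      rfl
    | zero => exact map_zero l
    | add x y _ _ hx hy => rw [map_add, hx, hy]; rfl
    | smul r x _ hx =>
      obtain ⟨t₀, ht₀⟩ := hYY r
      rw [ht₀, map_smul, hx]
      rfl

end Change

/-! ### Gluing squares, their localizations and completions -/

section Gluing

variable {S T T' T'' : Type u} [CommRing S] [CommRing T] [CommRing T'] [CommRing T'']

/-- For all extensions of scalars of the `S`-module `N` to a commutative square of rings, `N` is
the fibre product of the other three modules. -/
def ExactOn (φ' : S →+* T') (φ'' : S →+* T'') (ψ' : T' →+* T) (ψ'' : T'' →+* T)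
    (N : Type u) [AddCommGroup N] [Module S N] : Prop :=
  ∀ (N' : Type u) [AddCommGroup N'] [Module T' N'] (N'' : Type u) [AddCommGroup N'']
    [Module T'' N''] (N₀ : Type u) [AddCommGroup N₀] [Module T N₀]
    (g' : N →ₛₗ[φ'] N') (g'' : N →ₛₗ[φ''] N'') (h' : N' →ₛₗ[ψ'] N₀) (h'' : N'' →ₛₗ[ψ''] N₀),
    IsCoCartesianMap g' → IsCoCartesianMap g'' → IsCoCartesianMap h' → IsCoCartesianMap h'' →
    (∀ n, h' (g' n) = h'' (g'' n)) →
    (∀ n, g' n = 0 → g'' n = 0 → n = 0) ∧ ∀ a b, h' a = h'' b → ∃ n, g' n = a ∧ g'' n = b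

/-- All finitely generated `S`-modules are fibre products of their extensions of scalars. -/
def IsGluing (φ' : S →+* T') (φ'' : S →+* T'') (ψ' : T' →+* T) (ψ'' : T'' →+* T) : Prop :=
  ∀ (N : Type u) [AddCommGroup N] [Module S N], Module.Finite S N → ExactOn φ' φ'' ψ' ψ'' N

variable {φ' : S →+* T'} {φ'' : S →+* T''} {ψ' : T' →+* T} {ψ'' : T'' →+* T}
variable {S₁ T₁ T'₁ T''₁ : Type u} [CommRing S₁] [CommRing T₁] [CommRing T'₁] [CommRing T''₁]
variable {φ'₁ : S₁ →+* T'₁} {φ''₁ : S₁ →+* T''₁} {ψ'₁ : T'₁ →+* T₁} {ψ''₁ : T''₁ →+* T₁}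
variable {ι : S →+* S₁} {ι' : T' →+* T'₁} {ι'' : T'' →+* T''₁} {ι₀ : T →+* T₁}

theorem smul_cancel_of_isUnit {R M : Type*} [CommRing R] [AddCommGroup M] [Module R M] {r : R}
    (hr : IsUnit r) {x y : M} (h : r • x = r • y) : x = y := hr.smul_left_cancel.mp h

/-- A finite module `N` over the localization `S₁` is the localization of the finite `S`-module `X`
spanned by its generators. Powers of `x` carry questions about `N` to the unlocalized square for
`X`, and these powers are invertible over the localized rings. -/
theorem IsGluing.localize (H : IsGluing φ' φ'' ψ' ψ'') (hc : ψ'.comp φ' = ψ''.comp φ'') {x : S}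
    (hι : IsAway ι x) (hι' : IsAway ι' (φ' x)) (hι'' : IsAway ι'' (φ'' x))
    (hι₀ : IsAway ι₀ (ψ' (φ' x)))
    (sφ' : φ'₁.comp ι = ι'.comp φ') (sφ'' : φ''₁.comp ι = ι''.comp φ'')
    (sψ' : ψ'₁.comp ι' = ι₀.comp ψ') (sψ'' : ψ''₁.comp ι'' = ι₀.comp ψ'') :
    IsGluing φ'₁ φ''₁ ψ'₁ ψ''₁ := by
  intro N _ _ hN N' _ _ N'' _ _ N₀ _ _ g' g'' h' h'' hg' hg'' hh' hh'' hcomm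
  let : Module S N := Module.compHom N ι
  have hS : ∀ (s : S) (n : N), ι s • n = s • n := fun _ _ => rfl
  obtain ⟨s, hs⟩ := hN
  let X := Submodule.span S (s : Set N)
  let i : X →ₛₗ[ι] N :=
    { toFun := fun x => x.1, map_add' := fun _ _ => rfl, map_smul' := fun _ _ => rfl }
  have hX : Module.Finite S X := ⟨(Submodule.fg_top _).mpr ⟨s, rfl⟩⟩
  have hi : IsCoCartesianMap i := by
    refine isCoCartesianMap_of_isAway hι (fun m hm => ⟨0, ?_⟩) fun n => ?_
    · rw [pow_zero, one_smul]
      exact Subtype.ext hm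
    · have : n ∈ Submodule.span S₁ (s : Set N) := hs ▸ Submodule.mem_top
      suffices h : ∃ k : ℕ, ι x ^ k • n ∈ X by
        obtain ⟨k, hk⟩ := h
        exact ⟨k, ⟨_, hk⟩, rfl⟩
      induction this using Submodule.span_induction with
      | mem y h => exact ⟨0, by simpa using Submodule.subset_span h⟩
      | zero => exact ⟨0, by simp⟩
      | add a b _ _ ha hb =>
        obtain ⟨k, hk⟩ := ha
        obtain ⟨l, hl⟩ := hb
        refine ⟨k + l, ?_⟩
        rw [smul_add, pow_add]
        refine add_mem ?_ ?_
        · rw [mul_comm, mul_smul, ← map_pow, hS]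
          exact X.smul_mem _ hk
        · rw [mul_smul, ← map_pow, hS]
          exact X.smul_mem _ hl
      | smul r a _ ha =>
        obtain ⟨k, hk⟩ := ha
        let := ι.toAlgebra
        have : IsLocalization.Away x S₁ := hι
        obtain ⟨⟨c, ⟨_, l, rfl⟩⟩, hl⟩ := IsLocalization.surj (Submonoid.powers x) r
        have hl' : r * ι x ^ l = ι c := by rw [← map_pow]; exact hl
        refine ⟨k + l, ?_⟩
        have e : ι x ^ (k + l) • r • a = ι c • ι x ^ k • a := by
          rw [← hl', smul_smul, smul_smul]
          congr 1
          ring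
        rw [e, hS]
        exact X.smul_mem _ hk
  -- The extensions of scalars of `X` to the old square; `j'`, `j''` and `j₀` exhibit the given
  -- modules as their localizations.
  let j' : BaseChange φ' X →ₛₗ[ι'] N' := BaseChange.semilift sφ' (scomp rfl g' i)
  let j'' : BaseChange φ'' X →ₛₗ[ι''] N'' := BaseChange.semilift sφ'' (scomp rfl g'' i)
  let p : BaseChange φ' X →ₛₗ[ψ'] BaseChange (ψ'.comp φ') X :=
    BaseChange.semilift rfl (BaseChange.unit _)
  let q : BaseChange φ'' X →ₛₗ[ψ''] BaseChange (ψ'.comp φ') X :=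
    BaseChange.semilift hc (BaseChange.unit _)
  have e₀ : ψ'₁.comp (φ'₁.comp ι) = ι₀.comp (ψ'.comp φ') := by
    rw [sφ', ← RingHom.comp_assoc, sψ', RingHom.comp_assoc]
  let j₀ : BaseChange (ψ'.comp φ') X →ₛₗ[ι₀] N₀ :=
    BaseChange.semilift e₀ (scomp rfl h' (scomp rfl g' i))
  have hj' : IsCoCartesianMap j' :=
    isCoCartesianMap_unit.of_comp (hi.comp hg' rfl (scomp_apply rfl g' i)) sφ'
      fun m => (BaseChange.semilift_unit _ _ m).symm
  have hj'' : IsCoCartesianMap j'' :=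
    isCoCartesianMap_unit.of_comp (hi.comp hg'' rfl (scomp_apply rfl g'' i)) sφ''
      fun m => (BaseChange.semilift_unit _ _ m).symm
  have hp : IsCoCartesianMap p := isCoCartesianMap_unit.of_comp isCoCartesianMap_unit rfl
    fun m => (BaseChange.semilift_unit _ _ m).symm
  have hq : IsCoCartesianMap q := isCoCartesianMap_unit.of_comp isCoCartesianMap_unit hc
    fun m => (BaseChange.semilift_unit _ _ m).symm
  have hj₀ : IsCoCartesianMap j₀ := isCoCartesianMap_unit.of_comp
    ((hi.comp hg' rfl (scomp_apply rfl g' i)).comp hh' rfl fun _ => rfl) e₀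
    fun m => (BaseChange.semilift_unit _ _ m).symm
  have hj'u : ∀ m : X, j' (BaseChange.unit φ' m) = g' m := fun m => BaseChange.semilift_unit _ _ m
  have hj''u : ∀ m : X, j'' (BaseChange.unit φ'' m) = g'' m :=
    fun m => BaseChange.semilift_unit _ _ m
  have hpu : ∀ m : X, p (BaseChange.unit φ' m) = BaseChange.unit _ m :=
    fun m => BaseChange.semilift_unit _ _ m
  have hqu : ∀ m : X, q (BaseChange.unit φ'' m) = BaseChange.unit _ m :=
    fun m => BaseChange.semilift_unit _ _ m
  have hj₀u : ∀ m : X, j₀ (BaseChange.unit _ m) = h' (g' m) :=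
    fun m => BaseChange.semilift_unit _ _ m
  have c' : ∀ y, j₀ (p y) = h' (j' y) := fun y =>
    isCoCartesianMap_unit.semi_ext_of_eq sψ'.symm (h := scomp rfl j₀ p)
      (k := scomp rfl h' j') (fun m => by simp only [scomp_apply, hpu, hj₀u, hj'u]) y
  have c'' : ∀ y, j₀ (q y) = h'' (j'' y) := fun y =>
    isCoCartesianMap_unit.semi_ext_of_eq sψ''.symm (h := scomp rfl j₀ q)
      (k := scomp rfl h'' j'') (fun m => by simp only [scomp_apply, hqu, hj₀u, hj''u, hcomm]) y
  obtain ⟨H1, H2⟩ := H X hX _ _ _ _ _ p q isCoCartesianMap_unit isCoCartesianMap_unit hp hq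
    fun n => by rw [hpu, hqu]
  have hu : IsUnit (ι x) := hι.isUnit
  have hu' : IsUnit (ι' (φ' x)) := hι'.isUnit
  have hu'' : IsUnit (ι'' (φ'' x)) := hι''.isUnit
  have ex' : φ'₁ (ι x) = ι' (φ' x) := DFunLike.congr_fun sφ' x
  have ex'' : φ''₁ (ι x) = ι'' (φ'' x) := DFunLike.congr_fun sφ'' x
  constructor
  · intro n hn' hn''
    obtain ⟨k, m, hm⟩ := hi.exists_pow_smul_eq hι n
    have hm' : j' (BaseChange.unit φ' m) = 0 := by
      rw [hj'u]
      change g' (i m) = 0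
      rw [← hm, map_smulₛₗ, hn', smul_zero]
    have hm'' : j'' (BaseChange.unit φ'' m) = 0 := by
      rw [hj''u]
      change g'' (i m) = 0
      rw [← hm, map_smulₛₗ, hn'', smul_zero]
    obtain ⟨a, ha⟩ := hj'.exists_pow_smul_eq_zero hι' hm'
    obtain ⟨b, hb⟩ := hj''.exists_pow_smul_eq_zero hι'' hm''
    have h0 : x ^ (a + b) • m = 0 := by
      apply H1
      · rw [map_smulₛₗ, map_pow, add_comm, pow_add, mul_smul, ha, smul_zero]
      · rw [map_smulₛₗ, map_pow, pow_add, mul_smul, hb, smul_zero]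
    refine smul_cancel_of_isUnit (hu.pow (a + b + k)) ?_
    rw [pow_add, mul_smul, hm, ← map_pow, ← map_smulₛₗ, h0, map_zero, smul_zero]
  · intro a b hab
    obtain ⟨k, a₀, ha₀⟩ := hj'.exists_pow_smul_eq hι' a
    obtain ⟨l, b₀, hb₀⟩ := hj''.exists_pow_smul_eq hι'' b
    let a₁ := φ' x ^ l • a₀
    let b₁ := φ'' x ^ k • b₀
    have ha₁ : j' a₁ = ι' (φ' x) ^ (l + k) • a := by
      rw [map_smulₛₗ, ← ha₀, map_pow, smul_smul, pow_add]
    have hb₁ : j'' b₁ = ι'' (φ'' x) ^ (l + k) • b := by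
      rw [map_smulₛₗ, ← hb₀, map_pow, smul_smul, add_comm, pow_add]
    have h0 : j₀ (p a₁ - q b₁) = 0 := by
      rw [map_sub, c', c'', ha₁, hb₁, map_smulₛₗ, map_smulₛₗ, hab, sub_eq_zero, map_pow, map_pow]
      congr 2
      have e1 := DFunLike.congr_fun sψ' (φ' x)
      have e2 := DFunLike.congr_fun sψ'' (φ'' x)
      have e3 := DFunLike.congr_fun hc x
      simp only [RingHom.comp_apply] at e1 e2 e3
      rw [e1, e2, e3]
    -- The two numerators agree only in the localization `N₀`; a further power of `x` makes them
    -- agree before it.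
    obtain ⟨r, hr⟩ := hj₀.exists_pow_smul_eq_zero hι₀ h0
    have e3 : ψ' (φ' x) = ψ'' (φ'' x) := DFunLike.congr_fun hc x
    obtain ⟨m, hm', hm''⟩ := H2 (φ' x ^ r • a₁) (φ'' x ^ r • b₁) (by
      rw [smul_sub, sub_eq_zero] at hr
      rw [map_smulₛₗ p, map_smulₛₗ q, map_pow, map_pow, ← e3, hr])
    obtain ⟨v, hv⟩ := hu.pow (r + (l + k))
    let n : N := (↑v⁻¹ : S₁) • i m
    have hn : ι x ^ (r + (l + k)) • n = i m := by
      rw [← hv, smul_smul, Units.mul_inv, one_smul]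
    refine ⟨n, ?_, ?_⟩
    · refine smul_cancel_of_isUnit (hu'.pow (r + (l + k))) ?_
      rw [← ex', ← map_pow, ← map_smulₛₗ, hn, map_pow, ex']
      change g' m = _
      rw [← hj'u, hm', map_smulₛₗ, ha₁, map_pow, smul_smul, ← pow_add]
    · refine smul_cancel_of_isUnit (hu''.pow (r + (l + k))) ?_
      rw [← ex'', ← map_pow, ← map_smulₛₗ, hn, map_pow, ex'']
      change g'' m = _
      rw [← hj''u, hm'', map_smulₛₗ, hb₁, map_pow, smul_smul, ← pow_add]

/-- The ring homomorphism `ι` has the properties of the completion of a noetherian ring at `J`. -/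
structure IsCompletion (ι : T →+* T₁) (J : Ideal T) : Prop where
  noeth : IsNoetherianRing T₁
  jac : J.map ι ≤ (⊥ : Ideal T₁).jacobson
  exists_eval (l : ℕ) : ∃ e : T₁ →+* T ⧸ J ^ l,
    e.comp ι = Ideal.Quotient.mk (J ^ l) ∧ RingHom.ker e = (J ^ l).map ι

/-- The reduction `N ⧸ b N` of an `S₁`-module, as an `S`-module. -/
def Reduction (ι : S →+* S₁) (b : Ideal S) (N : Type u) [AddCommGroup N] [Module S₁ N] : Type u :=
  N ⧸ (b.map ι • ⊤ : Submodule S₁ N)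

namespace Reduction

variable (ι) (b : Ideal S) (N : Type u) [AddCommGroup N] [Module S₁ N]

instance : AddCommGroup (Reduction ι b N) :=
  inferInstanceAs (AddCommGroup (N ⧸ (b.map ι • ⊤ : Submodule S₁ N)))

instance : Module S (Reduction ι b N) :=
  Module.compHom (N ⧸ (b.map ι • ⊤ : Submodule S₁ N)) ι

variable {ι b N}

/-- The reduction of an element. -/
def mk (n : N) : Reduction ι b N := (Submodule.Quotient.mk n : N ⧸ (b.map ι • ⊤ : Submodule S₁ N))

theorem mk_surjective : Function.Surjective (mk : N → Reduction ι b N) :=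
  Submodule.Quotient.mk_surjective _

theorem mk_add (x y : N) : (mk (x + y) : Reduction ι b N) = mk x + mk y := rfl

theorem mk_smul (s : S) (x : N) : (mk (ι s • x) : Reduction ι b N) = s • mk x := rfl

theorem mk_eq_zero {x : N} :
    (mk x : Reduction ι b N) = 0 ↔ x ∈ (b.map ι • ⊤ : Submodule S₁ N) :=
  Submodule.Quotient.mk_eq_zero _

theorem mk_eq_mk {x y : N} :
    (mk x : Reduction ι b N) = mk y ↔ x - y ∈ (b.map ι • ⊤ : Submodule S₁ N) :=
  Submodule.Quotient.eq _

theorem smul_eq_zero {s : S} (hs : s ∈ b) (x : Reduction ι b N) : s • x = 0 := by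
  obtain ⟨x, rfl⟩ := mk_surjective x
  rw [← mk_smul, mk_eq_zero]
  exact Submodule.smul_mem_smul (Ideal.mem_map_of_mem _ hs) trivial

theorem finite [Module.Finite S₁ N] {e : S₁ →+* S ⧸ b} (he : e.comp ι = Ideal.Quotient.mk b)
    (hk : RingHom.ker e = b.map ι) : Module.Finite S (Reduction ι b N) := by
  obtain ⟨s, hs⟩ := ‹Module.Finite S₁ N›
  classical
  refine ⟨s.image mk, eq_top_iff.mpr fun x hx => ?_⟩
  clear hx
  obtain ⟨x, rfl⟩ := mk_surjective x
  have : x ∈ Submodule.span S₁ (s : Set N) := hs ▸ Submodule.mem_top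
  induction this using Submodule.span_induction with
  | mem y h => exact Submodule.subset_span (by simpa using ⟨y, h, rfl⟩)
  | zero => exact zero_mem _
  | add x y _ _ hx hy => rw [mk_add]; exact add_mem hx hy
  | smul r x _ hx =>
    obtain ⟨c, hc⟩ := Ideal.Quotient.mk_surjective (e r)
    have : (mk (r • x) : Reduction ι b N) = c • mk x := by
      rw [← mk_smul, mk_eq_mk, ← sub_smul]
      refine Submodule.smul_mem_smul ?_ trivial
      rw [← hk, RingHom.mem_ker, map_sub, ← hc, ← he, RingHom.comp_apply, sub_self]
    rw [this]
    exact Submodule.smul_mem _ _ hx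

end Reduction

/-- Completion does not change the quotient rings, so a coCartesian map between completed rings,
reduced modulo `b`, is also coCartesian over the uncompleted rings. -/
theorem IsCoCartesianMap.exists_reduction {φ : S →+* T} {φ₁ : S₁ →+* T₁}
    (sq : φ₁.comp ι = ι₀.comp φ) {b : Ideal S} {c : Ideal T} (hbc : b.map φ = c)
    {e : S₁ →+* S ⧸ b} (he : e.comp ι = Ideal.Quotient.mk b)
    (hk : RingHom.ker e = b.map ι)
    {e' : T₁ →+* T ⧸ c} (he' : e'.comp ι₀ = Ideal.Quotient.mk c)
    (hk' : RingHom.ker e' = c.map ι₀)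
    {N : Type u} [AddCommGroup N] [Module S₁ N] {N' : Type u} [AddCommGroup N'] [Module T₁ N']
    {g : N →ₛₗ[φ₁] N'} (hg : IsCoCartesianMap g) :
    ∃ k : Reduction ι b N →ₛₗ[φ] Reduction ι₀ c N', IsCoCartesianMap k ∧
      ∀ n, k (.mk n) = .mk (g n) := by
  subst hbc
  have hJ : (b.map ι).map φ₁ = (b.map φ).map ι₀ := by
    rw [Ideal.map_map, sq, Ideal.map_map]
  have hle : (b.map ι • ⊤ : Submodule S₁ N) ≤
      ((b.map φ).map ι₀ • ⊤ : Submodule T₁ N').comap g := by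
    rw [Submodule.smul_le]
    intro r hr n _
    rw [Submodule.mem_comap, map_smulₛₗ, ← hJ]
    exact Submodule.smul_mem_smul (Ideal.mem_map_of_mem _ hr) trivial
  let k₁ := Submodule.mapQ _ _ g hle
  have hk₁ : IsCoCartesianMap k₁ := hg.quotient hJ fun m => rfl
  let k : Reduction ι b N →ₛₗ[φ] Reduction ι₀ (b.map φ) N' :=
    { toFun := k₁
      map_add' := k₁.map_add
      map_smul' := fun r x => by
        have := k₁.map_smulₛₗ (ι r) x
        rw [← RingHom.comp_apply φ₁, sq] at this
        exact this }
  refine ⟨k, ?_, fun n => rfl⟩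
  let : Module S (N ⧸ (b.map ι • ⊤ : Submodule S₁ N)) := Module.compHom _ ι
  let : Module T (N' ⧸ ((b.map φ).map ι₀ • ⊤ : Submodule T₁ N')) := Module.compHom _ ι₀
  refine IsCoCartesianMap.restrict (X := N ⧸ (b.map ι • ⊤ : Submodule S₁ N))
    (Y := N' ⧸ ((b.map φ).map ι₀ • ⊤ : Submodule T₁ N')) sq he he'
    (by rw [hk, hk', hJ]) (fun _ _ => rfl) (fun _ _ => rfl) ?_ hk₁ fun _ => rfl
  intro s hs x
  obtain ⟨x, rfl⟩ := Submodule.Quotient.mk_surjective _ x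
  rw [← Submodule.Quotient.mk_smul, Submodule.Quotient.mk_eq_zero]
  exact Submodule.smul_mem_smul (hk ▸ hs) trivial

theorem IsCompletion.exists_eval_map {I : Ideal S} {φ : S →+* T} (h : IsCompletion ι₀ (I.map φ))
    {l : ℕ} {c : Ideal T} (hc : (I ^ l).map φ = c) : ∃ e : T₁ →+* T ⧸ c,
      e.comp ι₀ = Ideal.Quotient.mk c ∧ RingHom.ker e = c.map ι₀ := by
  subst hc
  rw [Ideal.map_pow]
  exact h.exists_eval l

theorem IsCompletion.eq_zero {J : Ideal T} (h : IsCompletion ι₀ J) {N : Type u} [AddCommGroup N]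
    [Module T₁ N] [Module.Finite T₁ N] {x : N}
    (hx : ∀ l, x ∈ ((J ^ l).map ι₀ • ⊤ : Submodule T₁ N)) : x = 0 := by
  have := h.noeth
  refine IsHausdorff.haus (IsHausdorff.of_le_jacobson (J.map ι₀) N h.jac) x fun l => ?_
  rw [SModEq.zero, ← Ideal.map_pow]
  exact hx l

/-- Modulo `I ^ l` the completed square may be replaced by the uncompleted one, where only modules
killed by `I ^ l` occur. The injectivity statements for all `l` give injectivity by Krull's
intersection theorem, and they make the approximate solutions a Cauchy sequence, whose limit in the
complete module `N` is a solution. -/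
theorem isGluing_of_isCompletion {I : Ideal S} (hc : ψ'.comp φ' = ψ''.comp φ'')
    (H : ∀ (l : ℕ) (N : Type u) [AddCommGroup N] [Module S N], Module.Finite S N →
      (∀ r ∈ I ^ l, ∀ n : N, r • n = 0) → ExactOn φ' φ'' ψ' ψ'' N)
    (hι : IsCompletion ι I) (hι' : IsCompletion ι' (I.map φ'))
    (hι'' : IsCompletion ι'' (I.map φ'')) (hι₀ : IsCompletion ι₀ (I.map (ψ'.comp φ')))
    (hI : IsAdicComplete (I.map ι) S₁)
    (sφ' : φ'₁.comp ι = ι'.comp φ') (sφ'' : φ''₁.comp ι = ι''.comp φ'')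
    (sψ' : ψ'₁.comp ι' = ι₀.comp ψ') (sψ'' : ψ''₁.comp ι'' = ι₀.comp ψ'') :
    IsGluing φ'₁ φ''₁ ψ'₁ ψ''₁ := by
  intro N _ _ hN N' _ _ N'' _ _ N₀ _ _ g' g'' h' h'' hg' hg'' hh' hh'' hcomm
  have := hι.noeth
  have := isAdicComplete_of_finite (I.map ι) N
  have hN' := hg'.finite
  have hN'' := hg''.finite
  have key : ∀ l : ℕ, (∀ n, g' n ∈ (((I ^ l).map φ').map ι' • ⊤ : Submodule T'₁ N') →
      g'' n ∈ (((I ^ l).map φ'').map ι'' • ⊤ : Submodule T''₁ N'') →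
      n ∈ ((I ^ l).map ι • ⊤ : Submodule S₁ N)) ∧
      ∀ a b, h' a = h'' b → ∃ n,
        g' n - a ∈ (((I ^ l).map φ').map ι' • ⊤ : Submodule T'₁ N') ∧
        g'' n - b ∈ (((I ^ l).map φ'').map ι'' • ⊤ : Submodule T''₁ N'') := by
    intro l
    obtain ⟨e, he, hk⟩ := hι.exists_eval l
    obtain ⟨e', he', hk'⟩ := hι'.exists_eval_map (l := l) rfl
    obtain ⟨e'', he'', hk''⟩ := hι''.exists_eval_map (l := l) rfl
    obtain ⟨e₀, he₀, hk₀⟩ := hι₀.exists_eval_map (l := l) (c := ((I ^ l).map φ').map ψ')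
      (Ideal.map_map _ _).symm
    obtain ⟨G', hG', eG'⟩ := hg'.exists_reduction sφ' rfl he hk he' hk'
    obtain ⟨G'', hG'', eG''⟩ := hg''.exists_reduction sφ'' rfl he hk he'' hk''
    obtain ⟨H', hH', eH'⟩ := hh'.exists_reduction sψ' rfl he' hk' he₀ hk₀
    obtain ⟨H'', hH'', eH''⟩ := hh''.exists_reduction sψ'' (c := ((I ^ l).map φ').map ψ')
      (by rw [Ideal.map_map, Ideal.map_map, hc]) he'' hk'' he₀ hk₀
    obtain ⟨X1, X2⟩ := H l (Reduction ι (I ^ l) N) (Reduction.finite he hk)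
      (fun r hr n => Reduction.smul_eq_zero hr n) _ _ _ G' G'' H' H'' hG' hG'' hH' hH'' (by
        intro n
        obtain ⟨n, rfl⟩ := Reduction.mk_surjective n
        rw [eG', eG'', eH', eH'', hcomm])
    constructor
    · intro n h1 h2
      rw [← Reduction.mk_eq_zero] at h1 h2 ⊢
      exact X1 _ (by rw [eG', h1]) (by rw [eG'', h2])
    · intro a b hab
      obtain ⟨n, h1, h2⟩ := X2 (.mk a) (.mk b) (by rw [eH', eH'', hab])
      obtain ⟨n, rfl⟩ := Reduction.mk_surjective n
      rw [eG', Reduction.mk_eq_mk] at h1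
      rw [eG'', Reduction.mk_eq_mk] at h2
      exact ⟨n, h1, h2⟩
  have hmono : ∀ {P P₁ : Type u} [CommRing P] [CommRing P₁] (φ : S →+* P) (j : P →+* P₁)
      {m n : ℕ}, m ≤ n → ((I ^ n).map φ).map j ≤ ((I ^ m).map φ).map j := fun φ j _ _ h =>
    Ideal.map_mono (Ideal.map_mono (Ideal.pow_le_pow_right h))
  constructor
  · intro n h1 h2
    refine hι.eq_zero fun l => (key l).1 n ?_ ?_
    · rw [h1]; exact zero_mem _
    · rw [h2]; exact zero_mem _
  · intro a b hab
    choose c hc' hc'' using fun l => (key l).2 a b hab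
    -- For `m ≤ n` the solutions `c m` and `c n` both solve the problem modulo `I ^ m`, hence agree
    -- modulo `I ^ m`.
    obtain ⟨L, hL⟩ := IsPrecomplete.prec (I := I.map ι) (M := N) inferInstance (f := c) (by
      intro m n hmn
      rw [SModEq.sub_mem, ← Ideal.map_pow]
      apply (key m).1
      · rw [map_sub, ← sub_sub_sub_cancel_right _ _ a]
        exact sub_mem (hc' m) (Submodule.smul_mono_left (hmono φ' ι' hmn) (hc' n))
      · rw [map_sub, ← sub_sub_sub_cancel_right _ _ b]
        exact sub_mem (hc'' m) (Submodule.smul_mono_left (hmono φ'' ι'' hmn) (hc'' n)))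
    have himg : ∀ {P P₁ : Type u} [CommRing P] [CommRing P₁] {φ : S →+* P} {j : P →+* P₁}
        {φ₁ : S₁ →+* P₁} (_ : φ₁.comp ι = j.comp φ) {X : Type u} [AddCommGroup X] [Module P₁ X]
        (g : N →ₛₗ[φ₁] X) (l : ℕ), g (c l - L) ∈ (((I ^ l).map φ).map j • ⊤ : Submodule P₁ X) := by
      intro P P₁ _ _ φ j φ₁ sq X _ _ g l
      have h1 := hL l
      rw [SModEq.sub_mem, ← Ideal.map_pow] at h1
      have hle : ((I ^ l).map ι • ⊤ : Submodule S₁ N) ≤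
          (((I ^ l).map φ).map j • ⊤ : Submodule P₁ X).comap g := by
        rw [Submodule.smul_le]
        intro r hr n _
        rw [Submodule.mem_comap, map_smulₛₗ, Ideal.map_map, ← sq, ← Ideal.map_map]
        exact Submodule.smul_mem_smul (Ideal.mem_map_of_mem _ hr) trivial
      exact hle h1
    refine ⟨L, ?_, ?_⟩
    · rw [← sub_eq_zero]
      refine hι'.eq_zero fun l => ?_
      rw [← Ideal.map_pow, show g' L - a = (g' (c l) - a) - g' (c l - L) by rw [map_sub]; abel]
      exact sub_mem (hc' l) (himg sφ' g' l)
    · rw [← sub_eq_zero]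
      refine hι''.eq_zero fun l => ?_
      rw [← Ideal.map_pow, show g'' L - b = (g'' (c l) - b) - g'' (c l - L) by rw [map_sub]; abel]
      exact sub_mem (hc'' l) (himg sφ'' g'' l)

end Gluing

/-! ### Gluing a flat completion along `x` with the localization at `x` -/

section Base

variable {C T T' T'' : Type u} [CommRing C] [CommRing T] [CommRing T'] [CommRing T'']
variable {φ' : C →+* T'} {φ'' : C →+* T''} {ψ' : T' →+* T} {ψ'' : T'' →+* T}

/-- The kernel of multiplication by `c` after a flat extension of scalars. -/
theorem IsCoCartesianMap.mem_span_of_flat (hf : φ'.Flat) {N : Type u} [AddCommGroup N] [Module C N]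
    {N' : Type u} [AddCommGroup N'] [Module T' N'] {g : N →ₛₗ[φ'] N'} (hg : IsCoCartesianMap g)
    {c : C} {a : N'} (ha : φ' c • a = 0) :
    a ∈ Submodule.span T' (g '' {n | c • n = 0}) := by
  let := φ'.toAlgebra
  have : Module.Flat C T' := hf
  let : Module C N' := Module.compHom N' φ'
  have : IsScalarTower C T' N' := ⟨fun r s x => by
    change (φ' r * s) • x = φ' r • (s • x)
    rw [mul_smul]⟩
  have hb : IsBaseChange T' (toLinearOfSemilinear g) :=
    (isCoCartesianMap_iff_isBaseChange φ' g).mp hg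
  let K := LinearMap.ker (LinearMap.lsmul C N c)
  have hex : Function.Exact K.subtype (LinearMap.lsmul C N c) :=
    LinearMap.exact_subtype_ker_map _
  have hex' := Module.Flat.lTensor_exact T' hex
  have hmul : ∀ t : TensorProduct C T' N, (LinearMap.lsmul C N c).lTensor T' t = c • t := by
    intro t
    induction t with
    | zero => simp
    | add x y hx hy => rw [map_add, hx, hy, smul_add]
    | tmul r n => simp
  -- By flatness, tensoring with `T'` preserves the exact sequence `K → N → N` given by
  -- multiplication by `c`.
  have h0 : (LinearMap.lsmul C N c).lTensor T' (hb.equiv.symm a) = 0 := by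
    rw [hmul, ← algebraMap_smul T' c, ← map_smul]
    exact (congrArg _ ha).trans (map_zero _)
  obtain ⟨s, hs⟩ := (hex' _).mp h0
  have hmem : ∀ s, hb.equiv (K.subtype.lTensor T' s) ∈
      Submodule.span T' (g '' {n | c • n = 0}) := by
    intro s
    induction s with
    | zero => simp
    | add x y hx hy => rw [map_add, map_add]; exact add_mem hx hy
    | tmul r n =>
      rw [LinearMap.lTensor_tmul, IsBaseChange.equiv_tmul]
      exact Submodule.smul_mem _ _ (Submodule.subset_span ⟨n, n.2, rfl⟩)
  have := hmem s
  rwa [hs, LinearEquiv.apply_symm_apply] at this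

/-- Let `m = I + (x)`. As a power of `I` kills `N`, the `m`-adic and the `x`-adic topology of `N`
coincide. Extension along `φ'`, which is flat and unchanged modulo powers of `m`, therefore neither
creates divisibility by `x ^ k` (`hdiv`) nor new `x ^ k`-torsion (`hker`). Denominators that are
powers of `x` can then be removed as in the theorem of Beauville and Laszlo. -/
theorem exactOn_of_flat [IsNoetherianRing C] (hc : ψ'.comp φ' = ψ''.comp φ'') (I : Ideal C) (x : C)
    (hf : φ'.Flat)
    (hev : ∀ l, ∃ e : T' →+* C ⧸ (I ⊔ Ideal.span {x}) ^ l,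
      e.comp φ' = Ideal.Quotient.mk _ ∧ RingHom.ker e = ((I ⊔ Ideal.span {x}) ^ l).map φ')
    (hφ'' : IsAway φ'' x) (hψ' : IsAway ψ' (φ' x)) (l : ℕ)
    (N : Type u) [AddCommGroup N] [Module C N] (hN : Module.Finite C N)
    (hl : ∀ r ∈ I ^ l, ∀ n : N, r • n = 0) : ExactOn φ' φ'' ψ' ψ'' N := by
  intro N' _ _ N'' _ _ N₀ _ _ g' g'' h' h'' hg' hg'' hh' hh'' hcomm
  let m := I ⊔ Ideal.span {x}
  -- The summand in `I ^ l` acts as zero, so elements of `m ^ (l + k)` act on `N` as multiples of `x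
  -- ^ k`.
  have hm : ∀ k, ∀ r ∈ m ^ (l + k), ∃ s ∈ I ^ l, ∃ c, r = s + x ^ k * c := by
    intro k r hr
    have h1 := Ideal.sup_pow_add_le_pow_sup_pow hr
    obtain ⟨s, hs, t, ht, rfl⟩ := Submodule.mem_sup.mp h1
    rw [Ideal.span_singleton_pow, Ideal.mem_span_singleton'] at ht
    obtain ⟨c, rfl⟩ := ht
    exact ⟨s, hs, c, by ring⟩
  -- The evaluation `e` gives a map `N' → N / m ^ p N` that extends the projection of `N`; it
  -- carries divisibility in `N'` back to `N` modulo `m ^ p`.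
  have hret : ∀ p, ∀ n : N, ∀ y : C, ∀ a : N', g' n = φ' y • a →
      ∃ n₁ : N, n - y • n₁ ∈ (m ^ p • ⊤ : Submodule C N) := by
    intro p n y a hna
    obtain ⟨e, he, hk⟩ := hev p
    let W := N ⧸ (m ^ p • ⊤ : Submodule C N)
    let : Module T' W := Module.compHom W e
    obtain ⟨r, hr⟩ := hg'.exists_lift (N' := W)
      { toFun := fun n => Submodule.Quotient.mk n
        map_add' := fun _ _ => rfl
        map_smul' := fun c n => by
          change _ = e (φ' c) • (Submodule.Quotient.mk n : W)
          rw [← RingHom.comp_apply, he]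
          rfl }
    obtain ⟨n₁, hn₁⟩ := Submodule.Quotient.mk_surjective _ (r a)
    refine ⟨n₁, ?_⟩
    rw [← Submodule.Quotient.mk_eq_zero, Submodule.Quotient.mk_sub, Submodule.Quotient.mk_smul,
      sub_eq_zero, hn₁]
    have h1 := congrArg r hna
    rw [hr, map_smul] at h1
    refine h1.trans ?_
    change e (φ' y) • r a = _
    rw [← RingHom.comp_apply, he]
    rfl
  have hdiv : ∀ k, ∀ n : N, ∀ a : N', g' n = φ' (x ^ k) • a → ∃ n₁ : N, n = x ^ k • n₁ := by
    intro k n a h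
    obtain ⟨n₁, hn₁⟩ := hret (l + k) n (x ^ k) a h
    have hle : (m ^ (l + k) • ⊤ : Submodule C N) ≤
        LinearMap.range (LinearMap.lsmul C N (x ^ k)) := by
      rw [Submodule.smul_le]
      intro r hr n _
      obtain ⟨s, hs, c, rfl⟩ := hm k r hr
      rw [add_smul, hl s hs, zero_add, mul_smul]
      exact ⟨c • n, rfl⟩
    obtain ⟨n₂, hn₂⟩ := hle hn₁
    refine ⟨n₁ + n₂, ?_⟩
    rw [smul_add, ← LinearMap.lsmul_apply (R := C) (x ^ k) n₂, hn₂]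
    abel
  -- By flatness the torsion of `N'` is spanned over `T'` by that of `N`. Since `m ^ (l + k)` kills
  -- the `x ^ k`-torsion of `N`, the ring `T'` acts on its image through `C / m ^ (l + k)`, so no
  -- new elements arise.
  have hker : ∀ k, ∀ a : N', φ' (x ^ k) • a = 0 → ∃ n, x ^ k • n = 0 ∧ g' n = a := by
    intro k a ha
    obtain ⟨e, he, hk⟩ := hev (l + k)
    have := hg'.mem_span_of_flat hf ha
    clear ha
    induction this using Submodule.span_induction with
    | mem y h =>
      obtain ⟨n, hn, rfl⟩ := h
      exact ⟨n, hn, rfl⟩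
    | zero => exact ⟨0, smul_zero _, map_zero _⟩
    | add y z _ _ hy hz =>
      obtain ⟨n, hn, rfl⟩ := hy
      obtain ⟨n', hn', rfl⟩ := hz
      exact ⟨n + n', by rw [smul_add, hn, hn', add_zero], map_add _ _ _⟩
    | smul t y _ hy =>
      obtain ⟨n, hn, rfl⟩ := hy
      obtain ⟨c, hc⟩ := Ideal.Quotient.mk_surjective (e t)
      refine ⟨c • n, by rw [smul_comm, hn, smul_zero], ?_⟩
      have h1 : t - φ' c ∈ (m ^ (l + k)).map φ' := by
        rw [← hk, RingHom.mem_ker, map_sub, ← hc, ← he, RingHom.comp_apply, sub_self]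
      have h2 : (m ^ (l + k)).map φ' ≤ LinearMap.ker (LinearMap.toSpanSingleton T' N' (g' n)) := by
        rw [Ideal.map_le_iff_le_comap]
        intro r hr
        obtain ⟨s, hs, c, rfl⟩ := hm k r hr
        rw [Ideal.mem_comap, LinearMap.mem_ker, LinearMap.toSpanSingleton_apply, ← map_smulₛₗ,
          add_smul, hl s hs, zero_add, mul_comm, mul_smul, hn, smul_zero, map_zero]
      have h3 : (t - φ' c) • g' n = 0 := h2 h1
      rw [sub_smul, sub_eq_zero] at h3
      rw [map_smulₛₗ, h3]
  constructor
  · intro n h1 h2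
    obtain ⟨k, hk⟩ := hg''.exists_pow_smul_eq_zero hφ'' h2
    have h3 : n ∈ (⨅ i : ℕ, m ^ i • ⊤ : Submodule C N) := by
      rw [Submodule.mem_iInf]
      intro i
      obtain ⟨n₁, hn₁⟩ := hret i n 0 0 (by rw [h1, smul_zero])
      simpa using hn₁
    obtain ⟨⟨r, hr⟩, hrn⟩ := (Ideal.mem_iInf_smul_pow_eq_bot_iff m n).mp h3
    -- Krull's intersection theorem provides `r ∈ m` fixing `n`; a high power of `r` acts as a
    -- multiple of `x ^ k`, which kills `n`.
    have h4 : ∀ i : ℕ, r ^ i • n = n := by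
      intro i
      induction i with
      | zero => simp
      | succ i ih => rw [pow_succ, mul_smul, hrn, ih]
    obtain ⟨s, hs, c, hc'⟩ := hm k (r ^ (l + k)) (Ideal.pow_mem_pow hr _)
    rw [← h4 (l + k), hc', add_smul, hl s hs, zero_add, mul_comm, mul_smul, hk, smul_zero]
  · intro a b hab
    obtain ⟨k, n, hn⟩ := hg''.exists_pow_smul_eq hφ'' b
    have h1 : h' (φ' x ^ k • a - g' n) = 0 := by
      rw [map_sub, hcomm, ← hn, map_smulₛₗ, map_smulₛₗ, hab, map_pow, map_pow,
        ← RingHom.comp_apply, hc, RingHom.comp_apply, sub_self]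
    obtain ⟨j, hj⟩ := hh'.exists_pow_smul_eq_zero hψ' h1
    have h2 : φ' (x ^ (j + k)) • a = g' (x ^ j • n) := by
      rw [smul_sub, sub_eq_zero, smul_smul, ← pow_add] at hj
      rw [map_smulₛₗ, map_pow, map_pow, hj]
    -- Division by `x ^ (j + k)` is possible already in `N`; it determines `a` up to torsion, which
    -- also comes from `N`.
    obtain ⟨n₁, hn₁⟩ := hdiv (j + k) _ a h2.symm
    obtain ⟨n₂, hn₂, hn₂'⟩ := hker (j + k) (a - g' n₁) (by
      rw [smul_sub, h2, hn₁, map_smulₛₗ, sub_self])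
    have h3 : x ^ (j + k) • (n₁ + n₂) = x ^ j • n := by rw [smul_add, hn₂, add_zero, hn₁]
    refine ⟨n₁ + n₂, ?_, ?_⟩
    · rw [map_add, hn₂']
      abel
    · refine smul_cancel_of_isUnit (hφ''.isUnit.pow (j + k)) ?_
      rw [← map_pow, ← map_smulₛₗ, h3, map_smulₛₗ, ← hn, map_pow, map_pow, smul_smul, pow_add]

end Base

/-! ### Effectivity: constructing a module from glueing data -/

section Effective

theorem isPrecomplete_prod {R M N : Type*} [CommRing R] (I : Ideal R) [AddCommGroup M] [Module R M]
    [AddCommGroup N] [Module R N] [IsPrecomplete I M] [IsPrecomplete I N] :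
    IsPrecomplete I (M × N) where
  prec' c hc := by
    obtain ⟨a, ha⟩ := IsPrecomplete.prec (I := I) (M := M) inferInstance (f := fun k => (c k).1) (by
      intro m n hmn
      have := hc hmn
      rw [SModEq.sub_mem] at this ⊢
      exact Submodule.smul_top_le_comap_smul_top (I ^ m) (LinearMap.fst R M N) this)
    obtain ⟨b, hb⟩ := IsPrecomplete.prec (I := I) (M := N) inferInstance (f := fun k => (c k).2) (by
      intro m n hmn
      have := hc hmn
      rw [SModEq.sub_mem] at this ⊢
      exact Submodule.smul_top_le_comap_smul_top (I ^ m) (LinearMap.snd R M N) this)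
    refine ⟨(a, b), fun k => ?_⟩
    have h1 := ha k
    have h2 := hb k
    rw [SModEq.sub_mem] at h1 h2 ⊢
    have e : c k - (a, b) = LinearMap.inl R M N ((c k).1 - a) + LinearMap.inr R M N ((c k).2 - b) := by
      ext <;> simp
    rw [e]
    exact add_mem (Submodule.smul_top_le_comap_smul_top (I ^ k) (LinearMap.inl R M N) h1)
      (Submodule.smul_top_le_comap_smul_top (I ^ k) (LinearMap.inr R M N) h2)

variable {S T T' T'' : Type u} [CommRing S] [CommRing T] [CommRing T'] [CommRing T'']

/-- A square of rings like the one of the completions of a noetherian ring along a closed subset,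
a principal open subset, and both. -/
structure IsFormalSquare (φ' : S →+* T') (φ'' : S →+* T'') (ψ' : T' →+* T) (ψ'' : T'' →+* T)
    (I : Ideal S) (x : S) : Prop where
  comm : ψ'.comp φ' = ψ''.comp φ''
  noeth' : IsNoetherianRing T'
  noeth'' : IsNoetherianRing T''
  noeth : IsNoetherianRing T
  complete' : IsAdicComplete (I.map φ' ⊔ Ideal.span {φ' x}) T'
  complete'' : IsAdicComplete (I.map φ'') T''
  complete : IsAdicComplete (I.map (ψ'.comp φ')) T
  isUnit'' : IsUnit (φ'' x)
  exists_eq (a : T') (b : T'') : ψ' a = ψ'' b → ∃ s, φ' s = a ∧ φ'' s = b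
  exists_pow (t : T) : ∃ (k : ℕ) (a : T'), ψ' (φ' x) ^ k * t - ψ' a ∈ I.map (ψ'.comp φ')
  exists_add (t : T) (k : ℕ) : ∃ (a : T') (b : T''),
    t - ψ' (φ' x ^ k * a) - ψ'' b ∈ I.map (ψ'.comp φ')

variable {φ' : S →+* T'} {φ'' : S →+* T''} {ψ' : T' →+* T} {ψ'' : T'' →+* T} {I : Ideal S} {x : S}

section Generators

variable {M' : Type u} [AddCommGroup M'] [Module T' M'] [Module.Finite T' M']
  {M'' : Type u} [AddCommGroup M''] [Module T'' M''] [Module.Finite T'' M'']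
  {M : Type u} [AddCommGroup M] [Module T M] [Module.Finite T M]
  {h' : M' →ₛₗ[ψ'] M} {h'' : M'' →ₛₗ[ψ''] M}

omit [Module.Finite T' M'] [Module.Finite T M] in
theorem IsFormalSquare.exists_pow_smul (H : IsFormalSquare φ' φ'' ψ' ψ'' I x)
    (s' : Submodule.span T (Set.range h') = ⊤) (m : M) :
    ∃ (k : ℕ) (n : M'), ψ' (φ' x) ^ k • m - h' n ∈ (I.map (ψ'.comp φ') • ⊤ : Submodule T M) := by
  have : m ∈ Submodule.span T (Set.range h') := s' ▸ Submodule.mem_top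
  induction this using Submodule.span_induction with
  | mem y h =>
    obtain ⟨n, rfl⟩ := h
    exact ⟨0, n, by simp⟩
  | zero => exact ⟨0, 0, by simp⟩
  | add y z _ _ hy hz =>
    obtain ⟨k, n, hn⟩ := hy
    obtain ⟨l, p, hp⟩ := hz
    refine ⟨k + l, φ' x ^ l • n + φ' x ^ k • p, ?_⟩
    have e : ψ' (φ' x) ^ (k + l) • (y + z) - h' (φ' x ^ l • n + φ' x ^ k • p) =
        ψ' (φ' x) ^ l • (ψ' (φ' x) ^ k • y - h' n) +
        ψ' (φ' x) ^ k • (ψ' (φ' x) ^ l • z - h' p) := by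
      simp only [map_add, map_smulₛₗ, map_pow]
      module
    rw [e]
    exact add_mem (Submodule.smul_mem _ _ hn) (Submodule.smul_mem _ _ hp)
  | smul t y _ hy =>
    obtain ⟨k, n, hn⟩ := hy
    obtain ⟨l, a, ha⟩ := H.exists_pow t
    refine ⟨l + k, a • n, ?_⟩
    have e : ψ' (φ' x) ^ (l + k) • t • y - h' (a • n) =
        (ψ' (φ' x) ^ l * t - ψ' a) • (ψ' (φ' x) ^ k • y) + ψ' a • (ψ' (φ' x) ^ k • y - h' n) := by
      simp only [map_smulₛₗ]
      module
    rw [e]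
    exact add_mem (Submodule.smul_mem_smul ha trivial) (Submodule.smul_mem _ _ hn)

omit [Module.Finite T' M'] [Module.Finite T'' M''] [Module.Finite T M] in
-- Modulo `I`, every element of `T` is a sum from `x ^ k T'` and `T''`, for arbitrary `k`. If `k` is
-- large enough, the power of `x` also moves a given generator from `M''` into the image of `M'`.
theorem IsFormalSquare.exists_add_mod (H : IsFormalSquare φ' φ'' ψ' ψ'' I x)
    (s' : Submodule.span T (Set.range h') = ⊤) (s'' : Submodule.span T (Set.range h'') = ⊤) (m : M) :
    ∃ (n : M') (p : M''), m - h' (φ' x • n) - h'' p ∈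
      (I.map (ψ'.comp φ') • ⊤ : Submodule T M) := by
  have : m ∈ Submodule.span T (Set.range h'') := s'' ▸ Submodule.mem_top
  -- The images of `M'` and `M''` are not `T`-submodules; allowing all multiples `t • m` makes the
  -- induction over the span work.
  suffices hs : ∀ t : T, ∃ (n : M') (p : M''), t • m - h' (φ' x • n) - h'' p ∈
      (I.map (ψ'.comp φ') • ⊤ : Submodule T M) by simpa using hs 1
  induction this using Submodule.span_induction with
  | mem y h =>
    obtain ⟨p, rfl⟩ := h
    intro t
    obtain ⟨k, n, hn⟩ := H.exists_pow_smul s' (h'' p)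
    -- `k` factors `x` are used up to clear the denominator of `h'' p`; the additional one is the
    -- factor `φ' x` in the claim.
    obtain ⟨a, b, hab⟩ := H.exists_add t (k + 1)
    refine ⟨a • n, b • p, ?_⟩
    have e : t • h'' p - h' (φ' x • a • n) - h'' (b • p) =
        (t - ψ' (φ' x ^ (k + 1) * a) - ψ'' b) • h'' p +
          (ψ' (φ' x) * ψ' a) • (ψ' (φ' x) ^ k • h'' p - h' n) := by
      simp only [map_smulₛₗ, map_mul, map_pow]
      module
    rw [e]
    exact add_mem (Submodule.smul_mem_smul hab trivial) (Submodule.smul_mem _ _ hn)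
  | zero => exact fun t => ⟨0, 0, by simp⟩
  | add y z _ _ hy hz =>
    intro t
    obtain ⟨n, p, h1⟩ := hy t
    obtain ⟨n', p', h2⟩ := hz t
    refine ⟨n + n', p + p', ?_⟩
    convert add_mem h1 h2 using 1
    simp only [map_smulₛₗ, map_add, smul_add]
    abel
  | smul r y _ hy =>
    intro t
    rw [smul_smul]
    exact hy _

/-- Successive approximation: the `S`-linear map `(n, p) ↦ h' (x n) + h'' p` is surjective modulo
`I`, its source is `I`-adically precomplete and its target is separated. -/
theorem IsFormalSquare.exists_add_eq (H : IsFormalSquare φ' φ'' ψ' ψ'' I x)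
    (s' : Submodule.span T (Set.range h') = ⊤) (s'' : Submodule.span T (Set.range h'') = ⊤) (m : M) :
    ∃ (n : M') (p : M''), m = h' (φ' x • n) + h'' p := by
  have := H.noeth'
  have := H.noeth''
  have := H.noeth
  have := H.complete'
  have := H.complete''
  have := H.complete
  let := φ'.toAlgebra
  let := φ''.toAlgebra
  let := (ψ'.comp φ').toAlgebra
  let : Module S M' := Module.compHom M' φ'
  let : Module S M'' := Module.compHom M'' φ''
  let : Module S M := Module.compHom M (ψ'.comp φ')
  have : IsScalarTower S T' M' := ⟨fun r s x => mul_smul (φ' r) s x⟩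
  have : IsScalarTower S T'' M'' := ⟨fun r s x => mul_smul (φ'' r) s x⟩
  have : IsScalarTower S T M := ⟨fun r s x => mul_smul (ψ'.comp φ' r) s x⟩
  -- `T'` is given as complete for the larger ideal `I + (x)` only.
  have c' : IsAdicComplete (I.map φ') M' := isAdicComplete_of_le (J := I.map φ' ⊔ Ideal.span {φ' x}) le_sup_left M'
  have c'' : IsAdicComplete (I.map φ'') M'' := isAdicComplete_of_finite _ M''
  have c : IsAdicComplete (I.map (ψ'.comp φ')) M := isAdicComplete_of_finite _ M
  have : IsPrecomplete I M' := IsPrecomplete.map_algebraMap_iff.mp c'.toIsPrecomplete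
  have : IsPrecomplete I M'' := IsPrecomplete.map_algebraMap_iff.mp c''.toIsPrecomplete
  have : IsHausdorff I M := IsHausdorff.map_algebraMap_iff.mp c.toIsHausdorff
  have := isPrecomplete_prod I (M := M') (N := M'')
  let F : M' × M'' →ₗ[S] M :=
    { toFun := fun y => h' (φ' x • y.1) + h'' y.2
      map_add' := fun y z => by simp only [Prod.fst_add, Prod.snd_add, smul_add, map_add]; abel
      map_smul' := fun r y => by
        change h' (φ' x • φ' r • y.1) + h'' (φ'' r • y.2) =
          (ψ'.comp φ' r) • (h' (φ' x • y.1) + h'' y.2)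
        rw [smul_comm, map_smulₛₗ h', map_smulₛₗ h'', smul_add, ← RingHom.comp_apply ψ'',
          ← H.comm, RingHom.comp_apply] }
  have hF : Function.Surjective F := by
    refine surjective_of_mkQ_comp_surjective (I := I) fun y => ?_
    obtain ⟨m, rfl⟩ := Submodule.mkQ_surjective _ y
    obtain ⟨n, p, hnp⟩ := H.exists_add_mod s' s'' m
    refine ⟨(n, p), ?_⟩
    rw [LinearMap.comp_apply, ← sub_eq_zero, ← map_sub, ← neg_sub, map_neg, neg_eq_zero,
      Submodule.mkQ_apply, Submodule.Quotient.mk_eq_zero]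
    have e : (I • ⊤ : Submodule S M) =
        (I.map (algebraMap S T) • ⊤ : Submodule T M).restrictScalars S := by
      rw [Submodule.restrictScalars_map_smul_eq]
      rfl
    rw [e]
    rw [sub_sub] at hnp
    exact hnp
  obtain ⟨⟨n, p⟩, h⟩ := hF m
  exact ⟨n, p, h.symm⟩

/-- The fibre product `K` of `M'` and `M''` over `M` is large enough: by `exists_add_eq` its
projections generate `M'` modulo `x` and `M''` modulo `I`, which suffices by Nakayama's lemma.
Finitely many elements of `K` then do for both modules. -/
theorem IsFormalSquare.exists_generators (H : IsFormalSquare φ' φ'' ψ' ψ'' I x)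
    (s' : Submodule.span T (Set.range h') = ⊤) (s'' : Submodule.span T (Set.range h'') = ⊤) :
    ∃ (κ : Type u) (_ : Finite κ) (a : κ → M') (b : κ → M''), (∀ j, h' (a j) = h'' (b j)) ∧
      Submodule.span T' (Set.range a) = ⊤ ∧ Submodule.span T'' (Set.range b) = ⊤ := by
  have := H.complete'
  have := H.complete''
  let K : Set (M' × M'') := {y | h' y.1 = h'' y.2}
  have hadd := H.exists_add_eq s' s''
  have h1 : Submodule.span T' (Prod.fst '' K) = ⊤ := by
    refine top_le_iff.mp (Submodule.le_of_le_smul_of_le_jacobson_bot (Module.finite_def.mp ‹_›)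
      (IsAdicComplete.le_jacobson_bot (I.map φ' ⊔ Ideal.span {φ' x})) fun m _ => ?_)
    -- Subtracting `x n` from `m` gives an element whose image is `h'' p`, so it is the first
    -- component of an element of `K`.
    obtain ⟨n, p, hnp⟩ := hadd (h' m)
    rw [← sub_add_cancel m (φ' x • n)]
    refine Submodule.add_mem_sup (Submodule.subset_span ⟨(m - φ' x • n, p), ?_, rfl⟩)
      (Submodule.smul_mem_smul (Ideal.mem_sup_right (Ideal.mem_span_singleton_self _)) trivial)
    change h' (m - φ' x • n) = h'' p
    rw [map_sub, hnp, add_sub_cancel_left]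
  have h2 : Submodule.span T'' (Prod.snd '' K) = ⊤ := by
    refine top_le_iff.mp (Submodule.le_of_le_smul_of_le_jacobson_bot (Module.finite_def.mp ‹_›)
      (IsAdicComplete.le_jacobson_bot (I.map φ'')) fun m _ => ?_)
    obtain ⟨k, n, hn⟩ := H.exists_pow_smul s' (h'' m)
    -- Multiplying `M = h' (M') + h'' (M'')` by `I` shows `I M ⊆ h' (M') + h'' (I M'')`. Thus `x ^ k
    -- m` can be lifted to `K` after a correction in `I M''`, and `x` is a unit of `T''`.
    have hI : ∀ y ∈ (I.map (ψ'.comp φ') • ⊤ : Submodule T M), ∃ (n : M') (p : M''),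
        p ∈ (I.map φ'' • ⊤ : Submodule T'' M'') ∧ y = h' n + h'' p := by
      intro y hy
      refine Submodule.smul_induction_on hy (fun r hr z _ => ?_) ?_
      · induction hr using Submodule.span_induction generalizing z with
        | mem t ht =>
          obtain ⟨r, hr, rfl⟩ := ht
          obtain ⟨n, p, rfl⟩ := hadd z
          refine ⟨φ' r • φ' x • n, φ'' r • p,
            Submodule.smul_mem_smul (Ideal.mem_map_of_mem _ hr) trivial, ?_⟩
          rw [smul_add, map_smulₛₗ h' (φ' r), map_smulₛₗ h'' (φ'' r), ← RingHom.comp_apply ψ'',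
            ← H.comm, RingHom.comp_apply]
        | zero => exact ⟨0, 0, zero_mem _, by simp⟩
        | add r t _ _ hr ht =>
          obtain ⟨n, p, hp, h1⟩ := hr z trivial
          obtain ⟨n', p', hp', h2⟩ := ht z trivial
          exact ⟨n + n', p + p', add_mem hp hp',
            by rw [add_smul, h1, h2]; simp only [map_add]; abel⟩
        | smul s r _ hr =>
          rw [smul_eq_mul, mul_comm, mul_smul]
          exact hr _ trivial
      · rintro y z ⟨n, p, hp, rfl⟩ ⟨n', p', hp', rfl⟩
        exact ⟨n + n', p + p', add_mem hp hp', by simp only [map_add]; abel⟩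
    obtain ⟨n', p, hp, he⟩ := hI _ hn
    have hK : φ'' x ^ k • m - p ∈ Submodule.span T'' (Prod.snd '' K) := by
      refine Submodule.subset_span ⟨(n + n', φ'' x ^ k • m - p), ?_, rfl⟩
      change h' (n + n') = h'' (φ'' x ^ k • m - p)
      rw [map_add, map_sub, map_smulₛₗ h'', map_pow, ← RingHom.comp_apply ψ'', ← H.comm,
        RingHom.comp_apply, ← sub_add_cancel (ψ' (φ' x) ^ k • h'' m) (h' n), he]
      abel
    obtain ⟨v, hv⟩ := H.isUnit''.pow k
    have e : m = (↑v⁻¹ : T'') • ((φ'' x ^ k • m - p) + p) := by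
      rw [sub_add_cancel, ← hv, smul_smul, Units.inv_mul, one_smul]
    rw [e]
    exact Submodule.smul_mem _ _ (Submodule.add_mem_sup hK hp)
  obtain ⟨A, hA, hA'⟩ := Submodule.fg_span_iff_fg_span_finset_subset _ |>.mp
    (h1 ▸ Module.finite_def.mp ‹Module.Finite T' M'›)
  obtain ⟨B, hB, hB'⟩ := Submodule.fg_span_iff_fg_span_finset_subset _ |>.mp
    (h2 ▸ Module.finite_def.mp ‹Module.Finite T'' M''›)
  rw [h1] at hA'
  rw [h2] at hB'
  have hα : ∀ y : A, ∃ z ∈ K, z.1 = y := fun y => hA y.2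
  have hβ : ∀ y : B, ∃ z ∈ K, z.2 = y := fun y => hB y.2
  choose α hα hα' using hα
  choose β hβ hβ' using hβ
  refine ⟨A ⊕ B, inferInstance, Sum.elim (fun y => (α y).1) (fun y => (β y).1),
    Sum.elim (fun y => (α y).2) (fun y => (β y).2), ?_, ?_, ?_⟩
  · rintro (y | y)
    · exact hα y
    · exact hβ y
  · rw [eq_top_iff, hA']
    exact Submodule.span_mono fun y hy => ⟨.inl ⟨y, hy⟩, hα' ⟨y, hy⟩⟩
  · rw [eq_top_iff, hB']
    exact Submodule.span_mono fun y hy => ⟨.inr ⟨y, hy⟩, hβ' ⟨y, hy⟩⟩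

end Generators

section Presentation

variable {R : Type u} [CommRing R] {φ : R →+* T}

theorem exists_semilinear_of_ker_le {A B : Type u} [AddCommGroup A] [AddCommGroup B] [Module R A]
    [Module R B] {Q : Type u} [AddCommGroup Q] [Module T Q] {p : A →ₗ[R] B}
    (hp : Function.Surjective p) {q : A →ₛₗ[φ] Q} (h : ∀ a, p a = 0 → q a = 0) :
    ∃ k : B →ₛₗ[φ] Q, ∀ a, k (p a) = q a := by
  let r := Function.surjInv hp
  have hr : ∀ b, p (r b) = b := Function.surjInv_eq hp
  have hq : ∀ a b, p a = p b → q a = q b := fun a b e => by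
    rw [← sub_eq_zero, ← map_sub]
    exact h _ (by rw [map_sub, e, sub_self])
  refine ⟨{ toFun := fun b => q (r b), map_add' := ?_, map_smul' := ?_ }, fun a => hq _ _ (hr _)⟩
  · intro x y
    rw [← map_add]
    exact hq _ _ (by rw [map_add, hr, hr, hr])
  · intro c x
    rw [← map_smulₛₗ]
    exact hq _ _ (by rw [map_smul, hr, hr])

/-- Applying a ring homomorphism to the coordinates. -/
def mapCoord (φ : R →+* T) (ι : Type u) : (ι → R) →ₛₗ[φ] (ι → T) where
  toFun c i := φ (c i)
  map_add' _ _ := funext fun _ => map_add φ _ _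
  map_smul' _ _ := funext fun _ => map_mul φ _ _

@[simp] theorem mapCoord_apply {ι : Type u} (c : ι → R) (i : ι) : mapCoord φ ι c i = φ (c i) := rfl

variable {ι : Type u} [Fintype ι]

theorem semilinear_apply {M : Type u} [AddCommGroup M] [Module R M] {N : Type u} [AddCommGroup N]
    [Module T N] (h : M →ₛₗ[φ] N) (a : ι → M) (c : ι → R) :
    h (Fintype.linearCombination R a c) =
      Fintype.linearCombination T (fun i => h (a i)) (mapCoord φ ι c) := by
  simp [Fintype.linearCombination_apply]

/-- Relations after extension of scalars are generated by relations before. -/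
theorem IsCoCartesianMap.span_relations {M : Type u} [AddCommGroup M] [Module R M] {N : Type u}
    [AddCommGroup N] [Module T N] {h : M →ₛₗ[φ] N} (hh : IsCoCartesianMap h) {a : ι → M}
    (ha : Submodule.span R (Set.range a) = ⊤) {t : ι → T}
    (ht : Fintype.linearCombination T (fun i => h (a i)) t = 0) :
    t ∈ Submodule.span T (mapCoord φ ι '' LinearMap.ker (Fintype.linearCombination R a)) := by
  classical
  let K := Submodule.span T (mapCoord φ ι '' LinearMap.ker (Fintype.linearCombination R a))
  have hs : Function.Surjective (Fintype.linearCombination R a) := by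
    rw [← LinearMap.range_eq_top, Fintype.range_linearCombination, ha]
  obtain ⟨k, hk⟩ := exists_semilinear_of_ker_le hs
    (q := scomp (ψ := RingHom.id T) (σ := φ) rfl K.mkQ (mapCoord φ ι)) (fun c hc => by
      rw [scomp_apply, Submodule.mkQ_apply, Submodule.Quotient.mk_eq_zero]
      exact Submodule.subset_span ⟨c, hc, rfl⟩)
  -- Reading off coordinates defines a map from `M` to `T ^ ι / K`; its extension to `N` sends the
  -- combination with coefficients `t` to the class of `t`, so a relation lies in `K`.
  obtain ⟨l, hl⟩ := hh.exists_lift k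
  have hl' : ∀ t : ι → T, l (Fintype.linearCombination T (fun i => h (a i)) t) = K.mkQ t := by
    intro t
    have : l.comp (Fintype.linearCombination T (fun i => h (a i))) = K.mkQ := by
      refine LinearMap.pi_ext' fun i => LinearMap.ext_ring ?_
      have h1 := hk (Pi.single i 1)
      have h2 : a i = Fintype.linearCombination R a (Pi.single i 1) := by simp
      simp only [LinearMap.comp_apply, LinearMap.single_apply]
      rw [Fintype.linearCombination_apply_single, one_smul, hl, h2, h1, scomp_apply]
      congr 1
      ext j
      by_cases hij : j = i
      · subst hij; simp
      · simp [hij]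
    exact DFunLike.congr_fun this t
  have := hl' t
  rw [ht, map_zero] at this
  exact (Submodule.Quotient.mk_eq_zero _).mp this.symm

/-- A presentation with relations `s` over `R` becomes the presentation with relations `φ s`. -/
theorem exists_isCoCartesianMap_of_presentation {M : Type u} [AddCommGroup M] [Module T M]
    {a : ι → M} (ha : Submodule.span T (Set.range a) = ⊤) {κ : Type u} {s : κ → ι → R}
    (hs : Submodule.span T (Set.range fun k => mapCoord φ ι (s k)) =
      LinearMap.ker (Fintype.linearCombination T a)) :
    ∃ g : ((ι → R) ⧸ Submodule.span R (Set.range s)) →ₛₗ[φ] M, IsCoCartesianMap g ∧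
      ∀ c, g (Submodule.Quotient.mk c) = Fintype.linearCombination T a (mapCoord φ ι c) := by
  classical
  let N := (ι → R) ⧸ Submodule.span R (Set.range s)
  obtain ⟨g, hg⟩ := exists_semilinear_of_ker_le
    (p := (Submodule.span R (Set.range s)).mkQ) (Submodule.mkQ_surjective _)
    (q := scomp (ψ := RingHom.id T) (σ := φ) rfl (Fintype.linearCombination T a) (mapCoord φ ι))
    (fun c hc => by
      rw [Submodule.mkQ_apply, Submodule.Quotient.mk_eq_zero] at hc
      induction hc using Submodule.span_induction with
      | mem y h =>
        obtain ⟨k, rfl⟩ := h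
        have : mapCoord φ ι (s k) ∈ LinearMap.ker (Fintype.linearCombination T a) := by
          rw [← hs]
          exact Submodule.subset_span ⟨k, rfl⟩
        exact this
      | zero => exact map_zero _
      | add x y _ _ hx hy => rw [map_add, hx, hy, add_zero]
      | smul r x _ hx => rw [map_smulₛₗ, hx, smul_zero])
  refine ⟨g, isCoCartesianMap_of_universal ?_ fun l hl => ?_, hg⟩
  · have hsur : Function.Surjective (Fintype.linearCombination T a) := by
      rw [← LinearMap.range_eq_top, Fintype.range_linearCombination, ha]
    let e : ι → N := fun i => Submodule.Quotient.mk (Pi.single i 1)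
    have he : ∀ c : ι → R, Fintype.linearCombination T (fun i => BaseChange.unit φ (e i))
        (mapCoord φ ι c) = BaseChange.unit φ (Submodule.Quotient.mk c : N) := by
      intro c
      rw [← semilinear_apply]
      congr 1
      have : Fintype.linearCombination R e = (Submodule.span R (Set.range s)).mkQ := by
        refine LinearMap.pi_ext' fun i => LinearMap.ext_ring ?_
        simp [e]
        rfl
      exact DFunLike.congr_fun this c
    obtain ⟨k, hk⟩ := exists_semilinear_of_ker_le (φ := RingHom.id T) hsur
      (q := Fintype.linearCombination T fun i => BaseChange.unit φ (e i)) (fun c hc => by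
        have hc' : c ∈ LinearMap.ker (Fintype.linearCombination T a) := hc
        rw [← hs] at hc'
        clear hc
        induction hc' using Submodule.span_induction with
        | mem y h =>
          obtain ⟨k, rfl⟩ := h
          rw [he, (Submodule.Quotient.mk_eq_zero _).mpr (Submodule.subset_span (Set.mem_range_self k)), map_zero]
        | zero => exact map_zero _
        | add x y _ _ hx hy => rw [map_add, hx, hy, add_zero]
        | smul r x _ hx => rw [map_smulₛₗ, hx, smul_zero])
    refine ⟨k, fun m => ?_⟩
    obtain ⟨c, rfl⟩ := Submodule.Quotient.mk_surjective _ m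
    have h1 := hg c
    rw [Submodule.mkQ_apply, scomp_apply] at h1
    rw [h1, hk, he]
  · have h1 : LinearMap.eqLocus l LinearMap.id = ⊤ := by
      rw [eq_top_iff, ← ha, Submodule.span_le]
      rintro _ ⟨i, rfl⟩
      have h2 := hg (Pi.single i 1)
      have h3 : mapCoord φ ι (Pi.single i 1) = Pi.single i 1 := by
        ext j
        by_cases hij : j = i
        · subst hij; simp
        · simp [hij]
      rw [scomp_apply, h3, Fintype.linearCombination_apply_single, one_smul] at h2
      change l (a i) = a i
      rw [← h2]
      exact hl _
    exact LinearMap.eqLocus_eq_top.mp h1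

end Presentation

theorem span_range_eq_top_iff {R M : Type*} [CommRing R] [AddCommGroup M] [Module R M]
    {K : Submodule R M} {ι : Type*} {u : ι → K} :
    Submodule.span R (Set.range u) = ⊤ ↔
      Submodule.span R (Set.range fun i => (u i : M)) = K := by
  rw [← (Submodule.map_injective_of_injective K.injective_subtype).eq_iff, Submodule.map_span,
    Submodule.map_top, K.range_subtype, ← Set.range_comp]
  rfl

/-- Generators are chosen compatibly for `M'` and `M''`, then compatible generators for their
modules of relations. The coefficients of the latter agree in `T`, hence come from `S`, and the
`S`-module with these relations has `M'` and `M''` as extensions of scalars. -/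
theorem IsFormalSquare.exists_module (H : IsFormalSquare φ' φ'' ψ' ψ'' I x)
    {M' : Type u} [AddCommGroup M'] [Module T' M'] [Module.Finite T' M']
    {M'' : Type u} [AddCommGroup M''] [Module T'' M''] [Module.Finite T'' M'']
    {M : Type u} [AddCommGroup M] [Module T M] [Module.Finite T M]
    {h' : M' →ₛₗ[ψ'] M} {h'' : M'' →ₛₗ[ψ''] M} (hh' : IsCoCartesianMap h')
    (hh'' : IsCoCartesianMap h'') :
    ∃ (N : Type u) (_ : AddCommGroup N) (_ : Module S N) (g' : N →ₛₗ[φ'] M')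
      (g'' : N →ₛₗ[φ''] M''), Module.Finite S N ∧ IsCoCartesianMap g' ∧ IsCoCartesianMap g'' ∧
      ∀ n, h' (g' n) = h'' (g'' n) := by
  have := H.noeth'
  have := H.noeth''
  have := H.noeth
  obtain ⟨ι, _, a, b, hab, ha, hb⟩ := H.exists_generators hh'.span_range hh''.span_range
  have := Fintype.ofFinite ι
  let K' := LinearMap.ker (Fintype.linearCombination T' a)
  let K'' := LinearMap.ker (Fintype.linearCombination T'' b)
  let K := LinearMap.ker (Fintype.linearCombination T fun i => h' (a i))
  let k' : K' →ₛₗ[ψ'] K :=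
    { toFun := fun c => ⟨mapCoord ψ' ι c, by
        rw [LinearMap.mem_ker, ← semilinear_apply, LinearMap.mem_ker.mp c.2, map_zero]⟩
      map_add' := fun c d => Subtype.ext (map_add (mapCoord ψ' ι) _ _)
      map_smul' := fun r c => Subtype.ext (map_smulₛₗ (mapCoord ψ' ι) _ _) }
  let k'' : K'' →ₛₗ[ψ''] K :=
    { toFun := fun c => ⟨mapCoord ψ'' ι c, by
        rw [LinearMap.mem_ker, funext hab, ← semilinear_apply, LinearMap.mem_ker.mp c.2, map_zero]⟩
      map_add' := fun c d => Subtype.ext (map_add (mapCoord ψ'' ι) _ _)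
      map_smul' := fun r c => Subtype.ext (map_smulₛₗ (mapCoord ψ'' ι) _ _) }
  -- The construction of compatible generators needs only that the images span. The relation modules
  -- satisfy this because extension of scalars is right exact, without flatness of `ψ'` and `ψ''`.
  have s' : Submodule.span T (Set.range k') = ⊤ := by
    rw [span_range_eq_top_iff]
    refine le_antisymm (Submodule.span_le.mpr ?_) fun t ht => ?_
    · rintro _ ⟨c, rfl⟩
      exact (k' c).2
    · refine Submodule.span_mono ?_ (hh'.span_relations ha (LinearMap.mem_ker.mp ht))
      rintro _ ⟨c, hc, rfl⟩
      exact ⟨⟨c, hc⟩, rfl⟩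
  have s'' : Submodule.span T (Set.range k'') = ⊤ := by
    rw [span_range_eq_top_iff]
    refine le_antisymm (Submodule.span_le.mpr ?_) fun t ht => ?_
    · rintro _ ⟨c, rfl⟩
      exact (k'' c).2
    · rw [LinearMap.mem_ker, funext hab] at ht
      refine Submodule.span_mono ?_ (hh''.span_relations hb ht)
      rintro _ ⟨c, hc, rfl⟩
      exact ⟨⟨c, hc⟩, rfl⟩
  obtain ⟨κ, _, u, v, huv, hu, hv⟩ := H.exists_generators s' s''
  have hR : ∀ k i, ∃ s, φ' s = (u k).1 i ∧ φ'' s = (v k).1 i := fun k i =>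
    H.exists_eq _ _ (congrFun (congrArg Subtype.val (huv k)) i)
  choose s hs' hs'' using hR
  rw [span_range_eq_top_iff] at hu hv
  obtain ⟨g', hg', e'⟩ := exists_isCoCartesianMap_of_presentation (φ := φ') ha (s := s)
    ((congrArg (fun r => Submodule.span T' (Set.range r))
      (funext fun k => funext fun i => hs' k i)).trans hu)
  obtain ⟨g'', hg'', e''⟩ := exists_isCoCartesianMap_of_presentation (φ := φ'') hb (s := s)
    ((congrArg (fun r => Submodule.span T'' (Set.range r))
      (funext fun k => funext fun i => hs'' k i)).trans hv)
  refine ⟨_, _, _, g', g'', inferInstance, hg', hg'', fun n => ?_⟩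
  obtain ⟨c, rfl⟩ := Submodule.Quotient.mk_surjective _ n
  rw [e', e'', semilinear_apply, semilinear_apply, funext hab]
  congr 1
  ext i
  exact DFunLike.congr_fun H.comm (c i)

end Effective

/-! ### Evaluation maps of adic completions -/

section Completion

variable {L : Type u} [CommRing L]

theorem exists_eval_adicCompletion {J : Ideal L} (hJ : J.FG) (l : ℕ) :
    ∃ e : AdicCompletion J L →+* L ⧸ J ^ l,
      e.comp (algebraMap L (AdicCompletion J L)) = Ideal.Quotient.mk (J ^ l) ∧
        RingHom.ker e = (J ^ l).map (algebraMap L (AdicCompletion J L)) := by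
  refine ⟨(AdicCompletion.evalₐ J l).toRingHom, ?_, ?_⟩
  · ext x
    exact (AdicCompletion.evalₐ J l).commutes x
  · ext x
    rw [← Submodule.restrictScalars_mem L (Ideal.map _ _), ← Ideal.smul_top_eq_map, AdicCompletion.pow_smul_top_eq_ker_eval hJ, LinearMap.mem_ker,
      ← AdicCompletion.factor_evalₐ_eq_eval J _ (by simp)]
    have : Function.Injective (Ideal.Quotient.factor
        (show J ^ l ≤ J ^ l • (⊤ : Ideal L) by simp)) := by
      rw [RingHom.injective_iff_ker_eq_bot, Ideal.Quotient.factor_ker, smul_eq_mul, Ideal.mul_top,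
        Ideal.map_quotient_self]
    rw [map_eq_zero_iff _ this]
    rfl

theorem isCompletion_adicCompletion [IsNoetherianRing L] (J : Ideal L) :
    IsCompletion (algebraMap L (AdicCompletion J L)) J where
  noeth := isNoetherianRing_adicCompletion J
  jac := by
    have := AdicCompletion.isAdicComplete_self J (IsNoetherian.noetherian J)
    exact IsAdicComplete.le_jacobson_bot _
  exists_eval := exists_eval_adicCompletion (IsNoetherian.noetherian J)

/-- Applied at the corner belonging to `Y ∩ V(f)`: that ring is already complete along the ideal of
`Y`, so it needs no further completion. -/
theorem isCompletion_id [IsNoetherianRing L] (J : Ideal L) [IsAdicComplete J L] :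
    IsCompletion (RingHom.id L) J where
  noeth := ‹_›
  jac := by
    rw [Ideal.map_id]
    exact IsAdicComplete.le_jacobson_bot _
  exists_eval l := ⟨Ideal.Quotient.mk _, rfl, by rw [Ideal.map_id, Ideal.mk_ker]⟩

end Completion

/-! ### The completed localizations attached to strata -/

namespace Cell

variable {n : ℕ} {A : Type u} [CommRing A] {f : Fin n → A}

theorem contains_cut (Y : Cell n) (i : Fin n) : Y.Contains (Y.cut i) :=
  ⟨Finset.subset_insert _ _, subset_rfl⟩

theorem contains_rest (Y : Cell n) (i : Fin n) : Y.Contains (Y.rest i) :=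
  ⟨subset_rfl, Finset.subset_insert _ _⟩

instance isNoetherianRing_comp (Y : Cell n) (B : CommAlgCat.{u} A) [IsNoetherianRing B] :
    IsNoetherianRing (Y.comp f B) :=
  have : IsNoetherianRing (Y.Loc f B) := IsLocalization.isNoetherianRing
    (Submonoid.powers (algebraMap A B (∏ j ∈ Y.inv, f j))) _ ‹_›
  isNoetherianRing_adicCompletion (Y.ideal f (Y.Loc f B))

variable (f) in
theorem isNoetherianRing_wordRing [IsNoetherianRing A] (s : List (Cell n)) :
    IsNoetherianRing (wordRing f s) := by
  induction s with
  | nil => exact ‹IsNoetherianRing A›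
  | cons Y s ih => exact Y.isNoetherianRing_comp _

theorem ideal_map (Y : Cell n) {B C : Type u} [CommRing B] [Algebra A B] [CommRing C] [Algebra A C]
    (φ : B →ₐ[A] C) : (Y.ideal f B).map φ.toRingHom = Y.ideal f C := by
  rw [ideal, ideal, Ideal.map_map]
  exact congrArg (fun g => Ideal.map g _) φ.comp_algebraMap

theorem ideal_cut (Y : Cell n) (i : Fin n) (B : Type u) [CommRing B] [Algebra A B] :
    (Y.cut i).ideal f B = Y.ideal f B ⊔ Ideal.span {algebraMap A B (f i)} := by
  rw [ideal, ideal, cut, Finset.coe_insert, Set.image_insert_eq, Ideal.span_insert, Ideal.map_sup,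
    Ideal.map_span _ {f i}, Set.image_singleton, sup_comm]

variable (f) in
/-- The completion map `B[f j ⁻¹ : j ∈ inv] → lim_l B[f j ⁻¹ : j ∈ inv] / (f i : i ∈ van) ^ l`. -/
noncomputable def locToComp (Y : Cell n) (B : CommAlgCat.{u} A) : Y.Loc f B →ₐ[A] Y.comp f B :=
  IsScalarTower.toAlgHom A (Y.Loc f B) (AdicCompletion (Y.ideal f (Y.Loc f B)) (Y.Loc f B))

theorem compMap_locToComp {a b : Cell n} (h : a.Contains b) {B C : CommAlgCat.{u} A}
    (g : B →ₐ[A] C) (x : a.Loc f B) :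
    compMap h g (a.locToComp f B x) = b.locToComp f C (locMap h g x) :=
  completionMap_algebraMap (I := a.ideal f (a.Loc f B)) (J := b.ideal f (b.Loc f C))
    (locMap h g) (pow_le_comap h (locMap h g)) x

instance isNoetherianRing_loc (Y : Cell n) (B : Type u) [CommRing B] [Algebra A B]
    [IsNoetherianRing B] : IsNoetherianRing (Y.Loc f B) :=
  IsLocalization.isNoetherianRing
    (Submonoid.powers (algebraMap A B (∏ j ∈ Y.inv, f j))) _ ‹_›

theorem isCompletion_locToComp (Y : Cell n) (B : CommAlgCat.{u} A) [IsNoetherianRing B] :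
    IsCompletion (Y.locToComp f B).toRingHom (Y.ideal f (Y.Loc f B)) :=
  isCompletion_adicCompletion _

theorem isAdicComplete_comp (Y : Cell n) (B : CommAlgCat.{u} A) :
    IsAdicComplete (Y.ideal f (Y.comp f B)) (Y.comp f B) := by
  rw [← Y.ideal_map (Y.locToComp f B)]
  exact AdicCompletion.isAdicComplete_self _ (Y.ideal_fg f _)

theorem isUnit_comp (Y : Cell n) (B : CommAlgCat.{u} A) :
    IsUnit (algebraMap A (Y.comp f B) (∏ j ∈ Y.inv, f j)) := by
  rw [← (Y.locToComp f B).commutes]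
  exact (isUnit_loc (Contains.refl Y) B).map _

theorem isAway_loc (Y : Cell n) (B : Type u) [CommRing B] [Algebra A B] :
    IsAway (IsScalarTower.toAlgHom A B (Y.Loc f B)).toRingHom
      (algebraMap A B (∏ j ∈ Y.inv, f j)) := by
  have : (IsScalarTower.toAlgHom A B (Y.Loc f B)).toRingHom.toAlgebra =
      (inferInstance : Algebra B (Y.Loc f B)) := Algebra.algebra_ext _ _ fun _ => rfl
  rw [IsAway, this]
  infer_instance

theorem isAway_rest_of_isUnit {Y : Cell n} {i : Fin n} (hi : i ∉ Y.inv) (B : Type u) [CommRing B]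
    [Algebra A B] (h : IsUnit (algebraMap A B (∏ j ∈ Y.inv, f j))) :
    IsAway (IsScalarTower.toAlgHom A B ((Y.rest i).Loc f B)).toRingHom (algebraMap A B (f i)) := by
  have h0 := (Y.rest i).isAway_loc (f := f) B
  let := (IsScalarTower.toAlgHom A B ((Y.rest i).Loc f B)).toRingHom.toAlgebra
  have h1 : IsLocalization.Away (algebraMap A B (∏ j ∈ (Y.rest i).inv, f j))
    ((Y.rest i).Loc f B) := h0
  refine IsLocalization.Away.of_associated (r := algebraMap A B (∏ j ∈ (Y.rest i).inv, f j)) ?_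
  rw [rest, Finset.prod_insert hi, map_mul]
  exact associated_mul_unit_left _ _ h

/-- Inverting the product for `Y ∖ V(f i)` is inverting the one for `Y` and then `f i`; `i ∉ Y.inv`
makes the new product `f i` times the old one. -/
theorem isAway_locMap_rest {Y : Cell n} {i : Fin n} (hi : i ∉ Y.inv) (B : Type u) [CommRing B]
    [Algebra A B] : IsAway (locMap (f := f) (Y.contains_rest i) (AlgHom.id A B)).toRingHom
      (algebraMap A (Y.Loc f B) (f i)) := by
  let φ := locMap (f := f) (Y.contains_rest i) (AlgHom.id A B)
  let := φ.toRingHom.toAlgebra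
  have hφ : ∀ b : B, φ (algebraMap B _ b) = algebraMap B _ b := locMap_algebraMap _ _
  let p := algebraMap A B (∏ j ∈ Y.inv, f j)
  let q := algebraMap A B (f i)
  have hq : algebraMap A (Y.Loc f B) (f i) = algebraMap B _ q :=
    IsScalarTower.algebraMap_apply A B _ _
  have hqp : algebraMap A B (∏ j ∈ (Y.rest i).inv, f j) = q * p := by
    rw [rest, Finset.prod_insert hi, map_mul]
  have hu : IsUnit (algebraMap B ((Y.rest i).Loc f B) (q * p)) := by
    rw [← hqp]
    exact IsLocalization.Away.algebraMap_isUnit _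
  have hup : IsUnit (algebraMap B (Y.Loc f B) p) := IsLocalization.Away.algebraMap_isUnit p
  refine IsLocalization.Away.mk _ ?_ ?_ ?_
  · change IsUnit (φ _)
    rw [hq, hφ]
    rw [map_mul] at hu
    exact isUnit_of_mul_isUnit_left hu
  · intro z
    obtain ⟨k, b, hb⟩ := IsLocalization.Away.surj (algebraMap A B (∏ j ∈ (Y.rest i).inv, f j)) z
    obtain ⟨v, hv⟩ := hup.pow k
    refine ⟨k, ↑v⁻¹ * algebraMap B _ b, ?_⟩
    change z * φ _ ^ k = φ _
    have h1 : φ v * φ (↑v⁻¹ * algebraMap B _ b) = algebraMap B _ b := by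
      rw [← map_mul, Units.mul_inv_cancel_left, hφ]
    have hv' : IsUnit (φ v) := v.isUnit.map φ
    refine hv'.mul_left_cancel ?_
    have h2 := congrArg (algebraMap B ((Y.rest i).Loc f B)) hqp
    rw [map_mul] at h2
    rw [h1, ← hb, hv, map_pow, hφ, hq, hφ, h2]
    ring
  · intro y₁ y₂ hy
    suffices H : ∃ m : ℕ, algebraMap A (Y.Loc f B) (f i) ^ m * (y₁ - y₂) = 0 by
      obtain ⟨m, hm⟩ := H
      exact ⟨m, by rw [← sub_eq_zero, ← mul_sub, hm]⟩
    have hy : φ (y₁ - y₂) = 0 := by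
      rw [map_sub, sub_eq_zero]
      exact hy
    generalize y₁ - y₂ = y at hy ⊢
    obtain ⟨k, b, hb⟩ := IsLocalization.Away.surj p y
    have h1 : algebraMap B ((Y.rest i).Loc f B) b = algebraMap B _ 0 := by
      rw [← hφ, ← hb, map_mul, hy, zero_mul, map_zero]
    obtain ⟨m, hm⟩ := IsLocalization.Away.exists_of_eq
      (algebraMap A B (∏ j ∈ (Y.rest i).inv, f j)) h1
    refine ⟨m, (hup.pow (k + m)).mul_left_cancel ?_⟩
    rw [mul_zero, hqp] at hm
    have := congrArg (algebraMap B (Y.Loc f B)) hm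
    rw [map_mul, map_pow, map_mul, ← hb, map_zero] at this
    rw [mul_zero, hq, ← this]
    ring

end Cell

theorem exists_algebraMap_sub_mem {L : Type u} [CommRing L] {J : Ideal L} (hJ : J.FG)
    (t : AdicCompletion J L) (l : ℕ) :
    ∃ d : L, t - algebraMap L _ d ∈ (J ^ l).map (algebraMap L (AdicCompletion J L)) := by
  obtain ⟨e, he, hk⟩ := exists_eval_adicCompletion hJ l
  obtain ⟨d, hd⟩ := Ideal.Quotient.mk_surjective (e t)
  refine ⟨d, hk.le ?_⟩
  rw [RingHom.mem_ker, map_sub, ← hd, sub_eq_zero]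
  exact (DFunLike.congr_fun he d).symm

theorem isCoCartesianMap_ringHom {R R' : Type u} [CommRing R] [CommRing R'] (φ : R →+* R') :
    IsCoCartesianMap ({ toFun := φ, map_add' := φ.map_add, map_smul' := fun r x => by simp } :
      R →ₛₗ[φ] R') := by
  refine isCoCartesianMap_of_universal ⟨LinearMap.toSpanSingleton R' _ (BaseChange.unit φ 1),
    fun m => ?_⟩ fun k hk => LinearMap.ext_ring ?_
  · change φ m • BaseChange.unit φ (1 : R) = _
    rw [← map_smulₛₗ, smul_eq_mul, mul_one]
  · have := hk 1
    simpa using this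

/-- Gluing for the module `N = S`. -/
theorem IsGluing.exists_eq {S T T' T'' : Type u} [CommRing S] [CommRing T] [CommRing T']
    [CommRing T''] {φ' : S →+* T'} {φ'' : S →+* T''} {ψ' : T' →+* T} {ψ'' : T'' →+* T}
    (H : IsGluing φ' φ'' ψ' ψ'') (hc : ψ'.comp φ' = ψ''.comp φ'') (a : T') (b : T'')
    (h : ψ' a = ψ'' b) : ∃ s, φ' s = a ∧ φ'' s = b :=
  (H S inferInstance T' T'' T _ _ _ _ (isCoCartesianMap_ringHom φ') (isCoCartesianMap_ringHom φ'')
    (isCoCartesianMap_ringHom ψ') (isCoCartesianMap_ringHom ψ'')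
    fun s => DFunLike.congr_fun hc s).2 a b h

namespace Cell

variable {n : ℕ} {A : Type u} [CommRing A] {f : Fin n → A}

variable (f) in
/-- The localization map `B → B[f j ⁻¹ : j ∈ inv]`. -/
noncomputable def toLoc (Y : Cell n) (B : Type u) [CommRing B] [Algebra A B] : B →ₐ[A] Y.Loc f B :=
  IsScalarTower.toAlgHom A B (Y.Loc f B)

theorem loc_hom_ext {Y : Cell n} {B C : Type u} [CommRing B] [Algebra A B] [CommRing C]
    [Algebra A C] {φ ψ : Y.Loc f B →ₐ[A] C} (h : ∀ b, φ (Y.toLoc f B b) = ψ (Y.toLoc f B b)) :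
    φ = ψ := by
  apply IsLocalization.algHom_ext (Submonoid.powers (algebraMap A B (∏ i ∈ Y.inv, f i)))
  ext x
  exact h x

section Square

variable (f) (Y : Cell n) (i : Fin n) (B : CommAlgCat.{u} A)

/-- The map from a completed localization of `B` to the one along `Y ∩ V(f i)`. -/
noncomputable abbrev cutMap : Y.comp f B →ₐ[A] (Y.cut i).comp f B :=
  compMap (Y.contains_cut i) (AlgHom.id A B)

/-- The map from a completed localization of `B` to the one along `Y ∖ V(f i)`. -/
noncomputable abbrev restMap : Y.comp f B →ₐ[A] (Y.rest i).comp f B :=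
  compMap (Y.contains_rest i) (AlgHom.id A B)

/-- The map between completions along `Y ∖ V(f i)` induced by completion along `Y ∩ V(f i)`. -/
noncomputable abbrev restCutMap : (Y.rest i).comp f B →ₐ[A] (Y.rest i).comp f ((Y.cut i).comp f B) :=
  compMap (Contains.refl (Y.rest i)) ((Y.cut i).toComp f B)

/-- The uncompleted analogue of `cutMap`. -/
noncomputable abbrev locCutMap : Y.Loc f B →ₐ[A] (Y.cut i).comp f B := (Y.cut i).locToComp f B

theorem toLoc_comp_locCutMap :
    ((Y.rest i).toLoc f ((Y.cut i).comp f B)).comp (Y.locCutMap f i B) =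
      (locMap (Contains.refl (Y.rest i)) ((Y.cut i).toComp f B)).comp
        (locMap (Y.contains_rest i) (AlgHom.id A B)) := by
  refine loc_hom_ext fun b => ?_
  change _ = locMap (Contains.refl (Y.rest i)) ((Y.cut i).toComp f B)
    (locMap (Y.contains_rest i) (AlgHom.id A B) (algebraMap _ _ b))
  rw [locMap_algebraMap, locMap_algebraMap]
  rfl

/-- `Y` and `Y.cut i` invert the same functions, so they have the same localization and differ only
in the completion. -/
theorem cutMap_locToComp (x : Y.Loc f B) :
    Y.cutMap f i B (Y.locToComp f B x) = Y.locCutMap f i B x := by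
  rw [compMap_locToComp]
  congr 1
  have : (locMap (f := f) (Y.contains_cut i) (AlgHom.id A B) : Y.Loc f B →ₐ[A] Y.Loc f B) =
      AlgHom.id A (Y.Loc f B) := loc_hom_ext fun b => locMap_algebraMap (f := f) (Y.contains_cut i) _ b
  exact DFunLike.congr_fun this x

theorem toComp_comp_cutMap :
    ((Y.rest i).toComp f ((Y.cut i).comp f B)).comp (Y.cutMap f i B) =
      (Y.restCutMap f i B).comp (Y.restMap f i B) := by
  refine AlgHom.ext fun x => ?_
  have := comp_ext (f := f) (Y.contains_rest i)
    (φ := ((Y.rest i).toComp f ((Y.cut i).comp f B)).comp (Y.cutMap f i B))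
    (ψ := (Y.restCutMap f i B).comp (Y.restMap f i B)) fun x => by
      simp only [AlgHom.comp_apply, compMap_toComp, AlgHom.id_apply]
  exact DFunLike.congr_fun this x

variable [IsNoetherianRing B] {Y i}

theorem isAdicComplete_cut : IsAdicComplete (Y.ideal f ((Y.cut i).comp f B)) ((Y.cut i).comp f B) :=
  have := (Y.cut i).isAdicComplete_comp (f := f) B
  isAdicComplete_of_le (ideal_le (Y.contains_cut i) _) _

/-- Let `L` be the localization for `Y` and `I` its ideal. The square formed by `L`, its flat
completion along `I + (f i)`, and the localizations of both at `f i` is exact on modules killed by a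
power of `I`. Completing it along `I` gives the asserted square. -/
theorem isGluing_comp (hi : i ∉ Y.inv) : IsGluing (Y.cutMap f i B).toRingHom (Y.restMap f i B).toRingHom
    ((Y.rest i).toComp f ((Y.cut i).comp f B)).toRingHom (Y.restCutMap f i B).toRingHom := by
  have hc := congrArg AlgHom.toRingHom (toLoc_comp_locCutMap f Y i B)
  have h0 := isAdicComplete_cut (Y := Y) (i := i) f B
  have hic : (Y.ideal f (Y.Loc f B) ⊔ Ideal.span {algebraMap A (Y.Loc f B) (f i)}) =
    (Y.cut i).ideal f (Y.Loc f B) := (ideal_cut _ _ _).symm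
  refine isGluing_of_isCompletion (I := Y.ideal f (Y.Loc f B))
    (φ' := (Y.locCutMap f i B).toRingHom)
    (φ'' := (locMap (f := f) (Y.contains_rest i) (AlgHom.id A B)).toRingHom)
    (ψ' := ((Y.rest i).toLoc f ((Y.cut i).comp f B)).toRingHom)
    (ψ'' := (locMap (f := f) (Contains.refl (Y.rest i)) ((Y.cut i).toComp f B)).toRingHom)
    (ι := (Y.locToComp f B).toRingHom) (ι' := RingHom.id _)
    (ι'' := ((Y.rest i).locToComp f B).toRingHom)
    (ι₀ := ((Y.rest i).locToComp f ((Y.cut i).comp f B)).toRingHom) hc ?_ ?_ ?_ ?_ ?_ ?_ ?_ ?_ ?_ ?_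
  · refine exactOn_of_flat hc _ (algebraMap A _ (f i)) ?_ ?_ (isAway_locMap_rest hi B) ?_
    · have := AdicCompletion.flat_of_isNoetherian ((Y.cut i).ideal f (Y.Loc f B))
      exact RingHom.flat_algebraMap_iff.mpr this
    · rw [hic]
      exact exists_eval_adicCompletion ((Y.cut i).ideal_fg f _)
    · have := isAway_rest_of_isUnit (f := f) hi ((Y.cut i).comp f B) ((Y.cut i).isUnit_comp B)
      rwa [← (Y.locCutMap f i B).commutes (f i)] at this
  · exact Y.isCompletion_locToComp B
  · rw [ideal_map]
    exact isCompletion_id _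
  · rw [ideal_map]
    exact (Y.rest i).isCompletion_locToComp B
  · have e := Y.ideal_map (f := f)
      (((Y.rest i).toLoc f ((Y.cut i).comp f B)).comp (Y.locCutMap f i B))
    exact e ▸ (Y.rest i).isCompletion_locToComp ((Y.cut i).comp f B)
  · rw [ideal_map]
    exact Y.isAdicComplete_comp B
  · exact RingHom.ext fun x => cutMap_locToComp f Y i B x
  · exact RingHom.ext fun x => compMap_locToComp _ _ x
  · rfl
  · exact RingHom.ext fun x => compMap_locToComp _ _ x

theorem exists_locToComp_sub_mem_pow (Y : Cell n) (B : CommAlgCat.{u} A) (t : Y.comp f B) (l : ℕ) :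
    ∃ d : Y.Loc f B, t - Y.locToComp f B d ∈ Y.ideal f (Y.comp f B) ^ l := by
  rw [← Y.ideal_map (Y.locToComp f B), ← Ideal.map_pow]
  exact exists_algebraMap_sub_mem (Y.ideal_fg f (Y.Loc f B)) t l

theorem isFormalSquare_comp (hi : i ∉ Y.inv) :
    IsFormalSquare (Y.cutMap f i B).toRingHom (Y.restMap f i B).toRingHom
      ((Y.rest i).toComp f ((Y.cut i).comp f B)).toRingHom (Y.restCutMap f i B).toRingHom
      (Y.ideal f (Y.comp f B)) (algebraMap A (Y.comp f B) (f i)) := by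
  have hc := congrArg AlgHom.toRingHom (toComp_comp_cutMap f Y i B)
  have eT : (Y.ideal f (Y.comp f B)).map
      (((Y.rest i).toComp f ((Y.cut i).comp f B)).toRingHom.comp (Y.cutMap f i B).toRingHom) =
      (Y.rest i).ideal f ((Y.rest i).comp f ((Y.cut i).comp f B)) :=
    Y.ideal_map (((Y.rest i).toComp f ((Y.cut i).comp f B)).comp (Y.cutMap f i B))
  have ex : (Y.cutMap f i B).toRingHom (algebraMap A (Y.comp f B) (f i)) =
      algebraMap A ((Y.cut i).comp f B) (f i) := (Y.cutMap f i B).commutes (f i)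
  have hx : ((Y.rest i).toComp f ((Y.cut i).comp f B)).toRingHom
      (algebraMap A ((Y.cut i).comp f B) (f i)) = algebraMap A _ (f i) :=
    ((Y.rest i).toComp f ((Y.cut i).comp f B)).commutes (f i)
  let ψ := (Y.rest i).toComp f ((Y.cut i).comp f B)
  let D := (Y.rest i).Loc f ((Y.cut i).comp f B)
  let j : D →ₐ[A] _ := (Y.rest i).locToComp f ((Y.cut i).comp f B)
  have hloc : ∀ d : D, ∃ (k : ℕ) (a : (Y.cut i).comp f B),
      algebraMap A D (f i) ^ k * d = (Y.rest i).toLoc f _ a := by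
    intro d
    have h0 := isAway_rest_of_isUnit (f := f) hi ((Y.cut i).comp f B) ((Y.cut i).isUnit_comp B)
    let := (IsScalarTower.toAlgHom A ((Y.cut i).comp f B) D).toRingHom.toAlgebra
    have h1 : IsLocalization.Away (algebraMap A ((Y.cut i).comp f B) (f i)) D := h0
    obtain ⟨k, a, ha⟩ := IsLocalization.Away.surj (algebraMap A ((Y.cut i).comp f B) (f i)) d
    refine ⟨k, a, ?_⟩
    rw [mul_comm, ← ((Y.rest i).toLoc f ((Y.cut i).comp f B)).commutes]
    exact ha
  have huD : IsUnit (algebraMap A D (f i)) := by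
    refine isUnit_of_dvd_unit ?_ (isUnit_loc (Contains.refl (Y.rest i)) ((Y.cut i).comp f B))
    exact (algebraMap A D).map_dvd (Finset.dvd_prod_of_mem f (Finset.mem_insert_self _ _))
  have huL : IsUnit (algebraMap A ((Y.rest i).Loc f B) (f i)) := by
    refine isUnit_of_dvd_unit ?_ (isUnit_loc (Contains.refl (Y.rest i)) B)
    exact (algebraMap A _).map_dvd (Finset.dvd_prod_of_mem f (Finset.mem_insert_self _ _))
  have hu'' : IsUnit ((Y.restMap f i B).toRingHom (algebraMap A (Y.comp f B) (f i))) := by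
    have h1 := huL.map ((Y.rest i).locToComp f B)
    rw [AlgHom.commutes, ← (Y.restMap f i B).commutes] at h1
    exact h1
  exact
  { comm := hc
    noeth' := inferInstance
    noeth'' := inferInstance
    noeth := inferInstance
    complete' := by
      rw [ideal_map, ex, ← ideal_cut]
      exact (Y.cut i).isAdicComplete_comp B
    complete'' := by
      rw [ideal_map]
      exact (Y.rest i).isAdicComplete_comp B
    complete := eT ▸ (Y.rest i).isAdicComplete_comp ((Y.cut i).comp f B)
    isUnit'' := hu''
    exists_eq := IsGluing.exists_eq (isGluing_comp f B hi) hc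
    exists_pow := by
      intro t
      obtain ⟨d, hd⟩ := exists_locToComp_sub_mem_pow f (Y.rest i) ((Y.cut i).comp f B) t 1
      rw [pow_one] at hd
      obtain ⟨k, a, ha⟩ := hloc d
      refine ⟨k, a, ?_⟩
      rw [eT, ex, hx]
      have e : ψ.toRingHom a = algebraMap A _ (f i) ^ k * j d := by
        rw [← j.commutes, ← map_pow, ← map_mul, ha]
        rfl
      rw [e, ← mul_sub]
      exact Ideal.mul_mem_left _ _ hd
    exists_add := by
      intro t k
      obtain ⟨d, hd⟩ := exists_locToComp_sub_mem_pow f (Y.rest i) ((Y.cut i).comp f B) t 1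
      rw [pow_one] at hd
      obtain ⟨m, a, ha⟩ := hloc d
      -- Modulo the ideal of `Y`, the element `t` is `a / f ^ m`. This exponent yields `a = c + s +
      -- r f ^ (m + k)` with `s` in the ideal of `Y` and `c` uncompleted. After division by `f ^ m`,
      -- the part `c / f ^ m` comes from the open stratum and `f ^ k r` has the required
      -- divisibility.
      obtain ⟨c, hc'⟩ := exists_locToComp_sub_mem_pow f (Y.cut i) B a (1 + (m + k))
      rw [ideal_cut] at hc'
      obtain ⟨s, hs, r, hr, hsr⟩ := Submodule.mem_sup.mp (Ideal.sup_pow_add_le_pow_sup_pow hc')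
      rw [Ideal.span_singleton_pow, Ideal.mem_span_singleton'] at hr
      obtain ⟨r, rfl⟩ := hr
      rw [pow_one] at hs
      obtain ⟨v, hv⟩ := hu''.pow m
      let b₀ : (Y.rest i).comp f B :=
        (Y.rest i).locToComp f B (locMap (Y.contains_rest i) (AlgHom.id A B) c)
      have hb₀ : (Y.restCutMap f i B) b₀ = ψ ((Y.cut i).locToComp f B c) := by
        rw [compMap_locToComp]
        exact congrArg j (DFunLike.congr_fun (toLoc_comp_locCutMap f Y i B) c).symm
      refine ⟨r, ↑v⁻¹ * b₀, ?_⟩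
      rw [eT, ex]
      let F := algebraMap A ((Y.rest i).comp f ((Y.cut i).comp f B)) (f i)
      have hF : (Y.restCutMap f i B).toRingHom v = F ^ m := by
        rw [hv, map_pow]
        exact congrArg (· ^ m) ((congrArg _ ((Y.restMap f i B).commutes _)).trans
          ((Y.restCutMap f i B).commutes (f i)))
      have hFu : IsUnit (F ^ m) := hF ▸ v.isUnit.map _
      have hs' : ψ s ∈ (Y.rest i).ideal f ((Y.rest i).comp f ((Y.cut i).comp f B)) := by
        have := Ideal.mem_map_of_mem ψ.toRingHom hs
        rwa [ideal_map] at this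
      have hv₀ : F ^ m * (Y.restCutMap f i B).toRingHom (↑v⁻¹ * b₀) = (Y.restCutMap f i B) b₀ := by
        rw [← hF, ← map_mul, Units.mul_inv_cancel_left]
        rfl
      have hja : F ^ m * j d = ψ a := by
        rw [show F = j (algebraMap A D (f i)) from (j.commutes _).symm, ← map_pow, ← map_mul, ha]
        rfl
      have hψ : ψ.toRingHom (algebraMap A _ (f i) ^ k * r) = F ^ k * ψ r := by
        rw [map_mul, map_pow, hx]
        rfl
      rw [← Ideal.unit_mul_mem_iff_mem _ hFu, mul_sub, mul_sub, hv₀, hb₀, hψ]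
      have ea : a = (Y.cut i).locToComp f B c + (s + r * algebraMap A _ (f i) ^ (m + k)) := by
        rw [hsr, add_sub_cancel]
      have e : F ^ m * t - F ^ m * (F ^ k * ψ r) - ψ ((Y.cut i).locToComp f B c) =
          F ^ m * (t - j d) + ψ s := by
        rw [mul_sub, hja, ea, map_add, map_add, map_mul, map_pow, ψ.commutes]
        ring
      rw [e]
      exact add_mem (Ideal.mul_mem_left _ _ hd) hs' }

end Square
end Cell

/-- All finitely generated modules are mapped bijectively to their extensions of scalars. -/
def BijectiveOnFinite {R R' : Type u} [CommRing R] [CommRing R'] (φ : R →+* R') : Prop :=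
  ∀ (N : Type u) [AddCommGroup N] [Module R N] (N' : Type u) [AddCommGroup N'] [Module R' N']
    (g : N →ₛₗ[φ] N'), Module.Finite R N → IsCoCartesianMap g → Function.Bijective g

namespace Cell

variable {n : ℕ} {A : Type u} [CommRing A] {f : Fin n → A}

theorem locMap_comp {a b c : Cell n} (h : a.Contains b) (h' : b.Contains c) {B C D : Type u}
    [CommRing B] [Algebra A B] [CommRing C] [Algebra A C] [CommRing D] [Algebra A D]
    (g : B →ₐ[A] C) (g' : C →ₐ[A] D) :
    (locMap (f := f) h' g').comp (locMap (f := f) h g) = locMap (h.trans h') (g'.comp g) :=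
  loc_hom_ext fun b => by
    change locMap h' g' (locMap h g (algebraMap _ _ b)) = locMap _ _ (algebraMap _ _ b)
    rw [locMap_algebraMap, locMap_algebraMap, locMap_algebraMap]
    rfl

/-- Putting a stratum in front of a word is a localization followed by a completion, and gluing
survives both. -/
theorem isGluing_compMap (a : Cell n) {B B' B'' B₀ : CommAlgCat.{u} A} [IsNoetherianRing B]
    [IsNoetherianRing B'] [IsNoetherianRing B''] [IsNoetherianRing B₀] {g' : B →ₐ[A] B'}
    {g'' : B →ₐ[A] B''} {h' : B' →ₐ[A] B₀} {h'' : B'' →ₐ[A] B₀}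
    (H : IsGluing g'.toRingHom g''.toRingHom h'.toRingHom h''.toRingHom)
    (hc : h'.comp g' = h''.comp g'') :
    IsGluing (compMap (f := f) (Contains.refl a) g').toRingHom
      (compMap (f := f) (Contains.refl a) g'').toRingHom
      (compMap (f := f) (Contains.refl a) h').toRingHom
      (compMap (f := f) (Contains.refl a) h'').toRingHom := by
  have hL : ∀ {C D : CommAlgCat.{u} A} (g : C →ₐ[A] D),
      (locMap (f := f) (Contains.refl a) g).toRingHom.comp (a.toLoc f C).toRingHom =
        (a.toLoc f D).toRingHom.comp g.toRingHom := fun g =>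
    RingHom.ext fun x => locMap_algebraMap (Contains.refl a) g x
  have hK : ∀ {C D : CommAlgCat.{u} A} (g : C →ₐ[A] D),
      (compMap (f := f) (Contains.refl a) g).toRingHom.comp (a.locToComp f C).toRingHom =
        (a.locToComp f D).toRingHom.comp (locMap (f := f) (Contains.refl a) g).toRingHom := fun g =>
    RingHom.ext fun x => compMap_locToComp (Contains.refl a) g x
  have hA : ∀ {C D : CommAlgCat.{u} A} (g : C →ₐ[A] D),
      IsAway (a.toLoc f D).toRingHom (g.toRingHom (algebraMap A C (∏ j ∈ a.inv, f j))) := by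
    intro C D g
    have h1 : g.toRingHom (algebraMap A C (∏ j ∈ a.inv, f j)) = algebraMap A D _ := g.commutes _
    rw [h1]
    exact a.isAway_loc (f := f) D
  have hG := H.localize (congrArg AlgHom.toRingHom hc) (a.isAway_loc (f := f) B) (hA g') (hA g'')
    (hA (h'.comp g')) (hL g') (hL g'') (hL h') (hL h'')
  have hc₁ : (locMap (f := f) (Contains.refl a) h').toRingHom.comp
      (locMap (f := f) (Contains.refl a) g').toRingHom =
      (locMap (f := f) (Contains.refl a) h'').toRingHom.comp
        (locMap (f := f) (Contains.refl a) g'').toRingHom := by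
    have := (locMap_comp (f := f) (Contains.refl a) (Contains.refl a) g' h').trans
      ((congrArg _ hc).trans (locMap_comp (f := f) (Contains.refl a) (Contains.refl a) g'' h'').symm)
    exact congrArg AlgHom.toRingHom this
  refine isGluing_of_isCompletion (I := a.ideal f (a.Loc f B)) hc₁
    (fun l N _ _ hN _ => hG N hN) (a.isCompletion_locToComp B) ?_ ?_ ?_ ?_ (hK g') (hK g'')
    (hK h') (hK h'')
  · rw [ideal_map]
    exact a.isCompletion_locToComp B'
  · rw [ideal_map]
    exact a.isCompletion_locToComp B''
  · have e := a.ideal_map (f := f) ((locMap (f := f) (Contains.refl a) h').comp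
      (locMap (f := f) (Contains.refl a) g'))
    exact e ▸ a.isCompletion_locToComp B₀
  · rw [ideal_map]
    exact a.isAdicComplete_comp B

theorem forall₂_contains (s : List (Cell n)) : s.SublistForall₂ Contains s :=
  List.sublistForall₂_iff.mpr ⟨s, List.forall₂_same.mpr fun _ _ => Contains.refl _, .refl _⟩

theorem sublistForall₂_append {a b s t : List (Cell n)} (h : a.SublistForall₂ Contains b)
    (h' : s.SublistForall₂ Contains t) : (a ++ s).SublistForall₂ Contains (b ++ t) := by
  rw [List.sublistForall₂_iff] at h h' ⊢
  obtain ⟨x, hx, hx'⟩ := h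
  obtain ⟨y, hy, hy'⟩ := h'
  exact ⟨x ++ y, List.rel_append hx hy, hx'.append hy'⟩

variable [IsNoetherianRing A] {Y : Cell n} {i : Fin n}

/-- Induction on `s₁`, starting from the square for `Y` over `R_{s₂}`. Uniqueness of canonical maps
identifies the given arrows with those of the inductive construction. -/
theorem isGluing_wordRing (hi : i ∉ Y.inv) (s₁ s₂ : List (Cell n))
    {g' : wordRing f (s₁ ++ Y :: s₂) →ₐ[A] wordRing f (s₁ ++ Y.cut i :: s₂)}
    {g'' : wordRing f (s₁ ++ Y :: s₂) →ₐ[A] wordRing f (s₁ ++ Y.rest i :: s₂)}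
    {h' : wordRing f (s₁ ++ Y.cut i :: s₂) →ₐ[A] wordRing f (s₁ ++ Y.rest i :: Y.cut i :: s₂)}
    {h'' : wordRing f (s₁ ++ Y.rest i :: s₂) →ₐ[A] wordRing f (s₁ ++ Y.rest i :: Y.cut i :: s₂)}
    (cg' : IsCanonical _ _ g') (cg'' : IsCanonical _ _ g'') (ch' : IsCanonical _ _ h')
    (ch'' : IsCanonical _ _ h'') :
    IsGluing g'.toRingHom g''.toRingHom h'.toRingHom h''.toRingHom := by
  induction s₁ with
  | nil =>
    have := isNoetherianRing_wordRing f s₂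
    have e1 := cg'.unique (.keep (Y.contains_cut i) (.refl s₂))
    have e2 := cg''.unique (.keep (Y.contains_rest i) (.refl s₂))
    have e3 := ch'.unique (.skip (Y.rest i) (.refl _))
    have e4 := ch''.unique (.keep (Contains.refl (Y.rest i)) (.skip (Y.cut i) (.refl s₂)))
    subst e1 e2 e3 e4
    exact isGluing_comp f (wordRing f s₂) hi
  | cons a s₁ ih =>
    have := isNoetherianRing_wordRing f (s₁ ++ Y :: s₂)
    have := isNoetherianRing_wordRing f (s₁ ++ Y.cut i :: s₂)
    have := isNoetherianRing_wordRing f (s₁ ++ Y.rest i :: s₂)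
    have := isNoetherianRing_wordRing f (s₁ ++ Y.rest i :: Y.cut i :: s₂)
    have hs := forall₂_contains s₂
    obtain ⟨k', ck'⟩ := exists_isCanonical (f := f)
      (sublistForall₂_append (forall₂_contains s₁) (.cons (Y.contains_cut i) hs))
    obtain ⟨k'', ck''⟩ := exists_isCanonical (f := f)
      (sublistForall₂_append (forall₂_contains s₁) (.cons (Y.contains_rest i) hs))
    obtain ⟨l', cl'⟩ := exists_isCanonical (f := f) (sublistForall₂_append (forall₂_contains s₁)
      (.cons_right (a := Y.rest i) (.cons (Contains.refl (Y.cut i)) hs)))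
    obtain ⟨l'', cl''⟩ := exists_isCanonical (f := f) (sublistForall₂_append (forall₂_contains s₁)
      (.cons (Contains.refl (Y.rest i)) (.cons_right (a := Y.cut i) hs)))
    have e1 := cg'.unique (.keep (Contains.refl a) ck')
    have e2 := cg''.unique (.keep (Contains.refl a) ck'')
    have e3 := ch'.unique (.keep (Contains.refl a) cl')
    have e4 := ch''.unique (.keep (Contains.refl a) cl'')
    subst e1 e2 e3 e4
    exact isGluing_compMap a (ih ck' ck'' cl' cl'') ((ck'.trans cl').unique (ck''.trans cl''))

theorem isFormalSquare_wordRing (hi : i ∉ Y.inv) (s₂ : List (Cell n))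
    {g' : wordRing f (Y :: s₂) →ₐ[A] wordRing f (Y.cut i :: s₂)}
    {g'' : wordRing f (Y :: s₂) →ₐ[A] wordRing f (Y.rest i :: s₂)}
    {h' : wordRing f (Y.cut i :: s₂) →ₐ[A] wordRing f (Y.rest i :: Y.cut i :: s₂)}
    {h'' : wordRing f (Y.rest i :: s₂) →ₐ[A] wordRing f (Y.rest i :: Y.cut i :: s₂)}
    (cg' : IsCanonical _ _ g') (cg'' : IsCanonical _ _ g'') (ch' : IsCanonical _ _ h')
    (ch'' : IsCanonical _ _ h'') :
    ∃ I x, IsFormalSquare g'.toRingHom g''.toRingHom h'.toRingHom h''.toRingHom I x := by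
  have := isNoetherianRing_wordRing f s₂
  have e1 := cg'.unique (.keep (Y.contains_cut i) (.refl s₂))
  have e2 := cg''.unique (.keep (Y.contains_rest i) (.refl s₂))
  have e3 := ch'.unique (.skip (Y.rest i) (.refl _))
  have e4 := ch''.unique (.keep (Contains.refl (Y.rest i)) (.skip (Y.cut i) (.refl s₂)))
  subst e1 e2 e3 e4
  exact ⟨_, _, isFormalSquare_comp f (wordRing f s₂) hi⟩

omit [IsNoetherianRing A] in
-- A unit in the ideal of completion makes that ideal the whole ring; as it lies in the Jacobson
-- radical, the ring vanishes.
theorem subsingleton_comp_of_isUnit (Y : Cell n) (B : CommAlgCat.{u} A) {i : Fin n}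
    (hi : i ∈ Y.van) (h : IsUnit (algebraMap A B (f i))) : Subsingleton (Y.comp f B) := by
  have hu : IsUnit (algebraMap A (Y.comp f B) (f i)) := by
    rw [← (Y.toComp f B).commutes]
    exact h.map _
  have htop : Y.ideal f (Y.comp f B) = ⊤ :=
    Ideal.eq_top_of_isUnit_mem _ (Ideal.mem_map_of_mem _ (Ideal.subset_span ⟨i, hi, rfl⟩)) hu
  have := Y.isAdicComplete_comp (f := f) B
  have h1 : (1 : Y.comp f B) ∈ (⊥ : Ideal (Y.comp f B)).jacobson :=
    IsAdicComplete.le_jacobson_bot (Y.ideal f (Y.comp f B)) (htop ▸ trivial)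
  rw [Ideal.mem_jacobson_bot] at h1
  have h2 := h1 (-1)
  simp only [mul_neg, mul_one, neg_add_cancel, isUnit_zero_iff] at h2
  exact subsingleton_of_zero_eq_one h2

omit [IsNoetherianRing A] in
theorem subsingleton_wordRing_append {s₂ : List (Cell n)} (h : Subsingleton (wordRing f s₂))
    (s₁ : List (Cell n)) : Subsingleton (wordRing f (s₁ ++ s₂)) := by
  obtain ⟨g, -⟩ := exists_isCanonical (f := f) (s := s₂) (t := s₁ ++ s₂)
    (sublistForall₂_append (a := []) .nil (forall₂_contains s₂))
  exact RingHom.codomain_trivial g.toRingHom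

omit [IsNoetherianRing A] in
/-- If the stratum `Z` does not meet `V(f i)`, then `f i` is invertible on the completion
along `Z`. -/
theorem isUnit_comp_of_disjoint (Z : Cell n) (B : CommAlgCat.{u} A)
    (h : Disjoint (Z.carrier f) (PrimeSpectrum.zeroLocus {f i})) :
    IsUnit (algebraMap A (Z.comp f B) (f i)) := by
  have := Z.isAdicComplete_comp (f := f) B
  by_contra hu
  obtain ⟨M, hM, hmem⟩ := exists_max_ideal_of_mem_nonunits hu
  have hP := hM.isPrime
  -- A maximal ideal containing `f i` contracts to a point of `V(f i)`. It contains the ideal of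
  -- completion, which is in the Jacobson radical, and none of the inverted functions; so this point
  -- is in `Z`.
  let p : PrimeSpectrum A := ⟨M.comap (algebraMap A (Z.comp f B)), inferInstance⟩
  have hp : p ∈ PrimeSpectrum.zeroLocus {f i} := by simpa [p] using hmem
  refine Set.disjoint_right.mp h hp ?_
  rw [mem_carrier]
  refine ⟨fun j hj => ?_, fun j hj hjM => ?_⟩
  · have h1 : Z.ideal f (Z.comp f B) ≤ M := by
      refine (IsAdicComplete.le_jacobson_bot _).trans ?_
      exact sInf_le ⟨bot_le, hM⟩
    exact h1 (Ideal.mem_map_of_mem _ (Ideal.subset_span ⟨j, hj, rfl⟩))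
  · refine hM.ne_top (Ideal.eq_top_of_isUnit_mem _ hjM (isUnit_of_dvd_unit ?_ (Z.isUnit_comp B)))
    exact (algebraMap A _).map_dvd (Finset.dvd_prod_of_mem f hj)

omit [IsNoetherianRing A] in
theorem isUnit_wordRing_of_disjoint {s : List (Cell n)} {Z : Cell n} (hZ : Z ∈ s)
    (h : Disjoint (Z.carrier f) (PrimeSpectrum.zeroLocus {f i})) :
    IsUnit (algebraMap A (wordRing f s) (f i)) := by
  induction s with
  | nil => cases hZ
  | cons a s ih =>
    rcases List.mem_cons.mp hZ with rfl | hZ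
    · exact isUnit_comp_of_disjoint _ _ h
    · have := (ih hZ).map (wordSkip f a s)
      rwa [AlgHom.commutes] at this

/-- Both corners of the gluing square that involve `Y ∩ V(f i)` are zero, so the fibre product
reduces to the remaining factor. -/
theorem bijectiveOnFinite_of_isUnit (hi : i ∉ Y.inv) (s₁ s₂ : List (Cell n))
    (hu : IsUnit (algebraMap A (wordRing f s₂) (f i)))
    {g'' : wordRing f (s₁ ++ Y :: s₂) →ₐ[A] wordRing f (s₁ ++ Y.rest i :: s₂)}
    (cg'' : IsCanonical _ _ g'') : BijectiveOnFinite g''.toRingHom := by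
  intro N _ _ N'' _ _ g hN hg
  have hs := forall₂_contains s₂
  obtain ⟨k', ck'⟩ := exists_isCanonical (f := f)
    (sublistForall₂_append (forall₂_contains s₁) (.cons (Y.contains_cut i) hs))
  obtain ⟨l', cl'⟩ := exists_isCanonical (f := f) (sublistForall₂_append (forall₂_contains s₁)
    (.cons_right (a := Y.rest i) (.cons (Contains.refl (Y.cut i)) hs)))
  obtain ⟨l'', cl''⟩ := exists_isCanonical (f := f) (sublistForall₂_append (forall₂_contains s₁)
    (.cons (Contains.refl (Y.rest i)) (.cons_right (a := Y.cut i) hs)))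
  have z1 : Subsingleton (wordRing f (Y.cut i :: s₂)) :=
    subsingleton_comp_of_isUnit (Y.cut i) _ (Finset.mem_insert_self _ _) hu
  have z2 : Subsingleton (wordRing f (s₁ ++ Y.cut i :: s₂)) := subsingleton_wordRing_append z1 s₁
  have z3 : Subsingleton (wordRing f (s₁ ++ Y.rest i :: Y.cut i :: s₂)) :=
    RingHom.codomain_trivial l'.toRingHom
  have m1 : Subsingleton (BaseChange k'.toRingHom N) := Module.subsingleton (wordRing f (s₁ ++ Y.cut i :: s₂)) _
  have m2 : Subsingleton (BaseChange l''.toRingHom N'') :=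
    Module.subsingleton (wordRing f (s₁ ++ Y.rest i :: Y.cut i :: s₂)) _
  have hz : IsCoCartesianMap (0 : BaseChange k'.toRingHom N →ₛₗ[l'.toRingHom]
      BaseChange l''.toRingHom N'') := by
    have : Subsingleton (BaseChange l'.toRingHom (BaseChange k'.toRingHom N)) :=
      Module.subsingleton (wordRing f (s₁ ++ Y.rest i :: Y.cut i :: s₂)) _
    exact ⟨Function.injective_of_subsingleton _, fun y => ⟨0, Subsingleton.elim _ _⟩⟩
  obtain ⟨h1, h2⟩ := isGluing_wordRing hi s₁ s₂ ck' cg'' cl' cl'' N inferInstance _ _ _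
    (BaseChange.unit _) g 0 (BaseChange.unit _) isCoCartesianMap_unit hg hz isCoCartesianMap_unit
    (fun _ => Subsingleton.elim _ _)
  refine ⟨(injective_iff_map_eq_zero g).mpr fun n hn => h1 n (Subsingleton.elim _ _) hn, fun b => ?_⟩
  obtain ⟨n, -, hn⟩ := h2 0 b (Subsingleton.elim _ _)
  exact ⟨n, hn⟩

end Cell

/-! ### A descent criterion in terms of limit cones -/

namespace DiagramModule

variable {I : Type w} [Category.{v} I] {S : I ⥤ CommRingCat.{u}}
  {J : Type w} [Category.{v} J] {T : J ⥤ CommRingCat.{u}} (α : I ⥤ J) (μ : α ⋙ T ⟶ S)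

/-- The ring map `T ξ → S i` of a morphism `ξ ⟶ α i`. -/
def coneRing {ξ : J} {i : I} (ρ : ξ ⟶ α.obj i) : T.obj ξ →+* S.obj i :=
  (ringMap α μ i).comp (T.map ρ).hom

theorem coneRing_comp_map {ξ ξ' : J} {i : I} (τ : ξ ⟶ ξ') (ρ : ξ' ⟶ α.obj i) :
    coneRing α μ (τ ≫ ρ) = (coneRing α μ ρ).comp (T.map τ).hom := by
  rw [coneRing, T.map_comp]
  rfl

theorem coneRing_comp {ξ : J} {i j : I} (ρ : ξ ⟶ α.obj i) (σ : i ⟶ j) :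
    coneRing α μ (ρ ≫ α.map σ) = (S.map σ).hom.comp (coneRing α μ ρ) := by
  have := pullback_square α μ σ
  rw [coneRing, T.map_comp, coneRing, ← RingHom.comp_assoc, ← this]
  rfl

theorem coneRing_id (i : I) : coneRing α μ (𝟙 (α.obj i)) = ringMap α μ i := by
  rw [coneRing, T.map_id]
  rfl

/-- A finitely generated module over `T ξ` whose extension of scalars to `S i` is `M i`,
compatibly for all `ξ ⟶ α i`. -/
structure CoCartesianCone (M : DiagramModule S) (ξ : J) where
  /-- the module over `T ξ` -/
  pt : ModuleCat.{u} (T.obj ξ)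
  /-- the legs of the cone -/
  app {i : I} (ρ : ξ ⟶ α.obj i) : pt →ₛₗ[coneRing α μ ρ] M.obj i
  isCoCartesianMap {i : I} (ρ : ξ ⟶ α.obj i) : IsCoCartesianMap (app ρ)
  finite : Module.Finite (T.obj ξ) pt
  naturality {i j : I} (ρ : ξ ⟶ α.obj i) (σ : i ⟶ j) (x : pt) :
    M.map σ (app ρ x) = app (ρ ≫ α.map σ) x

variable {α μ}

namespace CoCartesianCone

variable {M : DiagramModule S} {ξ : J}

/-- The point of the cone is the limit of the modules `M i` over all `ξ ⟶ α i`. -/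
def IsLimit (c : CoCartesianCone α μ M ξ) : Prop :=
  ∀ y : ∀ (i : I), (ξ ⟶ α.obj i) → M.obj i,
    (∀ (i j : I) (ρ : ξ ⟶ α.obj i) (σ : i ⟶ j), M.map σ (y i ρ) = y j (ρ ≫ α.map σ)) →
      ∃! x : c.pt, ∀ (i : I) (ρ : ξ ⟶ α.obj i), c.app ρ x = y i ρ

theorem IsLimit.ext {c : CoCartesianCone α μ M ξ} (hc : c.IsLimit) {x y : c.pt}
    (h : ∀ (i : I) (ρ : ξ ⟶ α.obj i), c.app ρ x = c.app ρ y) : x = y :=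
  (hc (fun _ ρ => c.app ρ y) fun _ _ ρ σ => c.naturality ρ σ y).unique h fun _ _ => rfl

theorem IsLimit.exists_semilinear {c : CoCartesianCone α μ M ξ} (hc : c.IsLimit) {R : Type u}
    [CommRing R] {φ : R →+* T.obj ξ} {Q : Type u} [AddCommGroup Q] [Module R Q]
    (g : ∀ {i : I} (ρ : ξ ⟶ α.obj i), Q →ₛₗ[(coneRing α μ ρ).comp φ] M.obj i)
    (hg : ∀ {i j : I} (ρ : ξ ⟶ α.obj i) (σ : i ⟶ j) (x : Q),
      M.map σ (g ρ x) = g (ρ ≫ α.map σ) x) :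
    ∃ k : Q →ₛₗ[φ] c.pt, ∀ {i : I} (ρ : ξ ⟶ α.obj i) (x : Q), c.app ρ (k x) = g ρ x := by
  have h1 : ∀ x : Q, ∃ y : c.pt, ∀ (i : I) (ρ : ξ ⟶ α.obj i), c.app ρ y = g ρ x := fun x =>
    (hc (fun _ ρ => g ρ x) fun _ _ ρ σ => hg ρ σ x).exists
  choose k hk using h1
  refine ⟨{ toFun := k, map_add' := fun x y => ?_, map_smul' := fun r x => ?_ },
    fun ρ x => hk x _ ρ⟩
  · refine hc.ext fun i ρ => ?_
    rw [hk, map_add, map_add, hk, hk]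
  · refine hc.ext fun i ρ => ?_
    rw [hk, map_smulₛₗ, map_smulₛₗ, hk]
    rfl

theorem app_congr (c : CoCartesianCone α μ M ξ)
    {i : I} {ρ ρ' : ξ ⟶ α.obj i} (h : ρ = ρ') (x : c.pt) : c.app ρ x = c.app ρ' x := by
  rw [h]

/-- Extension of scalars of a cone. -/
noncomputable def extend (c : CoCartesianCone α μ M ξ) {ξ' : J} (τ : ξ ⟶ ξ') :
    CoCartesianCone α μ M ξ' where
  pt := ModuleCat.of (T.obj ξ') (BaseChange (T.map τ).hom c.pt)
  app ρ := BaseChange.semilift (coneRing_comp_map α μ τ ρ) (c.app (τ ≫ ρ))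
  isCoCartesianMap ρ := isCoCartesianMap_unit.of_comp (c.isCoCartesianMap (τ ≫ ρ))
    (coneRing_comp_map α μ τ ρ) fun m => (BaseChange.semilift_unit _ _ m).symm
  finite := by
    have := c.finite
    exact BaseChange.finite (φ := (T.map τ).hom) (M := c.pt)
  naturality {i j} ρ σ x := by
    refine isCoCartesianMap_unit.semi_ext_of_eq (M := c.pt) (φ := (T.map τ).hom)
      (coneRing_comp α μ ρ σ).symm
      (h := scomp rfl (M.map σ) (BaseChange.semilift (coneRing_comp_map α μ τ ρ) (c.app (τ ≫ ρ))))
      (k := BaseChange.semilift (coneRing_comp_map α μ τ (ρ ≫ α.map σ))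
        (c.app (τ ≫ ρ ≫ α.map σ))) (fun m => ?_) x
    rw [scomp_apply, BaseChange.semilift_unit, BaseChange.semilift_unit, c.naturality]
    exact c.app_congr (Category.assoc _ _ _) m

end CoCartesianCone

variable (α μ) in
/-- The cone of a module over `(J, T)` over its own pull-back. -/
noncomputable def coneOfPullback (N : DiagramModule T) (hN : finCoCart T N) (ξ : J) :
    CoCartesianCone α μ ((pullback α μ).obj N) ξ where
  pt := N.obj ξ
  app {i} ρ := scomp (σ := coneRing α μ ρ) rfl (BaseChange.unit (ringMap α μ i)) (N.map ρ)
  isCoCartesianMap ρ := (hN.2 ρ).comp isCoCartesianMap_unit rfl fun _ => rfl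
  finite := hN.1 ξ
  naturality {i j} ρ σ x := by
    refine (pullbackMap_unit α μ N σ (N.map ρ x)).trans ?_
    rw [← N.map_comp]
    rfl

theorem coneOfPullback_app (N : DiagramModule T) (hN : finCoCart T N) (ξ : J) {i : I}
    (ρ : ξ ⟶ α.obj i) (x : N.obj ξ) :
    (coneOfPullback α μ N hN ξ).app ρ x = BaseChange.unit (ringMap α μ i) (N.map ρ x) := rfl

theorem map_eq_self (N : DiagramModule T) {ξ : J} (x : N.obj ξ) : N.map (𝟙 ξ) x = x := N.map_id ξ x

section Equivalence

variable (H : ∀ M : DiagramModule S, finCoCart S M → ∀ (ξ : J) (c : CoCartesianCone α μ M ξ),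
  c.IsLimit)

include H

/-- Each `N₂ ξ` is the limit of the pull-back of `N₂`, so the components of `g`, composed with the
cone of `N₁`, induce maps `N₁ ξ → N₂ ξ`. -/
theorem exists_pullback_map_eq {N₁ N₂ : DiagramModule T} (h₁ : finCoCart T N₁)
    (h₂ : finCoCart T N₂) (h₂' : finCoCart S ((pullback α μ).obj N₂))
    (g : (pullback α μ).obj N₁ ⟶ (pullback α μ).obj N₂) :
    ∃ a : N₁ ⟶ N₂, (pullback α μ).map a = g := by
  have hlim := fun ξ => H _ h₂' ξ (coneOfPullback α μ N₂ h₂ ξ)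
  have h : ∀ ξ : J, ∃ k : N₁.obj ξ →ₗ[T.obj ξ] N₂.obj ξ, ∀ {i : I} (ρ : ξ ⟶ α.obj i) x,
      BaseChange.unit (ringMap α μ i) (N₂.map ρ (k x)) =
        g.app i (BaseChange.unit (ringMap α μ i) (N₁.map ρ x)) := by
    intro ξ
    obtain ⟨k, hk⟩ := (hlim ξ).exists_semilinear (φ := RingHom.id _) (Q := N₁.obj ξ)
      (fun {i} ρ => scomp (σ := (coneRing α μ ρ).comp (RingHom.id _)) (φ := coneRing α μ ρ)
        (ψ := RingHom.id _) rfl (g.app i) ((coneOfPullback α μ N₁ h₁ ξ).app ρ)) (by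
        intro i j ρ σ x
        change ((pullback α μ).obj N₂).map σ (g.app i ((coneOfPullback α μ N₁ h₁ ξ).app ρ x)) =
          g.app j ((coneOfPullback α μ N₁ h₁ ξ).app (ρ ≫ α.map σ) x)
        rw [← g.naturality]
        exact congrArg (g.app j) ((coneOfPullback α μ N₁ h₁ ξ).naturality ρ σ x))
    exact ⟨k, fun ρ x => hk ρ x⟩
  choose k hk using h
  refine ⟨{ app := k, naturality := fun {ξ ξ'} τ x => ?_ }, ?_⟩
  · refine (hlim ξ').ext fun i ρ => ?_
    rw [coneOfPullback_app, coneOfPullback_app, hk, ← N₁.map_comp, ← N₂.map_comp, hk]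
  · ext i : 1
    refine BaseChange.hom_ext fun m => ?_
    have := hk (α.obj i) (𝟙 _) m
    rw [map_eq_self, map_eq_self] at this
    exact (BaseChange.map_unit _ _).trans this

theorem pullback_map_injective {N₁ N₂ : DiagramModule T} (h₂ : finCoCart T N₂)
    (h₂' : finCoCart S ((pullback α μ).obj N₂)) {a b : N₁ ⟶ N₂}
    (h : (pullback α μ).map a = (pullback α μ).map b) : a = b := by
  ext ξ x
  refine (H _ h₂' ξ (coneOfPullback α μ N₂ h₂ ξ)).ext fun i ρ => ?_
  rw [coneOfPullback_app, coneOfPullback_app, ← a.naturality, ← b.naturality]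
  have := DFunLike.congr_fun (congrArg (fun t : (pullback α μ).obj N₁ ⟶ (pullback α μ).obj N₂ => t.app i) h) (BaseChange.unit _ (N₁.map ρ x))
  exact (BaseChange.map_unit (φ := ringMap α μ i) (a.app (α.obj i)) (N₁.map ρ x)).symm.trans
    (this.trans (BaseChange.map_unit (φ := ringMap α μ i) (b.app (α.obj i)) (N₁.map ρ x)))

/-- The points of chosen cones form the module `N`, with transition maps from the limit property.
The extension of a cone along `ξ ⟶ ξ'` is again a cone, hence a limit, and so agrees with the chosen
one at `ξ'`; therefore `N` is coCartesian. The legs at the identities of `α i` identify the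
pull-back of `N` with `M`. -/
theorem exists_pullback_iso {M : DiagramModule S} (hM : finCoCart S M)
    (hg : ∀ ξ : J, Nonempty (CoCartesianCone α μ M ξ)) :
    ∃ N : DiagramModule T, finCoCart T N ∧ Nonempty ((pullback α μ).obj N ≅ M) := by
  let c := fun ξ => (hg ξ).some
  have hc := fun ξ => H M hM ξ (c ξ)
  have h : ∀ {ξ ξ' : J} (τ : ξ ⟶ ξ'), ∃ k : (c ξ).pt →ₛₗ[(T.map τ).hom] (c ξ').pt,
      ∀ {i : I} (ρ : ξ' ⟶ α.obj i) x, (c ξ').app ρ (k x) = (c ξ).app (τ ≫ ρ) x := by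
    intro ξ ξ' τ
    obtain ⟨k, hk⟩ := (hc ξ').exists_semilinear (φ := (T.map τ).hom) (Q := (c ξ).pt)
      (fun {i} ρ => scomp (σ := (coneRing α μ ρ).comp (T.map τ).hom) (ψ := RingHom.id _)
        (coneRing_comp_map α μ τ ρ).symm LinearMap.id ((c ξ).app (τ ≫ ρ))) (by
        intro i j ρ σ x
        change M.map σ ((c ξ).app (τ ≫ ρ) x) = (c ξ).app (τ ≫ ρ ≫ α.map σ) x
        rw [(c ξ).naturality]
        exact (c ξ).app_congr (Category.assoc _ _ _) x)
    exact ⟨k, fun ρ x => hk ρ x⟩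
  choose k hk using fun (ξ ξ' : J) (τ : ξ ⟶ ξ') => h τ
  let N : DiagramModule T :=
    { obj := fun ξ => (c ξ).pt
      map := fun {ξ ξ'} τ => k ξ ξ' τ
      map_id := fun ξ x => (hc ξ).ext fun i ρ => by
        rw [hk]
        exact (c ξ).app_congr (Category.id_comp _) x
      map_comp := fun {ξ ξ' ξ''} τ τ' x => (hc ξ'').ext fun i ρ => by
        rw [hk, hk, hk]
        exact (c ξ).app_congr (Category.assoc _ _ _) x }
  have hN : finCoCart T N := by
    refine ⟨fun ξ => (c ξ).finite, fun ξ ξ' τ => ?_⟩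
    have key : ∀ {i : I} (ρ : ξ' ⟶ α.obj i) (y : BaseChange (T.map τ).hom (c ξ).pt),
        (c ξ').app ρ (BaseChange.lift (k ξ ξ' τ) y) = ((c ξ).extend τ).app ρ y := by
      intro i ρ y
      refine isCoCartesianMap_unit.semi_ext_of_eq (M := (c ξ).pt) (φ := (T.map τ).hom) rfl
        (h := ((c ξ').app ρ).comp (BaseChange.lift (k ξ ξ' τ)))
        (k := ((c ξ).extend τ).app ρ) (fun m => ?_) y
      rw [LinearMap.comp_apply, BaseChange.lift_unit, hk]
      exact (BaseChange.semilift_unit (coneRing_comp_map α μ τ ρ) ((c ξ).app (τ ≫ ρ)) m).symm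
    have he := H M hM ξ' ((c ξ).extend τ)
    constructor
    · intro x y hxy
      refine he.ext fun i ρ => ?_
      exact (key ρ x).symm.trans ((congrArg _ hxy).trans (key ρ y))
    · intro y
      obtain ⟨z, hz, -⟩ := he (fun i ρ => (c ξ').app ρ y) fun i j ρ σ => (c ξ').naturality ρ σ y
      exact ⟨z, (hc ξ').ext fun i ρ => (key ρ z).trans (hz i ρ)⟩
  let q : ∀ i, N.obj (α.obj i) →ₛₗ[ringMap α μ i] M.obj i := fun i =>
    scomp (ψ := RingHom.id _) (coneRing_id α μ i).symm LinearMap.id ((c (α.obj i)).app (𝟙 _))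
  have hq : ∀ i, IsCoCartesianMap (q i) := by
    intro i
    have : ∀ (φ : T.obj (α.obj i) →+* S.obj i) (h : φ = coneRing α μ (𝟙 (α.obj i))),
        IsCoCartesianMap (scomp (ψ := RingHom.id _) h LinearMap.id ((c (α.obj i)).app (𝟙 _))) := by
      rintro _ rfl
      exact (c (α.obj i)).isCoCartesianMap (𝟙 _)
    exact this _ _
  have hnat : ∀ {i j : I} (σ : i ⟶ j) (m : N.obj (α.obj i)),
      q j (N.map (α.map σ) m) = M.map σ (q i m) := by
    intro i j σ m
    change (c _).app (𝟙 _) (k _ _ (α.map σ) m) = M.map σ ((c _).app (𝟙 _) m)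
    rw [hk, (c _).naturality]
    exact (c _).app_congr (by rw [Category.comp_id, Category.id_comp]) m
  let e : ∀ i, ((pullback α μ).obj N).obj i ≃ₗ[S.obj i] M.obj i := fun i =>
    LinearEquiv.ofBijective (BaseChange.lift (q i)) (hq i)
  have henat : ∀ {i j : I} (σ : i ⟶ j) (x : ((pullback α μ).obj N).obj i),
      e j (((pullback α μ).obj N).map σ x) = M.map σ (e i x) := by
    intro i j σ x
    refine isCoCartesianMap_unit.semi_ext_of_eq (M := N.obj (α.obj i)) (φ := ringMap α μ i) rfl
      (h := (e j).toLinearMap.comp (((pullback α μ).obj N).map σ))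
      (k := (M.map σ).comp (e i).toLinearMap) (fun m => ?_) x
    have h1 : ((pullback α μ).obj N).map σ (BaseChange.unit _ m) = BaseChange.unit _ _ :=
      pullbackMap_unit α μ N σ m
    change BaseChange.lift (q j) (((pullback α μ).obj N).map σ (BaseChange.unit _ m)) =
      M.map σ (BaseChange.lift (q i) (BaseChange.unit _ m))
    rw [h1]
    refine (BaseChange.lift_unit (q j) _).trans ?_
    rw [BaseChange.lift_unit]
    exact hnat σ m
  refine ⟨N, hN, ⟨{ hom := { app := fun i => (e i).toLinearMap, naturality := henat }
                    inv := { app := fun i => (e i).symm.toLinearMap, naturality := ?_ }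
                    hom_inv_id := ?_
                    inv_hom_id := ?_ }⟩⟩
  · intro i j σ x
    change (e j).symm _ = _
    rw [LinearEquiv.symm_apply_eq, henat]
    exact congrArg _ ((e i).apply_symm_apply x).symm
  · ext i x
    exact (e i).symm_apply_apply x
  · ext i x
    exact (e i).apply_symm_apply x

theorem pullbackFinCoCart_isEquivalence (hg : ∀ M : DiagramModule S, finCoCart S M → ∀ ξ : J,
    Nonempty (CoCartesianCone α μ M ξ)) : (pullbackFinCoCart α μ).IsEquivalence where
  faithful := ⟨fun {N₁ N₂ a b} h => by
    have h' := congrArg InducedCategory.Hom.hom h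
    exact ObjectProperty.hom_ext _ (pullback_map_injective H N₂.property
      ((pullbackFinCoCart α μ).obj N₂).property h')⟩
  full := ⟨fun {N₁ N₂} g => by
    obtain ⟨a, ha⟩ := exists_pullback_map_eq H N₁.property N₂.property
      ((pullbackFinCoCart α μ).obj N₂).property g.hom
    exact ⟨ObjectProperty.homMk a, ObjectProperty.hom_ext _ ha⟩⟩
  essSurj := ⟨fun M => by
    obtain ⟨N, hN, ⟨e⟩⟩ := exists_pullback_iso H M.property (hg M.obj M.property)
    exact ⟨⟨N, hN⟩, ⟨ObjectProperty.isoMk _ e⟩⟩⟩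

end Equivalence
end DiagramModule

namespace DiagramModule

variable {I : Type w} [Category.{v} I] {S : I ⥤ CommRingCat.{u}}
  {J : Type w} [Category.{v} J] {T : J ⥤ CommRingCat.{u}} {α : I ⥤ J} {μ : α ⋙ T ⟶ S}
  [Quiver.IsThin I] [Quiver.IsThin J] {M : DiagramModule S} {ξ : J}

omit [Quiver.IsThin I] in
-- `ζ` is initial among the indices of the limit, which is therefore `M ζ`.
theorem isLimit_of_bijective (c : CoCartesianCone α μ M ξ) {ζ : I} (ρ₀ : ξ ⟶ α.obj ζ)
    (hζ : ∀ i : I, (ξ ⟶ α.obj i) → Nonempty (ζ ⟶ i)) (h : Function.Bijective (c.app ρ₀)) :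
    c.IsLimit := by
  intro y hy
  obtain ⟨x, hx⟩ := h.2 (y ζ ρ₀)
  refine ⟨x, fun i ρ => ?_, fun x' hx' => h.1 ((hx' ζ ρ₀).trans hx.symm)⟩
  obtain ⟨σ⟩ := hζ i ρ
  obtain rfl : ρ₀ ≫ α.map σ = ρ := Subsingleton.elim _ _
  rw [← c.naturality, hx, hy]

omit [Quiver.IsThin I] in
-- A compatible family is determined by its values at `ζ'` and `ζ''`, which agree at `ζ₀`; exactness
-- produces the element of the point.
theorem isLimit_of_exactOn (hM : M.IsCoCartesian) (c : CoCartesianCone α μ M ξ) {ζ' ζ'' ζ₀ : I}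
    (ρ' : ξ ⟶ α.obj ζ') (ρ'' : ξ ⟶ α.obj ζ'') (σ' : ζ' ⟶ ζ₀) (σ'' : ζ'' ⟶ ζ₀)
    (hζ : ∀ i : I, (ξ ⟶ α.obj i) → Nonempty (ζ' ⟶ i) ∨ Nonempty (ζ'' ⟶ i))
    (h : ExactOn (coneRing α μ ρ') (coneRing α μ ρ'') (S.map σ').hom (S.map σ'').hom c.pt) :
    c.IsLimit := by
  have e : ρ' ≫ α.map σ' = ρ'' ≫ α.map σ'' := Subsingleton.elim _ _
  obtain ⟨h1, h2⟩ := h _ _ _ (c.app ρ') (c.app ρ'') (M.map σ') (M.map σ'') (c.isCoCartesianMap ρ')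
    (c.isCoCartesianMap ρ'') (hM σ') (hM σ'') fun n => by
      rw [c.naturality, c.naturality, e]
  intro y hy
  obtain ⟨x, hx', hx''⟩ := h2 (y ζ' ρ') (y ζ'' ρ'') (by rw [hy, hy, e])
  refine ⟨x, fun i ρ => ?_, fun z hz => ?_⟩
  · rcases hζ i ρ with h | h
    · obtain ⟨σ⟩ := h
      obtain rfl : ρ' ≫ α.map σ = ρ := Subsingleton.elim _ _
      rw [← c.naturality, hx', hy]
    · obtain ⟨σ⟩ := h
      obtain rfl : ρ'' ≫ α.map σ = ρ := Subsingleton.elim _ _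
      rw [← c.naturality, hx'', hy]
  · rw [← sub_eq_zero]
    exact h1 _ (by rw [map_sub, hx', hz, sub_self]) (by rw [map_sub, hx'', hz, sub_self])

theorem exists_cone_of_bijective (hM : finCoCart S M) {ζ : I} (ρ₀ : ξ ⟶ α.obj ζ)
    (hζ : ∀ i : I, (ξ ⟶ α.obj i) → Nonempty (ζ ⟶ i))
    (h : Function.Bijective (coneRing α μ ρ₀)) : Nonempty (CoCartesianCone α μ M ξ) := by
  let e := RingEquiv.ofBijective _ h
  have he : RingHom.id (S.obj ζ) = (coneRing α μ ρ₀).comp (e.symm : S.obj ζ →+* T.obj ξ) :=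
    RingHom.ext fun x => (e.apply_symm_apply x).symm
  let q : BaseChange (e.symm : S.obj ζ →+* T.obj ξ) (M.obj ζ) →ₛₗ[coneRing α μ ρ₀] M.obj ζ :=
    BaseChange.semilift he LinearMap.id
  have hid : IsCoCartesianMap (LinearMap.id : M.obj ζ →ₗ[S.obj ζ] M.obj ζ) :=
    isCoCartesianMap_of_bijective Function.bijective_id Function.bijective_id
  have hq : IsCoCartesianMap q := isCoCartesianMap_unit.of_comp hid he fun m =>
    (BaseChange.semilift_unit he LinearMap.id m).symm
  have hs : ∀ {i : I} (ρ : ξ ⟶ α.obj i) (σ : ζ ⟶ i),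
      coneRing α μ ρ = (S.map σ).hom.comp (coneRing α μ ρ₀) := by
    intro i ρ σ
    rw [← coneRing_comp]
    exact congrArg _ (Subsingleton.elim _ _)
  have := hM.1 ζ
  exact ⟨{ pt := ModuleCat.of (T.obj ξ) (BaseChange (e.symm : S.obj ζ →+* T.obj ξ) (M.obj ζ))
           app := fun {i} ρ => scomp (hs ρ (hζ i ρ).some) (M.map (hζ i ρ).some) q
           isCoCartesianMap := fun {i} ρ =>
            hq.comp (hM.2 (hζ i ρ).some) (hs ρ (hζ i ρ).some) fun _ => rfl
           finite := BaseChange.finite (M := M.obj ζ)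
           naturality := fun {i j} ρ σ x => by
            change M.map σ (M.map _ (q x)) = M.map _ (q x)
            rw [← M.map_comp, Subsingleton.elim ((hζ i ρ).some ≫ σ) (hζ j (ρ ≫ α.map σ)).some] }⟩

/-- The legs are composed from `g'` or `g''`. If an index receives arrows from both `ζ'` and `ζ''`,
these factor over `ζ₀`, where the two choices agree by `hc`. -/
theorem exists_cone_of_square (hM : M.IsCoCartesian) {ζ' ζ'' ζ₀ : I} (ρ' : ξ ⟶ α.obj ζ')
    (ρ'' : ξ ⟶ α.obj ζ'') (σ' : ζ' ⟶ ζ₀) (σ'' : ζ'' ⟶ ζ₀)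
    (hζ : ∀ i : I, (ξ ⟶ α.obj i) → Nonempty (ζ' ⟶ i) ∨ Nonempty (ζ'' ⟶ i))
    (hζ₀ : ∀ i : I, (ζ' ⟶ i) → (ζ'' ⟶ i) → Nonempty (ζ₀ ⟶ i))
    {N : Type u} [AddCommGroup N] [Module (T.obj ξ) N] [Module.Finite (T.obj ξ) N]
    {g' : N →ₛₗ[coneRing α μ ρ'] M.obj ζ'} {g'' : N →ₛₗ[coneRing α μ ρ''] M.obj ζ''}
    (hg' : IsCoCartesianMap g') (hg'' : IsCoCartesianMap g'')
    (hc : ∀ x, M.map σ' (g' x) = M.map σ'' (g'' x)) : Nonempty (CoCartesianCone α μ M ξ) := by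
  have hs : ∀ {ζ i : I} (ρ₀ : ξ ⟶ α.obj ζ) (ρ : ξ ⟶ α.obj i) (σ : ζ ⟶ i),
      coneRing α μ ρ = (S.map σ).hom.comp (coneRing α μ ρ₀) := by
    intro ζ i ρ₀ ρ σ
    rw [← coneRing_comp]
    exact congrArg _ (Subsingleton.elim _ _)
  have hboth : ∀ {i : I} (τ' : ζ' ⟶ i) (τ'' : ζ'' ⟶ i) (x : N),
      M.map τ' (g' x) = M.map τ'' (g'' x) := by
    intro i τ' τ'' x
    obtain ⟨τ⟩ := hζ₀ i τ' τ''
    obtain rfl : σ' ≫ τ = τ' := Subsingleton.elim _ _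
    obtain rfl : σ'' ≫ τ = τ'' := Subsingleton.elim _ _
    rw [M.map_comp, M.map_comp, hc]
  have h : ∀ (i : I) (ρ : ξ ⟶ α.obj i), ∃ a : N →ₛₗ[coneRing α μ ρ] M.obj i,
      IsCoCartesianMap a ∧ (∀ (τ : ζ' ⟶ i) x, a x = M.map τ (g' x)) ∧
        ∀ (τ : ζ'' ⟶ i) x, a x = M.map τ (g'' x) := by
    intro i ρ
    rcases hζ i ρ with h | h
    · obtain ⟨σ⟩ := h
      refine ⟨scomp (hs ρ' ρ σ) (M.map σ) g', hg'.comp (hM σ) (hs ρ' ρ σ) fun _ => rfl,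
        fun τ x => ?_, fun τ x => hboth σ τ x⟩
      rw [Subsingleton.elim τ σ]
      rfl
    · obtain ⟨σ⟩ := h
      refine ⟨scomp (hs ρ'' ρ σ) (M.map σ) g'', hg''.comp (hM σ) (hs ρ'' ρ σ) fun _ => rfl,
        fun τ x => (hboth τ σ x).symm, fun τ x => ?_⟩
      rw [Subsingleton.elim τ σ]
      rfl
  choose a ha ha' ha'' using h
  exact ⟨{ pt := ModuleCat.of (T.obj ξ) N
           app := fun {i} ρ => a i ρ
           isCoCartesianMap := fun {i} ρ => ha i ρ
           finite := ‹_›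
           naturality := fun {i j} ρ σ x => by
            rcases hζ i ρ with h | h
            · obtain ⟨τ⟩ := h
              exact (congrArg (M.map σ) (ha' i ρ τ x)).trans
                ((M.map_comp _ _ _).symm.trans (ha' j _ (τ ≫ σ) x).symm)
            · obtain ⟨τ⟩ := h
              exact (congrArg (M.map σ) (ha'' i ρ τ x)).trans
                ((M.map_comp _ _ _).symm.trans (ha'' j _ (τ ≫ σ) x).symm) }⟩

end DiagramModule

instance {P : Type w} [PartialOrder P] : Quiver.IsThin (ChainCat P) := fun _ _ => inferInstance

/-! ### Chains as subsets and the geometry of the split stratum -/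

namespace ChainCat

variable {P Q : Type w} [PartialOrder P] [PartialOrder Q]

theorem nonempty_hom_iff {ξ ξ' : ChainCat P} : Nonempty (ξ ⟶ ξ') ↔ ξ.verts ⊆ ξ'.verts :=
  ⟨fun ⟨a⟩ => (Hom.sublist a).subset, fun h => nonempty_hom (sublist_of_subset h)⟩

theorem nonempty_hom_mapObj_iff {ν : P →o Q} {ξ : ChainCat Q} {ζ : ChainCat P} :
    Nonempty (ξ ⟶ (mapFunctor ν).obj ζ) ↔ ∀ y ∈ ξ.verts, ∃ x ∈ ζ.verts, ν x = y :=
  nonempty_hom_iff.trans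
    ⟨fun h y hy => (mem_mapObj ν ζ y).mp (h hy), fun h y hy => (mem_mapObj ν ζ y).mpr (h y hy)⟩

theorem ext_of_subset {ξ ξ' : ChainCat P} (h : ξ.verts ⊆ ξ'.verts) (h' : ξ'.verts ⊆ ξ.verts) :
    ξ = ξ' := by
  have := (sublist_of_subset h).antisymm (sublist_of_subset h')
  cases ξ
  cases ξ'
  cases this
  rfl

theorem lt_or_lt {ξ : ChainCat P} {x y : P} (hx : x ∈ ξ.verts) (hy : y ∈ ξ.verts) (h : x ≠ y) :
    x < y ∨ y < x := by
  obtain ⟨a, ha, rfl⟩ := List.getElem_of_mem hx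
  obtain ⟨b, hb, rfl⟩ := List.getElem_of_mem hy
  have hd := List.pairwise_iff_getElem.mp ξ.desc
  rcases lt_trichotomy a b with hab | rfl | hab
  · exact Or.inr (hd a b ha hb hab)
  · exact absurd rfl h
  · exact Or.inl (hd b a hb ha hab)

end ChainCat

namespace Stratification

variable {n : ℕ} {A : Type u} [CommRing A] {f : Fin n → A}

/-- A nonempty open subset of an irreducible space is dense. -/
theorem closure_carrier (hirr : ∀ I : Finset (Fin n), IsIrreducible (PrimeSpectrum.zeroLocus (f '' I)))
    {Z : Cell n} (hZ : (Z.carrier f).Nonempty) :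
    closure (Z.carrier f) = PrimeSpectrum.zeroLocus (f '' Z.van) := by
  refine (closure_minimal Set.sdiff_subset (PrimeSpectrum.isClosed_zeroLocus _)).antisymm ?_
  exact subset_closure_inter_of_isPreirreducible_of_isOpen (hirr Z.van).isPreirreducible
    (PrimeSpectrum.isClosed_zeroLocus {∏ j ∈ Z.inv, f j}).isOpen_compl hZ

namespace IsSplitting

variable {P' P : Stratification f} {Y : Cell n} {i : Fin n} (h : IsSplitting P' P Y i)

/-- The stratum that is split. -/
def base : P.Stratum := ⟨Y, h.mem⟩

/-- The closed part of the stratum that is split. -/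
def cutStratum : P'.Stratum := ⟨Y.cut i, by rw [h.strata_eq]; exact Finset.mem_insert_self _ _⟩

/-- The open part of the stratum that is split. -/
def restStratum : P'.Stratum :=
  ⟨Y.rest i, by
    rw [h.strata_eq]
    exact Finset.mem_insert_of_mem (Finset.mem_insert_self _ _)⟩

open Classical in
/-- The section of `ν` which selects the open part of the stratum that is split. -/
noncomputable def up (Z : P.Stratum) : P'.Stratum :=
  if hZ : Z = h.base then h.restStratum
  else ⟨Z.cell, by
    rw [h.strata_eq]
    refine Finset.mem_insert_of_mem (Finset.mem_insert_of_mem (Finset.mem_erase.mpr ⟨?_, Z.mem⟩))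
    exact fun e => hZ (Stratum.ext e)⟩

theorem up_base : h.up h.base = h.restStratum := dif_pos rfl

theorem cell_up {Z : P.Stratum} (hZ : Z ≠ h.base) : (h.up Z).cell = Z.cell := by
  rw [up, dif_neg hZ]

theorem contains_up (Z : P.Stratum) : Z.cell.Contains (h.up Z).cell := by
  by_cases hZ : Z = h.base
  · subst hZ
    rw [up_base]
    exact Y.contains_rest i
  · rw [h.cell_up hZ]
    exact Cell.Contains.refl _

theorem van_up (Z : P.Stratum) : (h.up Z).cell.van = Z.cell.van := by
  by_cases hZ : Z = h.base
  · subst hZ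
    rw [up_base]
    rfl
  · rw [h.cell_up hZ]

theorem ν_cutStratum : h.ν h.cutStratum = h.base := dif_pos (Or.inl rfl)

theorem ν_restStratum : h.ν h.restStratum = h.base := dif_pos (Or.inr rfl)

theorem eq_of_carrier {R : Stratification f} {Z W : R.Stratum} {x : PrimeSpectrum A}
    (hZ : x ∈ Z.cell.carrier f) (hW : x ∈ W.cell.carrier f) : Z = W := by
  by_contra hne
  exact Set.disjoint_left.mp (R.disjoint _ Z.mem _ W.mem fun e => hne (Stratum.ext e)) hZ hW

theorem ν_up (Z : P.Stratum) : h.ν (h.up Z) = Z := by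
  obtain ⟨x, hx⟩ := P'.nonempty _ (h.up Z).mem
  exact eq_of_carrier ((h.parent_contains (h.up Z)).carrier_subset f hx)
    ((h.contains_up Z).carrier_subset f hx)

theorem eq_up_or (W : P'.Stratum) : W = h.up (h.ν W) ∨ W = h.cutStratum := by
  by_cases h1 : W.cell = Y.cut i
  · exact Or.inr (Stratum.ext h1)
  by_cases h2 : W.cell = Y.rest i
  · left
    have : W = h.restStratum := Stratum.ext h2
    rw [this, ν_restStratum, up_base]
  · left
    have hp : (h.ν W).cell = W.cell := by
      change (h.parent W).cell = _
      rw [parent, dif_neg (not_or.mpr ⟨h1, h2⟩)]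
    obtain ⟨x, hx⟩ := P'.nonempty _ W.mem
    -- A stratum of `P'` with the data `Y` would share a point with one of the two parts, hence be
    -- that part.
    have hne : h.ν W ≠ h.base := by
      intro e
      have hY : W.cell = Y := by rw [← hp, e]; rfl
      rw [hY] at hx
      by_cases hxc : x ∈ (Y.cut i).carrier f
      · have : W = h.cutStratum := eq_of_carrier (hY ▸ hx) hxc
        exact h1 (this ▸ rfl)
      · have hxr : x ∈ (Y.rest i).carrier f := by
          rw [Cell.carrier_rest]
          exact ⟨hx, hxc⟩
        have : W = h.restStratum := eq_of_carrier (hY ▸ hx) hxr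
        exact h2 (this ▸ rfl)
    exact Stratum.ext (by rw [h.cell_up hne, hp])

theorem eq_up {W : P'.Stratum} {Z : P.Stratum} (hW : h.ν W = Z) (hZ : Z ≠ h.base) :
    W = h.up Z := by
  rcases h.eq_up_or W with e | rfl
  · rw [e, hW]
  · exact absurd (hW.symm.trans h.ν_cutStratum) hZ

include h in
theorem notMem_inv : i ∉ Y.inv := by
  intro hi
  obtain ⟨x, hx⟩ := P'.nonempty _ h.cutStratum.mem
  rw [Cell.mem_carrier] at hx
  exact hx.2 i hi (hx.1 i (Finset.mem_insert_self _ _))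

section Order

variable (hirr : ∀ I : Finset (Fin n), IsIrreducible (PrimeSpectrum.zeroLocus (f '' I)))
include hirr

/-- The closure of a stratum depends only on the functions vanishing on it, and the open part of `Y`
has the same ones as `Y`. -/
theorem up_mono {Z W : P.Stratum} (hZW : Z ≤ W) : h.up Z ≤ h.up W := by
  have h1 : Z.cell.carrier f ⊆ closure (W.cell.carrier f) := hZW
  rw [closure_carrier hirr (P.nonempty _ W.mem)] at h1
  change (h.up Z).cell.carrier f ⊆ closure ((h.up W).cell.carrier f)
  rw [closure_carrier hirr (P'.nonempty _ (h.up W).mem), van_up]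
  exact ((h.contains_up Z).carrier_subset f).trans h1

theorem up_lt {Z W : P.Stratum} (hZW : Z < W) : h.up Z < h.up W := by
  refine lt_of_le_of_ne (h.up_mono hirr hZW.le) fun e => hZW.ne ?_
  rw [← h.ν_up Z, e, h.ν_up]

theorem cutStratum_lt : h.cutStratum < h.restStratum := by
  refine lt_of_le_of_ne ?_ fun e => ?_
  · change (Y.cut i).carrier f ⊆ closure ((Y.rest i).carrier f)
    rw [closure_carrier hirr (Z := Y.rest i) (P'.nonempty _ h.restStratum.mem), Cell.carrier_cut]
    exact Set.inter_subset_left.trans Set.sdiff_subset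
  · obtain ⟨x, hx⟩ := P'.nonempty _ h.cutStratum.mem
    have hx' : x ∈ (Y.rest i).carrier f := by
      rw [e] at hx
      exact hx
    rw [Cell.carrier_rest] at hx'
    exact hx'.2 hx

/-- By irreducibility the closure of the closed part is `closure Y ∩ V(f i)`. Once `Z` meets it, `Z`
is contained in it by the frontier condition of `P'`. -/
theorem up_lt_cutStratum_or {Z : P.Stratum} (hZ : Z < h.base) : h.up Z < h.cutStratum ∨
    Disjoint (Z.cell.carrier f) (PrimeSpectrum.zeroLocus {f i}) := by
  by_cases hd : Disjoint (Z.cell.carrier f) (PrimeSpectrum.zeroLocus {f i})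
  · exact Or.inr hd
  left
  obtain ⟨x, hx, hxi⟩ := Set.not_disjoint_iff.mp hd
  have hZ' := hZ.ne
  refine lt_of_le_of_ne ?_ fun e => hZ' ?_
  · refine P'.frontier _ h.cutStratum.mem _ (h.up Z).mem ⟨x, by rwa [h.cell_up hZ'], ?_⟩
    have h1 : x ∈ closure (Y.carrier f) := hZ.le hx
    rw [closure_carrier hirr (P.nonempty _ h.mem)] at h1
    change x ∈ closure ((Y.cut i).carrier f)
    rw [closure_carrier hirr (Z := Y.cut i) (P'.nonempty _ h.cutStratum.mem), Cell.cut, Finset.coe_insert,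
      Set.image_insert_eq, Set.insert_eq, PrimeSpectrum.zeroLocus_union]
    exact ⟨hxi, h1⟩
  · rw [← h.ν_up Z, e, ν_cutStratum]

end Order

end IsSplitting
end Stratification

namespace Cell

variable {n : ℕ} {A : Type u} [CommRing A] {f : Fin n → A}

theorem IsCanonical.bijective {s t : List (Cell n)} {g : wordRing f s →ₐ[A] wordRing f t}
    (hg : IsCanonical s t g) (e : s = t) : Function.Bijective g := by
  subst e
  rw [hg.unique (.refl s)]
  exact Function.bijective_id

variable [IsNoetherianRing A] {Y : Cell n} {i : Fin n} {s₁ s₂ w w' w'' w₀ : List (Cell n)}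
    {g' : wordRing f w →ₐ[A] wordRing f w'} {g'' : wordRing f w →ₐ[A] wordRing f w''}
    {h' : wordRing f w' →ₐ[A] wordRing f w₀} {h'' : wordRing f w'' →ₐ[A] wordRing f w₀}

theorem isGluing_of_word_eq (hi : i ∉ Y.inv) (hw : w = s₁ ++ Y :: s₂)
    (hw' : w' = s₁ ++ Y.cut i :: s₂) (hw'' : w'' = s₁ ++ Y.rest i :: s₂)
    (hw₀ : w₀ = s₁ ++ Y.rest i :: Y.cut i :: s₂) (cg' : IsCanonical _ _ g')
    (cg'' : IsCanonical _ _ g'') (ch' : IsCanonical _ _ h') (ch'' : IsCanonical _ _ h'') :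
    IsGluing g'.toRingHom g''.toRingHom h'.toRingHom h''.toRingHom := by
  subst hw hw' hw'' hw₀
  exact isGluing_wordRing hi s₁ s₂ cg' cg'' ch' ch''

theorem isFormalSquare_of_word_eq (hi : i ∉ Y.inv) (hw : w = Y :: s₂)
    (hw' : w' = Y.cut i :: s₂) (hw'' : w'' = Y.rest i :: s₂)
    (hw₀ : w₀ = Y.rest i :: Y.cut i :: s₂) (cg' : IsCanonical _ _ g')
    (cg'' : IsCanonical _ _ g'') (ch' : IsCanonical _ _ h') (ch'' : IsCanonical _ _ h'') :
    ∃ I x, IsFormalSquare g'.toRingHom g''.toRingHom h'.toRingHom h''.toRingHom I x := by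
  subst hw hw' hw'' hw₀
  exact isFormalSquare_wordRing hi s₂ cg' cg'' ch' ch''

theorem bijectiveOnFinite_of_word_eq (hi : i ∉ Y.inv) (hw : w = s₁ ++ Y :: s₂)
    (hw'' : w'' = s₁ ++ Y.rest i :: s₂) (hu : IsUnit (algebraMap A (wordRing f s₂) (f i)))
    (cg'' : IsCanonical _ _ g'') : BijectiveOnFinite g''.toRingHom := by
  subst hw hw''
  exact bijectiveOnFinite_of_isUnit hi s₁ s₂ hu cg''

end Cell

/-! ### The chains of `P'` over a given chain of `P` -/

namespace Stratification.IsSplitting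

open ChainCat DiagramModule

variable {n : ℕ} {A : Type u} [CommRing A] {f : Fin n → A}
  {P' P : Stratification f} {Y : Cell n} {i : Fin n} (h : IsSplitting P' P Y i)

theorem exists_coneRing_eq {ξ : ChainCat P.Stratum} {ζ : ChainCat P'.Stratum}
    (ρ : ξ ⟶ (mapFunctor h.ν).obj ζ) :
    ∃ g : Cell.wordRing f (P.word ξ) →ₐ[A] Cell.wordRing f (P'.word ζ),
      Cell.IsCanonical _ _ g ∧ coneRing (mapFunctor h.ν) h.ringTrans ρ = g.toRingHom :=
  ⟨_, (Cell.wordMap_isCanonical (P.word_sublist ρ)).trans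
    (Cell.wordMap_isCanonical (h.word_sublist_word ζ)), rfl⟩

theorem exists_ringFunctor_map_eq {R : Stratification f}
    {ξ ζ : ChainCat R.Stratum} (σ : ξ ⟶ ζ) :
    ∃ g : Cell.wordRing f (R.word ξ) →ₐ[A] Cell.wordRing f (R.word ζ),
      Cell.IsCanonical _ _ g ∧ (R.ringFunctor.map σ).hom = g.toRingHom :=
  ⟨_, Cell.wordMap_isCanonical (R.word_sublist σ), rfl⟩

theorem map_cell_up {s : List P.Stratum} (hs : h.base ∉ s) :
    (s.map h.up).map Stratum.cell = s.map Stratum.cell := by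
  rw [List.map_map]
  refine List.map_congr_left fun Z hZ => h.cell_up ?_
  rintro rfl
  exact hs hZ

theorem up_mem {ξ : ChainCat P.Stratum} {ζ : ChainCat P'.Stratum}
    (ρ : ξ ⟶ (mapFunctor h.ν).obj ζ) {Z : P.Stratum} (hZ : Z ∈ ξ.verts) (hne : Z ≠ h.base) :
    h.up Z ∈ ζ.verts := by
  obtain ⟨x, hx, e⟩ := nonempty_hom_mapObj_iff.mp ⟨ρ⟩ Z hZ
  rwa [← h.eq_up e hne]

theorem cut_mem_or_rest_mem {ξ : ChainCat P.Stratum} {ζ : ChainCat P'.Stratum}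
    (ρ : ξ ⟶ (mapFunctor h.ν).obj ζ) (hb : h.base ∈ ξ.verts) :
    h.cutStratum ∈ ζ.verts ∨ h.restStratum ∈ ζ.verts := by
  obtain ⟨x, hx, e⟩ := nonempty_hom_mapObj_iff.mp ⟨ρ⟩ _ hb
  rcases h.eq_up_or x with e' | rfl
  · rw [e, up_base] at e'
    exact Or.inr (e' ▸ hx)
  · exact Or.inl hx

section Order

variable (hirr : ∀ I : Finset (Fin n), IsIrreducible (PrimeSpectrum.zeroLocus (f '' I)))

/-- The image of a chain under the section `up`. -/
noncomputable def upChain (ξ : ChainCat P.Stratum) : ChainCat P'.Stratum where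
  verts := ξ.verts.map h.up
  ne_nil := by simpa using ξ.ne_nil
  desc := List.pairwise_map.mpr (ξ.desc.imp fun hab => h.up_lt hirr hab)

theorem verts_upChain (ξ : ChainCat P.Stratum) :
    (h.upChain hirr ξ).verts = ξ.verts.map h.up := rfl

theorem nonempty_hom_upChain (ξ : ChainCat P.Stratum) :
    Nonempty (ξ ⟶ (mapFunctor h.ν).obj (h.upChain hirr ξ)) :=
  nonempty_hom_mapObj_iff.mpr fun y hy => ⟨h.up y, List.mem_map_of_mem hy, h.ν_up y⟩

theorem nonempty_upChain_hom {ξ : ChainCat P.Stratum} {ζ : ChainCat P'.Stratum}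
    (ρ : ξ ⟶ (mapFunctor h.ν).obj ζ) (hr : h.base ∈ ξ.verts → h.restStratum ∈ ζ.verts) :
    Nonempty (h.upChain hirr ξ ⟶ ζ) := by
  refine nonempty_hom_iff.mpr fun x hx => ?_
  obtain ⟨Z, hZ, rfl⟩ := List.mem_map.mp hx
  by_cases hne : Z = h.base
  · subst hne
    rw [up_base]
    exact hr hZ
  · exact h.up_mem ρ hZ hne

variable {ξ : ChainCat P.Stratum} {s₁ s₂ : List P.Stratum}

include h in
theorem word_eq (hs : ξ.verts = s₁ ++ h.base :: s₂) :
    P.word ξ = s₁.map Stratum.cell ++ Y :: s₂.map Stratum.cell := by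
  rw [word, hs, List.map_append, List.map_cons]
  rfl

theorem base_notMem (hs : ξ.verts = s₁ ++ h.base :: s₂) : h.base ∉ s₁ ∧ h.base ∉ s₂ := by
  have := ξ.nodup
  rw [hs, List.nodup_middle, List.nodup_cons, List.mem_append] at this
  tauto

theorem word_upChain (hs : ξ.verts = s₁ ++ h.base :: s₂) :
    P'.word (h.upChain hirr ξ) = s₁.map Stratum.cell ++ Y.rest i :: s₂.map Stratum.cell := by
  obtain ⟨h1, h2⟩ := h.base_notMem hs
  rw [word, verts_upChain, hs, List.map_append, List.map_cons, List.map_append, List.map_cons,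
    h.map_cell_up h1, h.map_cell_up h2, up_base]
  rfl

theorem word_upChain_of_notMem (hb : h.base ∉ ξ.verts) :
    P'.word (h.upChain hirr ξ) = P.word ξ :=
  h.map_cell_up hb

theorem lt_base_of_mem (hs : ξ.verts = s₁ ++ h.base :: s₂) :
    (∀ z ∈ s₁, h.base < z) ∧ ∀ z ∈ s₂, z < h.base := by
  have := ξ.desc
  rw [hs, List.pairwise_append, List.pairwise_cons] at this
  exact ⟨fun z hz => this.2.2 z hz _ (List.mem_cons_self), fun z hz => this.2.1.1 z hz⟩

include hirr in
/-- The chains over a chain that meets the split stratum, if all its smaller members are in the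
closure of the closed part. -/
theorem exists_square (hs : ξ.verts = s₁ ++ h.base :: s₂)
    (hlt : ∀ z ∈ s₂, h.up z < h.cutStratum) :
    ∃ (ζ' ζ'' ζ₀ : ChainCat P'.Stratum) (_ : ξ ⟶ (mapFunctor h.ν).obj ζ')
      (_ : ξ ⟶ (mapFunctor h.ν).obj ζ'') (_ : ζ' ⟶ ζ₀) (_ : ζ'' ⟶ ζ₀),
      P'.word ζ' = s₁.map Stratum.cell ++ Y.cut i :: s₂.map Stratum.cell ∧
      P'.word ζ'' = s₁.map Stratum.cell ++ Y.rest i :: s₂.map Stratum.cell ∧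
      P'.word ζ₀ = s₁.map Stratum.cell ++ Y.rest i :: Y.cut i :: s₂.map Stratum.cell ∧
      (∀ j, (ξ ⟶ (mapFunctor h.ν).obj j) → Nonempty (ζ' ⟶ j) ∨ Nonempty (ζ'' ⟶ j)) ∧
      ∀ j, (ζ' ⟶ j) → (ζ'' ⟶ j) → Nonempty (ζ₀ ⟶ j) := by
  obtain ⟨n1, n2⟩ := h.base_notMem hs
  have hcr := h.cutStratum_lt hirr
  have hup := (h.upChain hirr ξ).desc
  have hv : (h.upChain hirr ξ).verts = s₁.map h.up ++ h.restStratum :: s₂.map h.up := by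
    rw [verts_upChain, hs, List.map_append, List.map_cons, up_base]
  rw [hv] at hup
  have hc : ∀ z ∈ s₁.map h.up, h.restStratum < z := fun z hz =>
    (List.pairwise_append.mp hup).2.2 z hz _ List.mem_cons_self
  have hc2 : ∀ z ∈ s₂.map h.up, z < h.cutStratum := by
    intro z hz
    obtain ⟨y, hy, rfl⟩ := List.mem_map.mp hz
    exact hlt y hy
  obtain ⟨d1, d2, d3⟩ := List.pairwise_append.mp hup
  have d2' := (List.pairwise_cons.mp d2).2
  have d4 : (h.cutStratum :: s₂.map h.up).Pairwise (· > ·) := List.pairwise_cons.mpr ⟨hc2, d2'⟩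
  -- Here `hlt` is needed: it places the closed part above all members of `s₂`. The third chain
  -- `ζ''` is `upChain`, and `ζ₀` is the union of the two.
  let ζ' : ChainCat P'.Stratum :=
    { verts := s₁.map h.up ++ h.cutStratum :: s₂.map h.up
      ne_nil := by simp
      desc := List.pairwise_append.mpr ⟨d1, d4, fun a ha b hb => by
        rcases List.mem_cons.mp hb with rfl | hb
        · exact hcr.trans (hc a ha)
        · exact d3 a ha b (List.mem_cons_of_mem _ hb)⟩ }
  let ζ₀ : ChainCat P'.Stratum :=
    { verts := s₁.map h.up ++ h.restStratum :: h.cutStratum :: s₂.map h.up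
      ne_nil := by simp
      desc := List.pairwise_append.mpr ⟨d1, List.pairwise_cons.mpr ⟨fun b hb => by
          rcases List.mem_cons.mp hb with rfl | hb
          · exact hcr
          · exact (hc2 b hb).trans hcr, d4⟩, fun a ha b hb => by
        rcases List.mem_cons.mp hb with rfl | hb
        · exact hc a ha
        rcases List.mem_cons.mp hb with rfl | hb
        · exact hcr.trans (hc a ha)
        · exact d3 a ha b (List.mem_cons_of_mem _ hb)⟩ }
  have hbm : h.base ∈ ξ.verts := by simp [hs]
  obtain ⟨ρ'⟩ : Nonempty (ξ ⟶ (mapFunctor h.ν).obj ζ') := by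
    refine nonempty_hom_mapObj_iff.mpr fun y hy => ?_
    by_cases hne : y = h.base
    · exact ⟨h.cutStratum, by simp [ζ'], hne ▸ h.ν_cutStratum⟩
    · refine ⟨h.up y, ?_, h.ν_up y⟩
      rw [hs, List.mem_append, List.mem_cons] at hy
      rcases hy with hy | hy | hy
      · exact List.mem_append_left _ (List.mem_map_of_mem hy)
      · exact absurd hy hne
      · exact List.mem_append_right _ (List.mem_cons_of_mem _ (List.mem_map_of_mem hy))
  obtain ⟨ρ''⟩ := h.nonempty_hom_upChain hirr ξ
  obtain ⟨σ'⟩ : Nonempty (ζ' ⟶ ζ₀) := nonempty_hom_iff.mpr fun x hx => by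
    rcases List.mem_append.mp hx with hx | hx
    · exact List.mem_append_left _ hx
    · exact List.mem_append_right _ (List.mem_cons_of_mem _ hx)
  obtain ⟨σ''⟩ : Nonempty (h.upChain hirr ξ ⟶ ζ₀) := nonempty_hom_iff.mpr fun x hx => by
    rw [hv] at hx
    rcases List.mem_append.mp hx with hx | hx
    · exact List.mem_append_left _ hx
    rcases List.mem_cons.mp hx with hx | hx
    · exact List.mem_append_right _ (hx ▸ List.mem_cons_self)
    · exact List.mem_append_right _ (List.mem_cons_of_mem _ (List.mem_cons_of_mem _ hx))
  refine ⟨ζ', h.upChain hirr ξ, ζ₀, ρ', ρ'', σ', σ'', ?_, h.word_upChain hirr hs, ?_, ?_, ?_⟩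
  · rw [word, List.map_append, List.map_cons, h.map_cell_up n1, h.map_cell_up n2]
    rfl
  · rw [word, List.map_append, List.map_cons, List.map_cons, h.map_cell_up n1, h.map_cell_up n2]
    rfl
  · intro j ρ
    rcases h.cut_mem_or_rest_mem ρ hbm with hm | hm
    · left
      refine nonempty_hom_iff.mpr fun x hx => ?_
      have hup : ∀ y ∈ s₁ ++ s₂, h.up y ∈ j.verts := by
        intro y hy
        refine h.up_mem ρ ?_ ?_
        · rw [hs, List.mem_append, List.mem_cons]
          rcases List.mem_append.mp hy with hy | hy <;> tauto
        · rintro rfl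
          rcases List.mem_append.mp hy with hy | hy
          · exact n1 hy
          · exact n2 hy
      rcases List.mem_append.mp hx with hx | hx
      · obtain ⟨y, hy, rfl⟩ := List.mem_map.mp hx
        exact hup y (List.mem_append_left _ hy)
      rcases List.mem_cons.mp hx with rfl | hx
      · exact hm
      · obtain ⟨y, hy, rfl⟩ := List.mem_map.mp hx
        exact hup y (List.mem_append_right _ hy)
    · exact Or.inr (h.nonempty_upChain_hom hirr ρ fun _ => hm)
  · intro j τ' τ''
    have t' := nonempty_hom_iff.mp ⟨τ'⟩
    have t'' := nonempty_hom_iff.mp ⟨τ''⟩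
    refine nonempty_hom_iff.mpr fun x hx => ?_
    rcases List.mem_append.mp hx with hx | hx
    · exact t' (List.mem_append_left _ hx)
    rcases List.mem_cons.mp hx with rfl | hx
    · exact t'' (by rw [hv]; exact List.mem_append_right _ List.mem_cons_self)
    · exact t' (List.mem_append_right _ hx)

end Order

end Stratification.IsSplitting

namespace Stratification.IsSplitting

open ChainCat DiagramModule

variable {n : ℕ} {A : Type u} [CommRing A] {f : Fin n → A}
  {P' P : Stratification f} {Y : Cell n} {i : Fin n} (h : IsSplitting P' P Y i)
  (hirr : ∀ I : Finset (Fin n), IsIrreducible (PrimeSpectrum.zeroLocus (f '' I)))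

/-- If a chain over the split stratum contains a smaller stratum which does not meet `V(f i)`, then
the chains over it contain the open part of the split stratum. -/
theorem rest_mem {ξ : ChainCat P.Stratum} {ζ : ChainCat P'.Stratum}
    (ρ : ξ ⟶ (mapFunctor h.ν).obj ζ) (hb : h.base ∈ ξ.verts) {z : P.Stratum} (hz : z ∈ ξ.verts)
    (hlt : z < h.base) (hn : ¬ h.up z < h.cutStratum) : h.restStratum ∈ ζ.verts := by
  refine (h.cut_mem_or_rest_mem ρ hb).resolve_left fun hc => ?_
  have hne : h.up z ≠ h.cutStratum := fun e => hlt.ne (by rw [← h.ν_up z, e, ν_cutStratum])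
  rcases lt_or_lt (h.up_mem ρ hz hlt.ne) hc hne with hl | hl
  · exact hn hl
  -- If the closed part were below `up z`, applying `ν` would put the split stratum below `z`.
  · have := h.ν.monotone hl.le
    rw [ν_cutStratum, ν_up] at this
    exact this.not_gt hlt

include hirr

variable [IsNoetherianRing A]

/-- There are three kinds of `ξ`. If the smaller members are in the closure of the closed part, the
limit is the fibre product of a gluing square. If one of them misses `V(f i)`, only chains with the
open part occur, and `f i` is already invertible. If `ξ` does not contain `Y`, its word is
unchanged. -/
theorem cone_isLimit (M : DiagramModule P'.ringFunctor) (hM : finCoCart P'.ringFunctor M)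
    (ξ : ChainCat P.Stratum) (c : CoCartesianCone (mapFunctor h.ν) h.ringTrans M ξ) :
    c.IsLimit := by
  have hfin := c.finite
  obtain ⟨ρ₀⟩ := h.nonempty_hom_upChain hirr ξ
  obtain ⟨g, cg, eg⟩ := h.exists_coneRing_eq ρ₀
  have hco := c.isCoCartesianMap ρ₀
  by_cases hb : h.base ∈ ξ.verts
  · obtain ⟨s₁, s₂, hs⟩ := List.append_of_mem hb
    by_cases hlt : ∀ z ∈ s₂, h.up z < h.cutStratum
    · obtain ⟨ζ', ζ'', ζ₀, ρ', ρ'', σ', σ'', w', w'', w₀, hcov, -⟩ := h.exists_square hirr hs hlt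
      obtain ⟨g', cg', eg'⟩ := h.exists_coneRing_eq ρ'
      obtain ⟨g'', cg'', eg''⟩ := h.exists_coneRing_eq ρ''
      obtain ⟨k', ck', ek'⟩ := exists_ringFunctor_map_eq σ'
      obtain ⟨k'', ck'', ek''⟩ := exists_ringFunctor_map_eq σ''
      have H : IsGluing (coneRing (mapFunctor h.ν) h.ringTrans ρ')
          (coneRing (mapFunctor h.ν) h.ringTrans ρ'') (P'.ringFunctor.map σ').hom
          (P'.ringFunctor.map σ'').hom := by
        rw [eg', eg'', ek', ek'']
        exact Cell.isGluing_of_word_eq h.notMem_inv (h.word_eq hs) w' w'' w₀ cg' cg'' ck' ck''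
      exact isLimit_of_exactOn hM.2 c ρ' ρ'' σ' σ'' hcov (H c.pt hfin)
    · push Not at hlt
      obtain ⟨z, hz, hn⟩ := hlt
      have hzb := (h.lt_base_of_mem hs).2 z hz
      have hzξ : z ∈ ξ.verts := by simp [hs, hz]
      refine isLimit_of_bijective c ρ₀ (fun j ρ => h.nonempty_upChain_hom hirr ρ fun _ =>
        h.rest_mem ρ hb hzξ hzb hn) ?_
      have hd := (h.up_lt_cutStratum_or hirr hzb).resolve_left hn
      have hu := Cell.isUnit_wordRing_of_disjoint (f := f) (s := s₂.map Stratum.cell)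
        (List.mem_map_of_mem hz) hd
      have H : BijectiveOnFinite (coneRing (mapFunctor h.ν) h.ringTrans ρ₀) := by
        rw [eg]
        exact Cell.bijectiveOnFinite_of_word_eq h.notMem_inv (h.word_eq hs)
          (h.word_upChain hirr hs) hu cg
      exact H _ _ _ hfin hco
  · refine isLimit_of_bijective c ρ₀ (fun j ρ => h.nonempty_upChain_hom hirr ρ fun hb' =>
      absurd hb' hb) (hco.bijective_of_bijective ?_)
    rw [eg]
    exact cg.bijective (h.word_upChain_of_notMem hirr hb).symm

theorem exists_cone_base (M : DiagramModule P'.ringFunctor) (hM : finCoCart P'.ringFunctor M)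
    {ξ : ChainCat P.Stratum} (hξ : ξ.verts = [h.base]) :
    Nonempty (CoCartesianCone (mapFunctor h.ν) h.ringTrans M ξ) := by
  have hs : ξ.verts = [] ++ h.base :: [] := hξ
  obtain ⟨ζ', ζ'', ζ₀, ρ', ρ'', σ', σ'', w', w'', w₀, hcov, hcov₀⟩ :=
    h.exists_square hirr hs (by simp)
  obtain ⟨g', cg', eg'⟩ := h.exists_coneRing_eq ρ'
  obtain ⟨g'', cg'', eg''⟩ := h.exists_coneRing_eq ρ''
  obtain ⟨k', ck', ek'⟩ := exists_ringFunctor_map_eq σ'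
  obtain ⟨k'', ck'', ek''⟩ := exists_ringFunctor_map_eq σ''
  obtain ⟨I, x, hsq⟩ : ∃ I x, IsFormalSquare (coneRing (mapFunctor h.ν) h.ringTrans ρ')
      (coneRing (mapFunctor h.ν) h.ringTrans ρ'') (P'.ringFunctor.map σ').hom
      (P'.ringFunctor.map σ'').hom I x := by
    rw [eg', eg'', ek', ek'']
    exact Cell.isFormalSquare_of_word_eq h.notMem_inv (h.word_eq hs) w' w'' w₀ cg' cg'' ck' ck''
  have := hM.1 ζ'
  have := hM.1 ζ''
  have := hM.1 ζ₀
  obtain ⟨N, _, _, a', a'', hN, ha', ha'', hc⟩ := hsq.exists_module (hM.2 σ') (hM.2 σ'')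
  exact exists_cone_of_square hM.2 ρ' ρ'' σ' σ'' hcov hcov₀ ha' ha'' hc

/-- Glueing of modules is needed only over the chain with the single member `Y`: it is a face of
every chain containing `Y`, and cones can be extended along such maps. -/
theorem exists_cone (M : DiagramModule P'.ringFunctor) (hM : finCoCart P'.ringFunctor M)
    (ξ : ChainCat P.Stratum) :
    Nonempty (CoCartesianCone (mapFunctor h.ν) h.ringTrans M ξ) := by
  by_cases hb : h.base ∈ ξ.verts
  · let ξ₀ : ChainCat P.Stratum := ⟨[h.base], by simp, by simp⟩
    obtain ⟨c⟩ := h.exists_cone_base hirr M hM (ξ := ξ₀) rfl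
    obtain ⟨τ⟩ : Nonempty (ξ₀ ⟶ ξ) := nonempty_hom_iff.mpr (by simpa [ξ₀] using hb)
    exact ⟨c.extend τ⟩
  · obtain ⟨ρ₀⟩ := h.nonempty_hom_upChain hirr ξ
    obtain ⟨g, cg, eg⟩ := h.exists_coneRing_eq ρ₀
    refine exists_cone_of_bijective hM ρ₀ (fun j ρ => h.nonempty_upChain_hom hirr ρ fun hb' =>
      absurd hb' hb) ?_
    rw [eg]
    exact cg.bijective (h.word_upChain_of_notMem hirr hb).symm

end Stratification.IsSplitting

/-! ### The fibration property -/

namespace ChainCat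

variable {P Q : Type w} [PartialOrder P] [PartialOrder Q]

/-- The chosen `ζ` is the full preimage of `η` in `ξ`; being the largest subchain over `η`, it is
the source of the cartesian lift. -/
theorem exists_chain_over (ν : P →o Q) {η : ChainCat Q} {ξ : ChainCat P}
    (a : η ⟶ (mapFunctor ν).obj ξ) :
    ∃ ζ : ChainCat P, (mapFunctor ν).obj ζ = η ∧
      ∀ x, x ∈ ζ.verts ↔ x ∈ ξ.verts ∧ ν x ∈ η.verts := by
  classical
  have ha := nonempty_hom_mapObj_iff.mp ⟨a⟩
  let ζ : ChainCat P :=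
    { verts := ξ.verts.filter fun x => ν x ∈ η.verts
      ne_nil := by
        obtain ⟨y, hy⟩ := List.exists_mem_of_ne_nil _ η.ne_nil
        obtain ⟨x, hx, rfl⟩ := ha y hy
        exact List.ne_nil_of_mem (List.mem_filter.mpr ⟨hx, by simpa using hy⟩)
      desc := ξ.desc.filter _ }
  have hζ : ∀ x, x ∈ ζ.verts ↔ x ∈ ξ.verts ∧ ν x ∈ η.verts := fun x => by simp [ζ]
  refine ⟨ζ, ext_of_subset (fun y hy => ?_) fun y hy => ?_, hζ⟩
  · obtain ⟨x, hx, rfl⟩ := (mem_mapObj ν ζ y).mp hy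
    exact ((hζ x).mp hx).2
  · obtain ⟨x, hx, rfl⟩ := ha y hy
    exact (mem_mapObj ν ζ _).mpr ⟨x, (hζ x).mpr ⟨hx, hy⟩, rfl⟩

theorem isHomLift (ν : P →o Q) {ξ ζ : ChainCat P}
    (g : (mapFunctor ν).obj ξ ⟶ (mapFunctor ν).obj ζ) (a : ξ ⟶ ζ) :
    (mapFunctor ν).IsHomLift g a := by
  rw [Subsingleton.elim g ((mapFunctor ν).map a)]
  infer_instance

theorem isFibered_mapFunctor (ν : P →o Q) : (mapFunctor ν).IsFibered := by
  refine Functor.IsFibered.of_exists_isStronglyCartesian fun ξ η a => ?_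
  obtain ⟨ζ, rfl, hζ⟩ := exists_chain_over ν a
  obtain ⟨φ⟩ : Nonempty (ζ ⟶ ξ) := nonempty_hom_iff.mpr fun x hx => ((hζ x).mp hx).1
  have hφ := isHomLift ν a φ
  refine ⟨ζ, φ, { universal_property' := fun {ξ'} g b _ => ?_ }⟩
  -- A chain that maps to `ξ` and whose image is a face of `ν ζ` consists of members of this
  -- preimage. Uniqueness is automatic because there is at most one morphism between two chains.
  obtain ⟨χ⟩ : Nonempty (ξ' ⟶ ζ) := nonempty_hom_iff.mpr fun x hx =>
    (hζ x).mpr ⟨nonempty_hom_iff.mp ⟨b⟩ hx,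
      nonempty_hom_iff.mp ⟨g⟩ ((mem_mapObj ν ξ' _).mpr ⟨x, hx, rfl⟩)⟩
  exact ⟨χ, ⟨isHomLift ν g χ, Subsingleton.elim _ _⟩, fun _ _ => Subsingleton.elim _ _⟩

end ChainCat

end FormalDescent

theorem mainTheorem4 {A : Type u} [CommRing A] [IsRegularRing A] {n : ℕ} (f : Fin n → A)
    (hD : FormalDescent.IsStrictNormalCrossings (Ideal.span {∏ i, f i}))
    (p : PrimeSpectrum A)
    (hp : FormalDescent.IsPartOfMinimalGenerators
      (fun i => algebraMap A (Localization.AtPrime p.asIdeal) (f i)))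
    (hirr : ∀ I : Finset (Fin n), IsIrreducible (PrimeSpectrum.zeroLocus (f '' I)))
    (P' P : FormalDescent.Stratification f) (Y : FormalDescent.Cell n) (i : Fin n)
    (h : P'.IsSplitting P Y i) :
    (FormalDescent.ChainCat.mapFunctor h.ν).IsFibered ∧
    (FormalDescent.DiagramModule.pullbackFinCoCart
      (FormalDescent.ChainCat.mapFunctor h.ν) h.ringTrans).IsEquivalence := by
  have hA : IsNoetherianRing A := inferInstance
  refine ⟨FormalDescent.ChainCat.isFibered_mapFunctor h.ν, ?_⟩
  exact FormalDescent.DiagramModule.pullbackFinCoCart_isEquivalence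
    (fun M hM ξ c => h.cone_isLimit hirr M hM ξ c) fun M hM ξ => h.exists_cone hirr M hM ξ
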